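/- For $n\in\mathbb N$ and real $m\in[0,n^3]$ let $\boldsymbol H\sim\mathcal H_3(m,n)$ be the random 3-uniform hypergraph on $[n]$ in which each of the $n^3$ ordered triples $U\in[n]^3$ is a hyperedge independently with probability $m/n^3$. A 3XOR instance on a hypergraph $H$ assigns a sign $b_U\in\{\pm1\}$ to each hyperedge $U\in H$; an assignment $x\in\{\pm1\}^n$ satisfies the constraint $U$ if $x_{U_1}x_{U_2}x_{U_3}=b_U$, and is $(1-\eta)$-satisfying if it satisfies at least $(1-\eta)|H|$ of the constraints. A diameter-$d$ cluster is a Hamming ball $\{x\in\{\pm1\}^n : \mathrm{dist}(c,x)\le d/2\}$ with centre $c\in\{\pm1\}^n$. **Theorem.** There are universal constants $\eta_0>0$ and $C>0$ such that for every constant $\delta\in(0,2)$ there is a deterministic polynomial-time algorithm $\mathcal A$ with the following properties. Its input is a hypergraph $H\subseteq[n]^3$ together with the number $\lfloor\eta|H|\rfloor$ of constraints that may be violated and the cluster radius $\lfloor d/2\rfloor$, and its output is a natural number. Polynomial time is measured on a random access machine with logarithmic cost, and means polynomial in $n$ and the bit lengths of the two integers. 1. (Certification.) For every $n$, every $H\subseteq[n]^3$,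 all real $\eta,d\ge0$ and every 3XOR instance on $H$, the $(1-\eta)$-satisfying assignments are covered by at most $\mathcal A(H,\lfloor\eta|H|\rfloor,\lfloor d/2\rfloor)$ diameter-$d$ clusters. 2. (Bound.) Let $\Delta=n^\delta$, $m=\Delta n$ and $\theta=\max(2\eta,\ \Delta^{-1/2}\log n)$. For every $K\in\mathbb N$ there is $n_0$ such that for all $n\ge n_0$ and all $\eta\in[0,\eta_0]$, with probability at least $1-n^{-K}$ over $\boldsymbol H\sim\mathcal H_3(m,n)$, $$\mathcal A\big(\boldsymbol H,\lfloor\eta|\boldsymbol H|\rfloor,\lfloor\theta n/2\rfloor\big)\ \le\ \exp\!\big(C\,\theta^2\log(1/\theta)\,n\big).$$ In particular, with probability at least $1-1/\mathrm{poly}(n)$ the algorithm certifies, simultaneously for all 3XOR instances on $\boldsymbol H$, that the $(1-\eta)$-satisfying assignments are covered by $\exp(O(\theta^2\log(1/\theta))n)$ clusters of diameter $\theta n$. -/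

import Mathlib

open ProbabilityTheory MeasureTheory

/-! ### 3-uniform hypergraphs, 3XOR instances, clusters -/

/-- A 3-uniform hypergraph on the vertex set `[n]`: a set of ordered triples in `[n]³`
(triples with repeated vertices are allowed). -/
abbrev Hypergraph3 (n : ℕ) : Type := Set (Fin 3 → Fin n)

/-- The random 3-uniform hypergraph on `[n]` with expected number of hyperedges `m`: each of the
`n³` triples is included independently with probability `m / n³`.  (The projection to `[0, 1]` does
nothing when `0 ≤ m ≤ n³`.) -/
noncomputable def randomHypergraph3 (n : ℕ) (m : ℝ) : Measure (Hypergraph3 n) :=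
  setBernoulli Set.univ (Set.projIcc (0 : ℝ) 1 zero_le_one (m / (n : ℝ) ^ 3))

/-- A 3XOR instance on the hypergraph `H`: a sign in `{±1}` for every hyperedge of `H`. -/
abbrev XORInstance {n : ℕ} (H : Hypergraph3 n) : Type := H → ℤˣ

/-- An assignment `x ∈ {±1}ⁿ`. -/
abbrev Assignment (n : ℕ) : Type := Fin n → ℤˣ

/-- The number of constraints `x_{U 0} · x_{U 1} · x_{U 2} = b U`, `U ∈ H`, satisfied by `x`. -/
noncomputable def XORInstance.numSat {n : ℕ} {H : Hypergraph3 n} (b : XORInstance H)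
    (x : Assignment n) : ℕ :=
  {U : H | ∏ i, x (U.1 i) = b U}.ncard

/-- The set of `(1 - η)`-satisfying assignments: those that satisfy at least a `1 - η` fraction of
the constraints. -/
def XORInstance.approxSolutions {n : ℕ} {H : Hypergraph3 n} (b : XORInstance H) (η : ℝ) :
    Set (Assignment n) :=
  {x | (1 - η) * (H.ncard : ℝ) ≤ (b.numSat x : ℝ)}

/-- The diameter-`d` cluster around `c`: the Hamming ball of radius `d / 2`. -/
def cluster {n : ℕ} (c : Assignment n) (d : ℝ) : Set (Assignment n) :=
  {x | (hammingDist c x : ℝ) ≤ d / 2}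

/-- `S` is covered by at most `N` diameter-`d` clusters. -/
def CoveredByClusters {n : ℕ} (S : Set (Assignment n)) (d : ℝ) (N : ℕ) : Prop :=
  ∃ centers : Finset (Assignment n), centers.card ≤ N ∧ S ⊆ ⋃ c ∈ centers, cluster c d

/-- `θ = max (2η, Δ^{-1/2} log n)`. -/
noncomputable def clusterScale (n : ℕ) (Δ η : ℝ) : ℝ :=
  max (2 * η) (Δ ^ (-(1 / 2) : ℝ) * Real.log n)

/-! ### Random access machines with logarithmic cost

Deterministic structured programs over a random access memory whose cells hold natural numbers.
Every operation is charged the bit lengths of its operands (the logarithmic cost criterion), so that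
polynomial time here agrees with polynomial time on Turing machines. -/

namespace RAM

/-- A memory: `M a i` is the content of the cell with address `i` in bank `a`. A program mentions
only finitely many banks. -/
abbrev Memory : Type := ℕ → ℕ → ℕ

/-- Arithmetic expressions; `read a i` is indirect addressing. -/
inductive Expr : Type
  | const (k : ℕ) : Expr
  | read (a : ℕ) (i : Expr) : Expr
  | add (e f : Expr) : Expr
  | sub (e f : Expr) : Expr
  | mul (e f : Expr) : Expr
  | div (e f : Expr) : Expr

/-- The value of an expression; subtraction is truncated, division is integer division. -/
def Expr.eval (M : Memory) : Expr → ℕ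
  | .const k => k
  | .read a i => M a (i.eval M)
  | .add e f => e.eval M + f.eval M
  | .sub e f => e.eval M - f.eval M
  | .mul e f => e.eval M * f.eval M
  | .div e f => e.eval M / f.eval M

/-- The logarithmic cost of evaluating an expression. -/
def Expr.cost (M : Memory) : Expr → ℕ
  | .const k => Nat.size k + 1
  | .read a i => i.cost M + Nat.size (i.eval M) + Nat.size (M a (i.eval M)) + 1
  | .add e f => e.cost M + f.cost M + Nat.size (e.eval M) + Nat.size (f.eval M) + 1
  | .sub e f => e.cost M + f.cost M + Nat.size (e.eval M) + Nat.size (f.eval M) + 1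
  | .mul e f => e.cost M + f.cost M + Nat.size (e.eval M) + Nat.size (f.eval M) + 1
  | .div e f => e.cost M + f.cost M + Nat.size (e.eval M) + Nat.size (f.eval M) + 1

/-- Programs; a guard counts as true when its value is not `0`. -/
inductive Prog : Type
  | skip : Prog
  | write (a : ℕ) (i e : Expr) : Prog
  | seq (p q : Prog) : Prog
  | ite (g : Expr) (p q : Prog) : Prog
  | loop (g : Expr) (p : Prog) : Prog

/-- `Run p M M' t`: started in memory `M`, the program `p` halts in memory `M'` at total
cost `t`. -/
inductive Run : Prog → Memory → Memory → ℕ → Prop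
  | skip (M : Memory) : Run .skip M M 1
  | write (M : Memory) (a : ℕ) (i e : Expr) :
      Run (.write a i e) M
        (Function.update M a (Function.update (M a) (i.eval M) (e.eval M)))
        (i.cost M + e.cost M + Nat.size (i.eval M) + Nat.size (e.eval M) + 1)
  | seq {p q : Prog} {M M' M'' : Memory} {s t : ℕ} :
      Run p M M' s → Run q M' M'' t → Run (.seq p q) M M'' (s + t)
  | ite_true {g : Expr} {p q : Prog} {M M' : Memory} {t : ℕ} :
      g.eval M ≠ 0 → Run p M M' t → Run (.ite g p q) M M' (g.cost M + t + 1)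
  | ite_false {g : Expr} {p q : Prog} {M M' : Memory} {t : ℕ} :
      g.eval M = 0 → Run q M M' t → Run (.ite g p q) M M' (g.cost M + t + 1)
  | loop_done {g : Expr} {p : Prog} {M : Memory} :
      g.eval M = 0 → Run (.loop g p) M M (g.cost M + 1)
  | loop_step {g : Expr} {p : Prog} {M M' M'' : Memory} {s t : ℕ} :
      g.eval M ≠ 0 → Run p M M' s → Run (.loop g p) M' M'' t →
        Run (.loop g p) M M'' (g.cost M + s + t + 1)

end RAM

/-! ### Certification algorithms -/

/-- What a certification algorithm computes: from a hypergraph `H` on `[n]`, a number `t` (how many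
constraints an assignment may violate) and a radius `r`, a natural number. -/
abbrev Certifier : Type := (n : ℕ) → Hypergraph3 n → ℕ → ℕ → ℕ

open Classical in
/-- The input memory: bank `0` holds `n, t, r`, bank `1` holds the `0/1` adjacency tensor of `H`, and
all other cells are `0`. -/
noncomputable def inputMemory (n : ℕ) (H : Hypergraph3 n) (t r : ℕ) : RAM.Memory
  | 0, 0 => n
  | 0, 1 => t
  | 0, 2 => r
  | 1, i => if ∃ U ∈ H, i = ((U 0 : ℕ) * n + (U 1 : ℕ)) * n + (U 2 : ℕ) then 1 else 0
  | _, _ => 0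

/-- `𝒜` is computed by a program that halts on every input, with the output in cell `0` of bank
`2`, at a cost polynomial in `n` and the bit lengths of `t` and `r`. -/
def Certifier.IsPolyTime (𝒜 : Certifier) : Prop :=
  ∃ (p : RAM.Prog) (P : Polynomial ℕ), ∀ (n : ℕ) (H : Hypergraph3 n) (t r : ℕ),
    ∃ (M : RAM.Memory) (T : ℕ), RAM.Run p (inputMemory n H t r) M T ∧
      M 2 0 = 𝒜 n H t r ∧ T ≤ P.eval (n + Nat.size t + Nat.size r)

/-- Soundness of the certificates: on *every* hypergraph `H` and for *every* 3XOR instance on `H`,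
the output bounds the number of diameter-`d` clusters needed to cover the `(1 - η)`-satisfying
assignments.  The integer inputs `⌊η |H|⌋` and `⌊d / 2⌋` carry all the information in `η` and `d` that
matters, as numbers of violated constraints and Hamming distances are integers. -/
def Certifier.IsSound (𝒜 : Certifier) : Prop :=
  ∀ (n : ℕ) (H : Hypergraph3 n) (η d : ℝ), 0 ≤ η → 0 ≤ d → ∀ b : XORInstance H,
    CoveredByClusters (b.approxSolutions η) d (𝒜 n H ⌊η * (H.ncard : ℝ)⌋₊ ⌊d / 2⌋₊)

/-! ### The operator norm of a real matrix and the entries of its powers -/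

namespace XORCert

section MatrixNorm

open scoped Matrix Matrix.Norms.L2Operator

variable {ι : Type*} [Fintype ι] [DecidableEq ι]

/-! Let `x` and `y` each violate at most `t` of the `m` constraints, and let them differ on a set
`D` of `αn` vertices. A hyperedge with an odd number of positions in `D` is violated by `x` or by
`y`, so at most `2t` hyperedges are odd. If the degrees and the projected graphs of `H` are
pseudorandom, inclusion-exclusion gives about `3αm` odd hyperedges for small `α`, and almost all
hyperedges are odd for `α` near `1`. When `t ≤ m/1000`, this forces `αm ≤ t` if `α ≤ 1/20` and
excludes `α ≥ 19/20` (`Certified.hammingDist_le`).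

Intermediate `α` is handled by guessing few values of `x`. Among the `n` cyclic windows of `s`
vertices, one carries at most the average share `st/n` of the constraints violated by `x`. Label `x`
by such a window and by its values there; there are `n * 2 ^ s` labels. If `x` and `y` share a
label, a hyperedge whose first vertex lies in the window is odd exactly when `D` separates its other
two vertices. These pairs form a graph of average degree about `d = sm/n²`. If its centered
adjacency matrix has norm at most `d/100`, the cut of `D` has close to a `2α(1-α)` fraction of the
edges, too many for intermediate `α` (`Certified.hammingDist_le_of_window`). Hence equal labels
imply small distance, and the fibres of the labelling are the clusters.

The norm is certified by integers: the sum of the squared entries of `(B * Bᵀ) ^ k` lies between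
`‖B‖ ^ (4k)` and `n * ‖B‖ ^ (4k)`, and for `k = n.size` the factor `n` costs only a constant in the
norm. For a random hypergraph the expected moment is bounded by revealing the labels along a closed
walk (`abs_integral_walkSum_le`), and Markov's inequality succeeds as soon as `d` is of order `log²
n`. Since `θ²Δ ≥ log² n`, a window of about `θ²n/4` vertices suffices, which gives `exp(O(θ²n))`
clusters if `δ ≤ 1`. For `δ > 1` the factor `n` alone may exceed the claimed bound, but then windows
of one vertex are already pseudorandom, and summing over all vertices where `x` and `y` agree yields
a single cluster (`Certified.hammingDist_le_of_one`).

For the running time, all computations are carried out modulo `W = 2 ^ (50n² + 1)`, so that no cell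
grows. The compared quantities are nonnegative integers below `W`, so their residues determine them.
-/

lemma norm_pow_of_isSelfAdjoint {E : Type*} [NormedRing E] [StarRing E] [CStarRing E]
    {x : E} (hx : IsSelfAdjoint x) {k : ℕ} (hk : k ≠ 0) : ‖x ^ k‖ = ‖x‖ ^ k := by
  refine le_antisymm (norm_pow_le' x (Nat.pos_of_ne_zero hk)) ?_
  rcases eq_or_ne (‖x‖) 0 with h0 | h0
  · rw [h0, zero_pow hk]; exact norm_nonneg _
  have hpos : 0 < ‖x‖ := lt_of_le_of_ne (norm_nonneg _) (Ne.symm h0)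
  -- The C*-identity gives equality for exponents that are powers of two. Padding `x ^ k` to the
  -- exponent `2 ^ k` and cancelling `‖x‖ ^ (2 ^ k - k)` gives the lower bound for `k`.
  have hlt : k < 2 ^ k := Nat.lt_two_pow_self
  have h1 : ‖x‖ ^ (2 ^ k) = ‖x ^ (2 ^ k)‖ := (hx.norm_pow_two_pow k).symm
  have h2 : x ^ (2 ^ k) = x ^ k * x ^ (2 ^ k - k) := by rw [← pow_add]; congr 1; omega
  have h3 : ‖x‖ ^ (2 ^ k) = ‖x‖ ^ k * ‖x‖ ^ (2 ^ k - k) := by rw [← pow_add]; congr 1; omega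
  have h4 : ‖x ^ (2 ^ k)‖ ≤ ‖x ^ k‖ * ‖x‖ ^ (2 ^ k - k) := by
    rw [h2]
    refine (norm_mul_le _ _).trans ?_
    gcongr
    exact norm_pow_le' x (by omega)
  rw [← h1, h3] at h4
  exact le_of_mul_le_mul_right h4 (by positivity)

lemma dotProduct_mulVec_le (A : Matrix ι ι ℝ) (u v : ι → ℝ) :
    |u ⬝ᵥ A *ᵥ v| ≤ ‖A‖ * (√(∑ i, u i ^ 2) * √(∑ i, v i ^ 2)) := by
  have h := Matrix.inner_toEuclideanCLM A (WithLp.toLp 2 u) (WithLp.toLp 2 v)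
  have h2 := abs_real_inner_le_norm (WithLp.toLp 2 u)
    (Matrix.toEuclideanCLM (𝕜 := ℝ) A (WithLp.toLp 2 v))
  rw [h] at h2
  refine h2.trans ?_
  have h3 := (Matrix.toEuclideanCLM (n := ι) (𝕜 := ℝ) A).le_opNorm (WithLp.toLp 2 v)
  rw [Matrix.l2_opNorm_toEuclideanCLM] at h3
  have hu : ‖WithLp.toLp 2 u‖ = √(∑ i, u i ^ 2) := by simp [EuclideanSpace.norm_eq]
  have hv : ‖WithLp.toLp 2 v‖ = √(∑ i, v i ^ 2) := by simp [EuclideanSpace.norm_eq]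
  rw [hv] at h3
  rw [hu]
  calc _ ≤ √(∑ i, u i ^ 2) * (‖A‖ * √(∑ i, v i ^ 2)) := by gcongr
    _ = _ := by ring

lemma norm_sq_le_sum_sq (A : Matrix ι ι ℝ) : ‖A‖ ^ 2 ≤ ∑ i, ∑ j, A i j ^ 2 := by
  have hS : 0 ≤ ∑ i, ∑ j, A i j ^ 2 := by positivity
  have : ‖A‖ ≤ √(∑ i, ∑ j, A i j ^ 2) := by
    rw [← Matrix.l2_opNorm_toEuclideanCLM]
    refine ContinuousLinearMap.opNorm_le_bound _ (by positivity) fun x => ?_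
    rw [EuclideanSpace.norm_eq, EuclideanSpace.norm_eq, ← Real.sqrt_mul hS]
    refine Real.sqrt_le_sqrt ?_
    rw [Finset.sum_mul]
    refine Finset.sum_le_sum fun i _ => ?_
    rw [Matrix.ofLp_toEuclideanCLM, Real.norm_eq_abs, sq_abs]
    simp only [Real.norm_eq_abs, sq_abs]
    exact Finset.sum_mul_sq_le_sq_mul_sq _ _ _
  calc ‖A‖ ^ 2 ≤ √(∑ i, ∑ j, A i j ^ 2) ^ 2 := by gcongr
    _ = _ := Real.sq_sqrt hS

lemma sum_sq_le_card_mul_norm_sq (A : Matrix ι ι ℝ) :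
    ∑ i, ∑ j, A i j ^ 2 ≤ Fintype.card ι * ‖A‖ ^ 2 := by
  rw [Finset.sum_comm]
  have : ∀ j : ι, ∑ i, A i j ^ 2 ≤ ‖A‖ ^ 2 := fun j => by
    have h := (Matrix.toEuclideanCLM (n := ι) (𝕜 := ℝ) A).le_opNorm
      (WithLp.toLp 2 (Pi.single j 1))
    rw [Matrix.l2_opNorm_toEuclideanCLM, Matrix.toEuclideanCLM_toLp] at h
    have h1 : ‖WithLp.toLp 2 (Pi.single j (1 : ℝ) : ι → ℝ)‖ = 1 := by simp
    rw [h1, mul_one, EuclideanSpace.norm_eq] at h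
    rw [← Real.sqrt_le_left (norm_nonneg _)]
    refine le_trans (Real.sqrt_le_sqrt (le_of_eq ?_)) h
    simp
  calc _ ≤ ∑ _j : ι, ‖A‖ ^ 2 := Finset.sum_le_sum fun j _ => this j
    _ = _ := by simp

lemma isSelfAdjoint_mul_transpose (A : Matrix ι ι ℝ) : IsSelfAdjoint (A * Aᵀ) := by
  rw [isSelfAdjoint_iff, Matrix.star_eq_conjTranspose, Matrix.conjTranspose_eq_transpose_of_trivial,
    Matrix.transpose_mul, Matrix.transpose_transpose]

lemma norm_mul_transpose_pow (A : Matrix ι ι ℝ) {k : ℕ} (hk : k ≠ 0) :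
    ‖(A * Aᵀ) ^ k‖ = ‖A‖ ^ (2 * k) := by
  rw [norm_pow_of_isSelfAdjoint (isSelfAdjoint_mul_transpose A) hk]
  have : ‖A * Aᵀ‖ = ‖A‖ ^ 2 := by
    have h := Matrix.l2_opNorm_conjTranspose_mul_self Aᵀ
    have h2 := Matrix.l2_opNorm_conjTranspose A
    rw [Matrix.conjTranspose_eq_transpose_of_trivial] at h h2
    rw [Matrix.transpose_transpose] at h
    rw [h, h2, sq]
  rw [this, pow_mul]

/-- The Frobenius norm dominates the operator norm. This direction makes the moment test sound;
`sum_sq_le_card_mul_norm_pow` is the converse, with the loss of a dimension factor, and makes random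
hypergraphs pass it. -/
lemma norm_pow_le_sum_sq (A : Matrix ι ι ℝ) {k : ℕ} (hk : k ≠ 0) :
    ‖A‖ ^ (4 * k) ≤ ∑ i, ∑ j, ((A * Aᵀ) ^ k) i j ^ 2 := by
  refine le_trans (le_of_eq ?_) (norm_sq_le_sum_sq _)
  rw [norm_mul_transpose_pow A hk, ← pow_mul]; ring_nf

lemma norm_le_of_sum_sq_le (A : Matrix ι ι ℝ) {k : ℕ} (hk : k ≠ 0) {R : ℝ} (hR : 0 ≤ R)
    (h : ∑ i, ∑ j, ((A * Aᵀ) ^ k) i j ^ 2 ≤ R ^ (4 * k)) : ‖A‖ ≤ R :=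
  le_of_pow_le_pow_left₀ (by omega) hR ((norm_pow_le_sum_sq A hk).trans h)

lemma sum_sq_le_card_mul_norm_pow (A : Matrix ι ι ℝ) {k : ℕ} (hk : k ≠ 0) :
    ∑ i, ∑ j, ((A * Aᵀ) ^ k) i j ^ 2 ≤ Fintype.card ι * ‖A‖ ^ (4 * k) := by
  refine (sum_sq_le_card_mul_norm_sq _).trans (le_of_eq ?_)
  rw [norm_mul_transpose_pow A hk, ← pow_mul]; ring_nf

lemma norm_const_le (c : ℝ) : ‖(Matrix.of fun _ _ => c : Matrix ι ι ℝ)‖ ≤ Fintype.card ι * |c| := by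
  refine le_of_pow_le_pow_left₀ two_ne_zero (by positivity) ((norm_sq_le_sum_sq _).trans
    (le_of_eq ?_))
  simp [mul_pow, sq_abs]; ring

end MatrixNorm


/-! ### The certificate -/

section Certificate

variable {n : ℕ}

/-- The triple with `i` at position `c` and `j`, `k`, in this order, at the other two positions. -/
def place (c : Fin 3) (i j k : Fin n) : Fin 3 → Fin n :=
  match c with
  | 0 => ![i, j, k]
  | 1 => ![j, i, k]
  | 2 => ![j, k, i]

lemma sum_eq_sum_place {M : Type*} [AddCommMonoid M] (c : Fin 3) (F : (Fin 3 → Fin n) → M) :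
    ∑ U, F U = ∑ i, ∑ j, ∑ k, F (place c i j k) := by
  have key : ∀ (e : Fin n × Fin n × Fin n → (Fin 3 → Fin n)), Function.Bijective e →
      ∑ U, F U = ∑ i, ∑ j, ∑ k, F (e (i, j, k)) := fun e he => by
    rw [← Function.Bijective.sum_comp he, Fintype.sum_prod_type]
    exact Finset.sum_congr rfl fun i _ => Fintype.sum_prod_type _
  refine key (fun q => place c q.1 q.2.1 q.2.2) ⟨?_, ?_⟩
  · rintro ⟨i, j, k⟩ ⟨i', j', k'⟩ h
    have h0 := congrFun h 0
    have h1 := congrFun h 1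
    have h2 := congrFun h 2
    fin_cases c <;> simp_all [place]
  · intro U
    fin_cases c
    · exact ⟨(U 0, U 1, U 2), by ext i; fin_cases i <;> simp [place]⟩
    · exact ⟨(U 1, U 0, U 2), by ext i; fin_cases i <;> simp [place]⟩
    · exact ⟨(U 2, U 0, U 1), by ext i; fin_cases i <;> simp [place]⟩

open Classical in
/-- The indicator of the hyperedges. -/
noncomputable def edge (H : Hypergraph3 n) (U : Fin 3 → Fin n) : ℕ := if U ∈ H then 1 else 0

lemma sum_edge (H : Hypergraph3 n) : ∑ U, edge H U = H.ncard := by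
  classical
  rw [Set.ncard_eq_toFinset_card']
  simp [edge]

/-- The number of hyperedges with vertex `v` at position `c`. -/
noncomputable def degree (H : Hypergraph3 n) (c : Fin 3) (v : Fin n) : ℕ :=
  ∑ j, ∑ k, edge H (place c v j k)

/-- Cyclic shift by `l`. -/
def shift (a : Fin n) (l : ℕ) : Fin n := ⟨(a + l) % n, Nat.mod_lt _ (Fin.pos a)⟩

/-- The number of hyperedges with `j` and `k` at the positions other than `c` and with an element of
the cyclic window `a, a + 1, …, a + s - 1` at position `c`. -/
noncomputable def windowCount (H : Hypergraph3 n) (c : Fin 3) (s : ℕ) (a j k : Fin n) : ℕ :=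
  ∑ l ∈ Finset.range s, edge H (place c (shift a l) j k)

/-- The matrix of window counts, centered at its average and scaled to integers. -/
noncomputable def centeredMatrix (H : Hypergraph3 n) (c : Fin 3) (s : ℕ) (a : Fin n) :
    Matrix (Fin n) (Fin n) ℤ :=
  Matrix.of fun j k => 100 * ((n : ℤ) ^ 3 * windowCount H c s a j k - s * H.ncard)

open scoped Matrix in
/-- All degrees are close to the average or above, and all window matrices have small spectral
norm, as witnessed by a high moment. -/
def Certified (H : Hypergraph3 n) (s : ℕ) : Prop :=
  0 < s ∧ 0 < H.ncard ∧ (∀ c v, 99 * H.ncard ≤ 100 * n * degree H c v) ∧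
    ∀ c a, ∑ j, ∑ k, ((centeredMatrix H c s a * (centeredMatrix H c s a)ᵀ) ^ n.size) j k ^ 2 ≤
      ((s * H.ncard * n : ℕ) : ℤ) ^ (4 * n.size)

lemma sum_shift {M : Type*} [AddCommMonoid M] (f : Fin n → M) (l : ℕ) :
    ∑ a, f (shift a l) = ∑ a, f a := by
  refine Function.Bijective.sum_comp (Finite.injective_iff_bijective.mp fun a b h => ?_) f
  have h' : (a + l : ℕ) % n = (b + l) % n := congrArg Fin.val h
  have h2 : (a : ℕ) ≡ b [MOD n] := Nat.ModEq.add_right_cancel' l h'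
  exact Fin.ext (Nat.ModEq.eq_of_lt_of_lt h2 a.2 b.2)

/-- For each offset the cyclic shift permutes the vertices. Averages over windows are therefore
averages over all vertices, without boundary terms. -/
lemma sum_windowCount (H : Hypergraph3 n) (c : Fin 3) (s : ℕ) (j k : Fin n) :
    ∑ a, windowCount H c s a j k = s * ∑ i, edge H (place c i j k) := by
  simp only [windowCount]
  rw [Finset.sum_comm]
  simp [sum_shift (fun i => edge H (place c i j k))]

variable {H : Hypergraph3 n} {s : ℕ}

lemma Certified.pos (h : Certified H s) : 0 < n := by
  rcases Nat.eq_zero_or_pos n with rfl | h0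
  · have := sum_edge H
    have h1 := h.2.1
    rw [← this] at h1
    simp at h1
  · exact h0

open scoped Matrix Matrix.Norms.L2Operator in
-- The scaling by `100 * n ^ 3` makes this the bound `s * m / (100 * n ^ 2)` for the window counts
-- minus their mean, one hundredth of the average degree of a window graph.
lemma Certified.norm_le (h : Certified H s) (c : Fin 3) (a : Fin n) :
    ‖(centeredMatrix H c s a).map (Int.cast : ℤ → ℝ)‖ ≤ s * H.ncard * n := by
  refine norm_le_of_sum_sq_le _ (k := n.size) (Nat.size_pos.2 h.pos).ne' (by positivity) ?_
  have h1 := h.2.2.2 c a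
  have h2 : (((centeredMatrix H c s a * (centeredMatrix H c s a)ᵀ) ^ n.size).map
      (Int.cast : ℤ → ℝ)) = ((centeredMatrix H c s a).map (Int.cast : ℤ → ℝ) *
        ((centeredMatrix H c s a).map (Int.cast : ℤ → ℝ))ᵀ) ^ n.size := by
    rw [← Matrix.transpose_map]
    have := map_pow (RingHom.mapMatrix (m := Fin n) (Int.castRingHom ℝ))
      (centeredMatrix H c s a * (centeredMatrix H c s a)ᵀ) n.size
    rw [map_mul] at this
    exact this
  rw [← h2]
  simp only [Matrix.map_apply]
  exact_mod_cast h1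

/-- The discrepancy bound for windows. -/
lemma Certified.window_discrepancy (h : Certified H s) (c : Fin 3) (a : Fin n) (u v : Fin n → ℝ) :
    |∑ j, ∑ k, (windowCount H c s a j k : ℝ) * (u j * v k) -
        s * H.ncard / n ^ 3 * ((∑ j, u j) * ∑ k, v k)| ≤
      s * H.ncard / (100 * n ^ 2) * (√(∑ j, u j ^ 2) * √(∑ k, v k ^ 2)) := by
  have hn : (0 : ℝ) < n := by exact_mod_cast h.pos
  have h1 := dotProduct_mulVec_le ((centeredMatrix H c s a).map (Int.cast : ℤ → ℝ)) u v
  have h2 : u ⬝ᵥ ((centeredMatrix H c s a).map (Int.cast : ℤ → ℝ)).mulVec v =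
      100 * n ^ 3 * (∑ j, ∑ k, (windowCount H c s a j k : ℝ) * (u j * v k) -
        s * H.ncard / n ^ 3 * ((∑ j, u j) * ∑ k, v k)) := by
    simp only [dotProduct, Matrix.mulVec, centeredMatrix, Matrix.map_apply, Matrix.of_apply]
    rw [Finset.sum_mul_sum, Finset.mul_sum, ← Finset.sum_sub_distrib, Finset.mul_sum]
    refine Finset.sum_congr rfl fun j _ => ?_
    rw [Finset.mul_sum, Finset.mul_sum, ← Finset.sum_sub_distrib, Finset.mul_sum]
    refine Finset.sum_congr rfl fun k _ => ?_
    push_cast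
    field_simp
  rw [h2, abs_mul, abs_of_pos (by positivity : (0 : ℝ) < 100 * n ^ 3)] at h1
  have h3 := h1.trans (mul_le_mul_of_nonneg_right (h.norm_le c a) (by positivity))
  rw [← mul_le_mul_iff_right₀ (by positivity : (0 : ℝ) < 100 * n ^ 3)]
  refine h3.trans (le_of_eq ?_)
  field_simp

lemma sum_comm_three {α β γ M : Type*} [Fintype α] [Fintype β] [Fintype γ] [AddCommMonoid M]
    (f : α → β → γ → M) : ∑ i, ∑ j, ∑ k, f i j k = ∑ j, ∑ k, ∑ i, f i j k := by
  rw [Finset.sum_comm]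
  exact Finset.sum_congr rfl fun _ _ => Finset.sum_comm

/-- The discrepancy bound for the projected graphs. -/
lemma Certified.discrepancy (h : Certified H s) (c : Fin 3) (u v : Fin n → ℝ) :
    |∑ i, ∑ j, ∑ k, (edge H (place c i j k) : ℝ) * (u j * v k) -
        H.ncard / n ^ 2 * ((∑ j, u j) * ∑ k, v k)| ≤
      H.ncard / (100 * n) * (√(∑ j, u j ^ 2) * √(∑ k, v k ^ 2)) := by
  have hn : (0 : ℝ) < n := by exact_mod_cast h.pos
  have hs : (0 : ℝ) < s := by exact_mod_cast h.1
  -- Summing the window discrepancies over all starting points counts each hyperedge `s` times, so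
  -- no separate spectral test of the projected graphs is needed.
  have h1 : s * (∑ i, ∑ j, ∑ k, (edge H (place c i j k) : ℝ) * (u j * v k) -
        H.ncard / n ^ 2 * ((∑ j, u j) * ∑ k, v k)) =
      ∑ a, (∑ j, ∑ k, (windowCount H c s a j k : ℝ) * (u j * v k) -
        s * H.ncard / n ^ 3 * ((∑ j, u j) * ∑ k, v k)) := by
    rw [Finset.sum_sub_distrib, mul_sub]
    congr 1
    · rw [sum_comm_three, sum_comm_three (fun a j k => (windowCount H c s a j k : ℝ) * (u j * v k)),
        Finset.mul_sum]
      refine Finset.sum_congr rfl fun j _ => ?_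
      rw [Finset.mul_sum]
      refine Finset.sum_congr rfl fun k _ => ?_
      rw [← Finset.sum_mul, ← Finset.sum_mul, ← mul_assoc]
      congr 1
      exact_mod_cast (sum_windowCount H c s j k).symm
    · simp only [Finset.sum_const, Finset.card_univ, Fintype.card_fin, nsmul_eq_mul]
      field_simp
  have h2 := (Finset.abs_sum_le_sum_abs _ _).trans
    (Finset.sum_le_sum fun a (_ : a ∈ Finset.univ) => h.window_discrepancy c a u v)
  rw [← h1, abs_mul, abs_of_pos hs] at h2
  rw [← mul_le_mul_iff_right₀ hs]
  refine h2.trans (le_of_eq ?_)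
  simp only [Finset.sum_const, Finset.card_univ, Fintype.card_fin, nsmul_eq_mul]
  field_simp

end Certificate


/-! ### Soundness of the certificate -/

section Soundness

variable {n : ℕ} {H : Hypergraph3 n} {s : ℕ}

/-- The indicator of the coordinates where `x` and `y` differ. -/
def diff (x y : Assignment n) (i : Fin n) : ℝ := if x i = y i then 0 else 1

/-- The indicator of the triples on which the products of `x` and `y` differ. -/
def oddTriple (x y : Assignment n) (U : Fin 3 → Fin n) : ℝ :=
  if ∏ i, x (U i) = ∏ i, y (U i) then 0 else 1

/-- The number of hyperedges on which the products of `x` and `y` differ. -/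
noncomputable def oddCount (H : Hypergraph3 n) (x y : Assignment n) : ℝ :=
  ∑ U, (edge H U : ℝ) * oddTriple x y U

lemma diff_eq (x y : Assignment n) (i : Fin n) : diff x y i = 0 ∨ diff x y i = 1 := by
  unfold diff; split_ifs <;> simp

lemma diff_sq (x y : Assignment n) (i : Fin n) : diff x y i ^ 2 = diff x y i := by
  rcases diff_eq x y i with h | h <;> simp [h]

lemma sum_diff (x y : Assignment n) : ∑ i, diff x y i = hammingDist x y := by
  simp [diff, hammingDist, Finset.sum_ite]

lemma diff_nonneg (x y : Assignment n) (i : Fin n) : 0 ≤ diff x y i := by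
  rcases diff_eq x y i with h | h <;> simp [h]

lemma diff_le_one (x y : Assignment n) (i : Fin n) : diff x y i ≤ 1 := by
  rcases diff_eq x y i with h | h <;> simp [h]

/-- For bits `a`, `b`, `c` the parity of their sum is `(1 - (1 - 2a)(1 - 2b)(1 - 2c)) / 2`; the
right side is its expansion. The three lower bounds that follow serve small, large and intermediate
distances. -/
lemma oddTriple_eq (x y : Assignment n) (U : Fin 3 → Fin n) :
    oddTriple x y U = diff x y (U 0) + diff x y (U 1) + diff x y (U 2) -
      2 * (diff x y (U 1) * diff x y (U 2) + diff x y (U 0) * diff x y (U 2) +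
        diff x y (U 0) * diff x y (U 1)) +
      4 * (diff x y (U 0) * diff x y (U 1) * diff x y (U 2)) := by
  simp only [oddTriple, diff, Fin.prod_univ_three]
  generalize x (U 0) = a₀, x (U 1) = a₁, x (U 2) = a₂, y (U 0) = b₀, y (U 1) = b₁, y (U 2) = b₂
  rcases Int.units_eq_one_or a₀ with rfl | rfl <;> rcases Int.units_eq_one_or a₁ with rfl | rfl <;>
    rcases Int.units_eq_one_or a₂ with rfl | rfl <;>
    rcases Int.units_eq_one_or b₀ with rfl | rfl <;>
    rcases Int.units_eq_one_or b₁ with rfl | rfl <;>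
    rcases Int.units_eq_one_or b₂ with rfl | rfl <;> norm_num

lemma le_oddTriple (x y : Assignment n) (U : Fin 3 → Fin n) :
    diff x y (U 0) + diff x y (U 1) + diff x y (U 2) -
      2 * (diff x y (U 1) * diff x y (U 2) + diff x y (U 0) * diff x y (U 2) +
        diff x y (U 0) * diff x y (U 1)) ≤ oddTriple x y U := by
  rw [oddTriple_eq]
  have := mul_nonneg (mul_nonneg (diff_nonneg x y (U 0)) (diff_nonneg x y (U 1)))
    (diff_nonneg x y (U 2))
  linarith

lemma sub_two_le_oddTriple (x y : Assignment n) (U : Fin 3 → Fin n) :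
    diff x y (U 0) + diff x y (U 1) + diff x y (U 2) - 2 ≤ oddTriple x y U := by
  rw [oddTriple_eq]
  rcases diff_eq x y (U 0) with h | h <;> rcases diff_eq x y (U 1) with h' | h' <;>
    rcases diff_eq x y (U 2) with h'' | h'' <;> norm_num [h, h', h'']

lemma cut_le_oddTriple (x y : Assignment n) (U : Fin 3 → Fin n) :
    (1 - diff x y (U 0)) * (diff x y (U 1) * (1 - diff x y (U 2)) +
      (1 - diff x y (U 1)) * diff x y (U 2)) ≤ oddTriple x y U := by
  rw [oddTriple_eq]
  rcases diff_eq x y (U 0) with h | h <;> rcases diff_eq x y (U 1) with h' | h' <;>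
    rcases diff_eq x y (U 2) with h'' | h'' <;> norm_num [h, h', h'']

lemma sum_edge_mul_eq (c : Fin 3) (f : Fin n → ℝ) :
    ∑ U, (edge H U : ℝ) * f (U c) = ∑ v, (degree H c v : ℝ) * f v := by
  rw [sum_eq_sum_place c]
  refine Finset.sum_congr rfl fun v _ => ?_
  simp only [degree, Nat.cast_sum, Finset.sum_mul]
  have : ∀ j k, place c v j k c = v := fun j k => by fin_cases c <;> rfl
  simp [this]

lemma Certified.degree_sum_ge (h : Certified H s) (x y : Assignment n) (c : Fin 3) :
    99 / 100 * (H.ncard / n) * hammingDist x y ≤ ∑ U, (edge H U : ℝ) * diff x y (U c) := by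
  have hn : (0 : ℝ) < n := by exact_mod_cast h.pos
  rw [sum_edge_mul_eq, ← sum_diff, Finset.mul_sum]
  refine Finset.sum_le_sum fun v _ => mul_le_mul_of_nonneg_right ?_ (diff_nonneg _ _ _)
  have := h.2.2.1 c v
  have h2 : (99 : ℝ) * H.ncard ≤ 100 * n * degree H c v := by exact_mod_cast this
  rw [← mul_div_assoc, div_le_iff₀ hn]
  linarith

lemma Certified.pair_sum_le (h : Certified H s) (x y : Assignment n) (c : Fin 3) :
    ∑ i, ∑ j, ∑ k, (edge H (place c i j k) : ℝ) * (diff x y j * diff x y k) ≤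
      H.ncard / n ^ 2 * (hammingDist x y : ℝ) ^ 2 + H.ncard / (100 * n) * hammingDist x y := by
  have h1 := le_of_abs_le (h.discrepancy c (diff x y) (diff x y))
  simp only [diff_sq, sum_diff] at h1
  rw [Real.mul_self_sqrt (by positivity)] at h1
  linarith

lemma sum_edge_mul_pairs (x y : Assignment n) :
    ∑ U, (edge H U : ℝ) * (diff x y (U 1) * diff x y (U 2) + diff x y (U 0) * diff x y (U 2) +
        diff x y (U 0) * diff x y (U 1)) =
      ∑ c, ∑ i, ∑ j, ∑ k, (edge H (place c i j k) : ℝ) * (diff x y j * diff x y k) := by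
  simp only [mul_add, Finset.sum_add_distrib]
  rw [Fin.sum_univ_three, sum_eq_sum_place 0,
    sum_eq_sum_place 1 (fun U => (edge H U : ℝ) * (diff x y (U 0) * diff x y (U 2))),
    sum_eq_sum_place 2 (fun U => (edge H U : ℝ) * (diff x y (U 0) * diff x y (U 1)))]
  rfl

/-- Truncated inclusion-exclusion: the linear terms use the degrees, the quadratic ones the
projected graphs. The constant is `291/100 = 3 * 99/100 - 6 * 1/100`. -/
lemma Certified.oddCount_ge_small (h : Certified H s) (x y : Assignment n) :
    (H.ncard : ℝ) / n * hammingDist x y * (291 / 100 - 6 * hammingDist x y / n) ≤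
      oddCount H x y := by
  have hn : (0 : ℝ) < n := by exact_mod_cast h.pos
  have h1 : ∑ U, (edge H U : ℝ) * diff x y (U 0) + ∑ U, (edge H U : ℝ) * diff x y (U 1) +
      ∑ U, (edge H U : ℝ) * diff x y (U 2) - 2 * ∑ c, ∑ i, ∑ j, ∑ k,
        (edge H (place c i j k) : ℝ) * (diff x y j * diff x y k) ≤ oddCount H x y := by
    rw [← sum_edge_mul_pairs, ← Finset.sum_add_distrib, ← Finset.sum_add_distrib, Finset.mul_sum,
      ← Finset.sum_sub_distrib]
    refine Finset.sum_le_sum fun U _ => ?_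
    have := mul_le_mul_of_nonneg_left (le_oddTriple x y U) (Nat.cast_nonneg (α := ℝ) (edge H U))
    linarith
  rw [Fin.sum_univ_three] at h1
  have d0 := h.degree_sum_ge x y 0
  have d1 := h.degree_sum_ge x y 1
  have d2 := h.degree_sum_ge x y 2
  have p0 := h.pair_sum_le x y 0
  have p1 := h.pair_sum_le x y 1
  have p2 := h.pair_sum_le x y 2
  have e : (H.ncard : ℝ) / n * hammingDist x y * (291 / 100 - 6 * hammingDist x y / n) =
      3 * (99 / 100 * (H.ncard / n) * hammingDist x y) - 6 * (H.ncard / n ^ 2 *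
        (hammingDist x y : ℝ) ^ 2 + H.ncard / (100 * n) * hammingDist x y) := by
    field_simp; ring
  linarith

lemma Certified.oddCount_ge_large (h : Certified H s) (x y : Assignment n) :
    (H.ncard : ℝ) * (297 / 100 * hammingDist x y / n - 2) ≤ oddCount H x y := by
  have hn : (0 : ℝ) < n := by exact_mod_cast h.pos
  have hm : ∑ U, (edge H U : ℝ) = H.ncard := by exact_mod_cast sum_edge H
  have h1 : ∑ U, (edge H U : ℝ) * diff x y (U 0) + ∑ U, (edge H U : ℝ) * diff x y (U 1) +
      ∑ U, (edge H U : ℝ) * diff x y (U 2) - 2 * ∑ U, (edge H U : ℝ) ≤ oddCount H x y := by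
    rw [← Finset.sum_add_distrib, ← Finset.sum_add_distrib, Finset.mul_sum,
      ← Finset.sum_sub_distrib]
    refine Finset.sum_le_sum fun U _ => ?_
    have := mul_le_mul_of_nonneg_left (sub_two_le_oddTriple x y U)
      (Nat.cast_nonneg (α := ℝ) (edge H U))
    linarith
  have d0 := h.degree_sum_ge x y 0
  have d1 := h.degree_sum_ge x y 1
  have d2 := h.degree_sum_ge x y 2
  rw [hm] at h1
  have e : (H.ncard : ℝ) * (297 / 100 * hammingDist x y / n - 2) =
      3 * (99 / 100 * (H.ncard / n) * hammingDist x y) - 2 * H.ncard := by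
    field_simp; ring
  linarith

/-- The hyperedges in a window whose other two vertices are separated by the difference of `x` and
`y`. -/
noncomputable def windowCut (H : Hypergraph3 n) (s : ℕ) (a : Fin n) (x y : Assignment n) : ℝ :=
  ∑ j, ∑ k, (windowCount H 0 s a j k : ℝ) *
    (diff x y j * (1 - diff x y k) + (1 - diff x y j) * diff x y k)

/-- The discrepancy bound is applied to the difference set against its complement, in both orders.
By AM-GM each error term is at most half of `s * m / (100 * n)`. -/
lemma Certified.windowCut_ge (h : Certified H s) (a : Fin n) (x y : Assignment n) :
    (s * H.ncard : ℝ) / n *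
      (2 * (hammingDist x y / n * (1 - hammingDist x y / n)) - 1 / 100) ≤ windowCut H s a x y := by
  have hn : (0 : ℝ) < n := by exact_mod_cast h.pos
  set τ : ℝ := ((hammingDist x y : ℕ) : ℝ) with hτ
  have hs1 : ∀ i, (1 - diff x y i) ^ 2 = 1 - diff x y i := fun i => by
    rcases diff_eq x y i with h | h <;> simp [h]
  have hsum : ∑ i, (1 - diff x y i) = n - τ := by simp [sum_diff, hτ]
  have hnt : 0 ≤ (n : ℝ) - τ := by
    rw [← hsum]; exact Finset.sum_nonneg fun i _ => sub_nonneg.2 (diff_le_one _ _ _)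
  have hτ0 : 0 ≤ τ := by positivity
  have hsq : √τ * √(n - τ) ≤ n / 2 := by
    rw [← Real.sqrt_mul hτ0]
    refine Real.sqrt_le_iff.2 ⟨by positivity, ?_⟩
    nlinarith [sq_nonneg (τ - (n - τ))]
  have h1 := neg_le_of_abs_le (h.window_discrepancy 0 a (diff x y) (fun i => 1 - diff x y i))
  have h2 := neg_le_of_abs_le (h.window_discrepancy 0 a (fun i => 1 - diff x y i) (diff x y))
  simp only [diff_sq, sum_diff, hs1, hsum, ← hτ] at h1 h2
  have hc : (s * H.ncard : ℝ) / (100 * n ^ 2) * (√τ * √(n - τ)) ≤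
      (s * H.ncard : ℝ) / (100 * n ^ 2) * (n / 2) := by gcongr
  rw [mul_comm (√(n - τ))] at h2
  have h3 : windowCut H s a x y = ∑ j, ∑ k, (windowCount H 0 s a j k : ℝ) *
      (diff x y j * (1 - diff x y k)) + ∑ j, ∑ k, (windowCount H 0 s a j k : ℝ) *
      ((1 - diff x y j) * diff x y k) := by
    simp only [windowCut, mul_add, Finset.sum_add_distrib]
  rw [h3]
  have e : (s * H.ncard : ℝ) / n * (2 * (τ / n * (1 - τ / n)) - 1 / 100) =
      2 * (s * H.ncard / n ^ 3 * (τ * (n - τ))) -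
        2 * ((s * H.ncard : ℝ) / (100 * n ^ 2) * (n / 2)) := by
    field_simp
  linarith

end Soundness


/-! ### From pseudorandomness to covers by clusters -/

section Covering

variable {n : ℕ} {H : Hypergraph3 n} {s t r : ℕ}

open Classical in
/-- The indicator of the constraints violated by `x`. -/
noncomputable def violated (b : XORInstance H) (x : Assignment n) (U : Fin 3 → Fin n) : ℕ :=
  if h : U ∈ H then (if ∏ i, x (U i) = b ⟨U, h⟩ then 0 else 1) else 0

lemma sum_violated_add_numSat (b : XORInstance H) (x : Assignment n) :
    ∑ U, violated b x U + b.numSat x = H.ncard := by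
  classical
  have h1 : b.numSat x = ∑ U : H, if ∏ i, x (U.1 i) = b U then 1 else 0 := by
    rw [XORInstance.numSat, Set.ncard_eq_toFinset_card']
    simp
  have h2 : ∑ U, violated b x U = ∑ U : H, if ∏ i, x (U.1 i) = b U then 0 else 1 := by
    have h3 : ∑ U ∈ Finset.univ.filter (· ∈ H), violated b x U = ∑ U, violated b x U := by
      refine Finset.sum_filter_of_ne fun U _ hU => ?_
      by_contra hn
      exact hU (by simp [violated, hn])
    rw [← h3, Finset.sum_subtype (Finset.univ.filter (· ∈ H)) (p := (· ∈ H)) (by simp)]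
    refine Finset.sum_congr rfl fun U _ => ?_
    rw [violated, dif_pos U.2]
  rw [h1, h2, ← Finset.sum_add_distrib]
  have h4 : ∀ U : H, ((if ∏ i, x (U.1 i) = b U then 0 else 1) +
      if ∏ i, x (U.1 i) = b U then 1 else 0) = 1 := fun U => by split_ifs <;> rfl
  simp only [h4, Finset.sum_const, Finset.card_univ, smul_eq_mul, mul_one]
  rw [← Nat.card_eq_fintype_card]
  rfl

lemma sum_violated_le {b : XORInstance H} {η : ℝ} {x : Assignment n}
    (hx : x ∈ b.approxSolutions η) : ∑ U, violated b x U ≤ ⌊η * (H.ncard : ℝ)⌋₊ := by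
  refine Nat.le_floor ?_
  have h1 : ((∑ U, violated b x U : ℕ) : ℝ) + b.numSat x = H.ncard := by
    exact_mod_cast sum_violated_add_numSat b x
  have h2 : (1 - η) * (H.ncard : ℝ) ≤ (b.numSat x : ℝ) := hx
  linarith

/-- One sign cannot equal two different products. -/
lemma edge_mul_oddTriple_le (b : XORInstance H) (x y : Assignment n) (U : Fin 3 → Fin n) :
    (edge H U : ℝ) * oddTriple x y U ≤ violated b x U + violated b y U := by
  unfold edge oddTriple violated
  by_cases h : U ∈ H
  · simp only [h, if_true, dif_pos]
    split_ifs with h1 h2 h3 h3 h4 h5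
    all_goals first | (exfalso; apply h1; simp_all; done) | norm_num
  · simp [h]

lemma oddCount_le {b : XORInstance H} {x y : Assignment n} (hx : ∑ U, violated b x U ≤ t)
    (hy : ∑ U, violated b y U ≤ t) : oddCount H x y ≤ 2 * t := by
  have hx' : ∑ U, (violated b x U : ℝ) ≤ t := by exact_mod_cast hx
  have hy' : ∑ U, (violated b y U : ℝ) ≤ t := by exact_mod_cast hy
  have := Finset.sum_le_sum fun U (_ : U ∈ Finset.univ) => edge_mul_oddTriple_le b x y U
  rw [Finset.sum_add_distrib] at this
  unfold oddCount
  linarith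

/-- Two approximate solutions whose distance is not of middle order are close. -/
lemma Certified.hammingDist_le (h : Certified H s) (ht : 1000 * t ≤ H.ncard)
    (hr : t * n < (r + 1) * H.ncard) {x y : Assignment n} (hodd : oddCount H x y ≤ 2 * t)
    (hmid : (hammingDist x y : ℝ) / n ≤ 1 / 20 ∨ 19 / 20 ≤ (hammingDist x y : ℝ) / n) :
    hammingDist x y ≤ r := by
  have hn : (0 : ℝ) < n := by exact_mod_cast h.pos
  have hm : (0 : ℝ) < H.ncard := by exact_mod_cast h.2.1
  have ht' : (1000 : ℝ) * t ≤ H.ncard := by exact_mod_cast ht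
  rcases hmid with hmid | hmid
  · have h1 := (h.oddCount_ge_small x y).trans hodd
    -- For `α ≤ 1/20` the factor `291/100 - 6α` is at least `2`.
    have h2 : (H.ncard : ℝ) / n * hammingDist x y * 2 ≤ 2 * t := by
      refine le_trans ?_ h1
      have : (0 : ℝ) ≤ (H.ncard : ℝ) / n * hammingDist x y := by positivity
      refine mul_le_mul_of_nonneg_left ?_ this
      rw [mul_div_assoc]; linarith
    have h3 : (H.ncard : ℝ) * hammingDist x y ≤ t * n := by
      have : (H.ncard : ℝ) / n * hammingDist x y = H.ncard * hammingDist x y / n := by ring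
      rw [this, mul_comm, mul_le_mul_iff_right₀ two_pos, div_le_iff₀ hn] at h2
      exact h2
    have h4 : H.ncard * hammingDist x y ≤ t * n := by exact_mod_cast h3
    -- Distances are integers, so the strict inequality with `r + 1` gives distance at most `r`.
    have h5 : H.ncard * hammingDist x y < H.ncard * (r + 1) := by
      calc _ ≤ _ := h4
        _ < _ := hr
        _ = _ := by ring
    have := Nat.lt_of_mul_lt_mul_left h5
    omega
  · exfalso
    have h1 := (h.oddCount_ge_large x y).trans hodd
    -- For `α ≥ 19/20` at least `8/10` of the hyperedges would be odd, whereas `2t` is at most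
    -- `2/1000` of them.
    have h2 : (H.ncard : ℝ) * (8 / 10) ≤
        (H.ncard : ℝ) * (297 / 100 * hammingDist x y / n - 2) := by
      refine mul_le_mul_of_nonneg_left ?_ hm.le
      rw [mul_div_assoc]; linarith
    linarith

/-- The constraints violated by `x` with a window vertex at the first position. -/
noncomputable def windowViolated (b : XORInstance H) (s : ℕ) (a : Fin n) (x : Assignment n) : ℕ :=
  ∑ l ∈ Finset.range s, ∑ j, ∑ k, violated b x (place 0 (shift a l) j k)

/-- Averaging: summed over all windows, each violated constraint is counted `s` times. -/
lemma exists_windowViolated_le (hn : 0 < n) (b : XORInstance H) (s : ℕ) {x : Assignment n}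
    (hx : ∑ U, violated b x U ≤ t) : ∃ a, n * windowViolated b s a x ≤ s * t := by
  by_contra! hcon
  have h1 : ∑ a, windowViolated b s a x = s * ∑ U, violated b x U := by
    simp only [windowViolated]
    rw [Finset.sum_comm, sum_eq_sum_place 0]
    simp [sum_shift (fun i => ∑ j, ∑ k, violated b x (place 0 i j k))]
  have h2 : ∑ _a : Fin n, s * t < ∑ a, n * windowViolated b s a x :=
    Finset.sum_lt_sum_of_nonempty ⟨⟨0, hn⟩, Finset.mem_univ _⟩ fun a _ => hcon a
  have e : ∑ a, n * windowViolated b s a x = n * (s * ∑ U, violated b x U) := by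
    rw [← Finset.mul_sum, h1]
  rw [e] at h2
  simp only [Finset.sum_const, Finset.card_univ, Fintype.card_fin, smul_eq_mul] at h2
  have h3 := Nat.lt_of_mul_lt_mul_left h2
  exact absurd (Nat.mul_le_mul_left s hx) (by omega)

/-- The first vertex of such a hyperedge is not in the difference set, so the hyperedge is odd
exactly when its other two vertices are separated. -/
lemma windowCut_le (b : XORInstance H) (s : ℕ) (a : Fin n) {x y : Assignment n}
    (hxy : ∀ l < s, x (shift a l) = y (shift a l)) :
    windowCut H s a x y ≤ windowViolated b s a x + windowViolated b s a y := by
  have h1 : windowCut H s a x y = ∑ l ∈ Finset.range s, ∑ j, ∑ k,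
      (edge H (place 0 (shift a l) j k) : ℝ) *
        (diff x y j * (1 - diff x y k) + (1 - diff x y j) * diff x y k) := by
    simp only [windowCut, windowCount, Nat.cast_sum, Finset.sum_mul]
    symm
    rw [Finset.sum_comm]
    exact Finset.sum_congr rfl fun j _ => Finset.sum_comm
  rw [h1]
  simp only [windowViolated, Nat.cast_sum, ← Finset.sum_add_distrib]
  refine Finset.sum_le_sum fun l hl => Finset.sum_le_sum fun j _ => Finset.sum_le_sum fun k _ => ?_
  refine le_trans ?_ (edge_mul_oddTriple_le b x y _)
  refine mul_le_mul_of_nonneg_left ?_ (Nat.cast_nonneg _)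
  have h2 := cut_le_oddTriple x y (place 0 (shift a l) j k)
  have h3 : diff x y (shift a l) = 0 := by simp [diff, hxy l (Finset.mem_range.1 hl)]
  simpa [place, h3] using h2

lemma not_middle_of_le {α c : ℝ} (hc : c ≤ 6 / 1000) (h : α * (1 - α) ≤ c) :
    α ≤ 1 / 20 ∨ 19 / 20 ≤ α := by
  by_contra! hcon
  nlinarith [mul_pos (sub_pos.2 hcon.1) (sub_pos.2 hcon.2)]

/-- Both assignments violate at most an average share in the common window, so `2α(1-α) - 1/100 ≤
2t/m ≤ 2/1000`, that is, `α(1-α) ≤ 6/1000`. This excludes the middle range, where `α(1-α)` exceeds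
`19/400`. -/
lemma Certified.hammingDist_le_of_window (h : Certified H s) (ht : 1000 * t ≤ H.ncard)
    (hr : t * n < (r + 1) * H.ncard) {b : XORInstance H} {x y : Assignment n}
    (hx : ∑ U, violated b x U ≤ t) (hy : ∑ U, violated b y U ≤ t) {a : Fin n}
    (hxa : n * windowViolated b s a x ≤ s * t) (hya : n * windowViolated b s a y ≤ s * t)
    (hxy : ∀ l < s, x (shift a l) = y (shift a l)) : hammingDist x y ≤ r := by
  have hn : (0 : ℝ) < n := by exact_mod_cast h.pos
  have hm : (0 : ℝ) < H.ncard := by exact_mod_cast h.2.1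
  have hs : (0 : ℝ) < s := by exact_mod_cast h.1
  have ht' : (1000 : ℝ) * t ≤ H.ncard := by exact_mod_cast ht
  refine h.hammingDist_le ht hr (oddCount_le hx hy) (not_middle_of_le le_rfl ?_)
  have h1 := (h.windowCut_ge a x y).trans (windowCut_le b s a hxy)
  have hxa' : (n : ℝ) * windowViolated b s a x ≤ s * t := by exact_mod_cast hxa
  have hya' : (n : ℝ) * windowViolated b s a y ≤ s * t := by exact_mod_cast hya
  set α : ℝ := (hammingDist x y : ℝ) / n
  have h2 : (s * H.ncard : ℝ) * (2 * (α * (1 - α)) - 1 / 100) ≤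
      s * (2 * t) := by
    have := mul_le_mul_of_nonneg_left h1 hn.le
    have e : (n : ℝ) * ((s * H.ncard : ℝ) / n * (2 * (α * (1 - α)) - 1 / 100)) =
      (s * H.ncard : ℝ) * (2 * (α * (1 - α)) - 1 / 100) := by field_simp
    rw [e] at this
    linarith
  rw [mul_assoc, mul_le_mul_iff_right₀ hs] at h2
  have h3 : (H.ncard : ℝ) * (2 * (α * (1 - α)) - 1 / 100) ≤ H.ncard * (2 / 1000) := by linarith
  rw [mul_le_mul_iff_right₀ hm] at h3
  linarith

lemma windowCut_one (a : Fin n) (x y : Assignment n) :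
    windowCut H 1 a x y = ∑ j, ∑ k, (edge H (place 0 a j k) : ℝ) *
    (diff x y j * (1 - diff x y k) + (1 - diff x y j) * diff x y k) := by
  have : shift a 0 = a := Fin.ext (by simp [shift, Nat.mod_eq_of_lt a.2])
  simp [windowCut, windowCount, this]

/-- With one-vertex windows no label has to be guessed: the cuts of the `(1-α)n` vertices where `x`
and `y` agree consist of odd hyperedges, and together they give `(1-α)(2α(1-α) - 1/100) ≤ 2/1000`.
-/
lemma Certified.hammingDist_le_of_one (h : Certified H 1) (ht : 1000 * t ≤ H.ncard)
    (hr : t * n < (r + 1) * H.ncard) {b : XORInstance H} {x y : Assignment n}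
    (hx : ∑ U, violated b x U ≤ t) (hy : ∑ U, violated b y U ≤ t) : hammingDist x y ≤ r := by
  have hn : (0 : ℝ) < n := by exact_mod_cast h.pos
  have hm : (0 : ℝ) < H.ncard := by exact_mod_cast h.2.1
  have ht' : (1000 : ℝ) * t ≤ H.ncard := by exact_mod_cast ht
  have hodd := oddCount_le hx hy
  refine h.hammingDist_le ht hr hodd ?_
  have h1 : ∑ a, (1 - diff x y a) * windowCut H 1 a x y ≤ oddCount H x y := by
    rw [oddCount, sum_eq_sum_place 0]
    refine Finset.sum_le_sum fun a _ => ?_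
    rw [windowCut_one, Finset.mul_sum]
    refine Finset.sum_le_sum fun j _ => ?_
    rw [Finset.mul_sum]
    refine Finset.sum_le_sum fun k _ => ?_
    have := mul_le_mul_of_nonneg_left (cut_le_oddTriple x y (place 0 a j k))
      (Nat.cast_nonneg (α := ℝ) (edge H (place 0 a j k)))
    refine le_trans (le_of_eq ?_) this
    simp [place]; ring
  have h2 : ∑ a, (1 - diff x y a) * ((1 * H.ncard : ℝ) / n *
      (2 * (hammingDist x y / n * (1 - hammingDist x y / n)) - 1 / 100)) ≤
      ∑ a, (1 - diff x y a) * windowCut H 1 a x y := by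
    refine Finset.sum_le_sum fun a _ => mul_le_mul_of_nonneg_left ?_
      (sub_nonneg.2 (diff_le_one _ _ _))
    simpa using h.windowCut_ge a x y
  rw [← Finset.sum_mul, Finset.sum_sub_distrib, sum_diff] at h2
  simp only [Finset.sum_const, Finset.card_univ, Fintype.card_fin, nsmul_eq_mul, mul_one,
    one_mul] at h2
  have h3 := (h2.trans h1).trans hodd
  set α : ℝ := (hammingDist x y : ℝ) / n with hα
  have e : ((n : ℝ) - hammingDist x y) * ((H.ncard : ℝ) / n * (2 * (α * (1 - α)) - 1 / 100)) =
      H.ncard * ((1 - α) * (2 * (α * (1 - α)) - 1 / 100)) := by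
    rw [hα]; field_simp
  rw [e] at h3
  have h4 : (H.ncard : ℝ) * ((1 - α) * (2 * (α * (1 - α)) - 1 / 100)) ≤
      H.ncard * (2 / 1000) := by linarith
  rw [mul_le_mul_iff_right₀ hm] at h4
  by_contra! hcon
  -- In the middle range `2α(1-α)` exceeds `2 * 1/20 * 19/20 = 95/1000`, and `1-α` exceeds `1/20`;
  -- the product is then more than `85/20000 > 2/1000`.
  have h5 : (0 : ℝ) < 2 * (α * (1 - α)) - 95 / 1000 := by
    nlinarith [mul_pos (sub_pos.2 hcon.1) (sub_pos.2 hcon.2)]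
  nlinarith [mul_pos (sub_pos.2 hcon.2) h5]

/-- Any member of a nonempty fibre can serve as the centre of its cluster. -/
lemma coveredByClusters_of_fibers {S : Set (Assignment n)} {κ : Type*} [Fintype κ] {d : ℝ}
    (f : S → κ) (h : ∀ x y : S, f x = f y → (hammingDist x.1 y.1 : ℝ) ≤ d / 2) :
    CoveredByClusters S d (Fintype.card κ) := by
  classical
  rcases S.eq_empty_or_nonempty with rfl | ⟨x₀, _⟩
  · exact ⟨∅, by simp, by simp⟩
  let g : κ → Assignment n := fun q => if hq : ∃ x : S, f x = q then hq.choose.1 else x₀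
  refine ⟨Finset.univ.image g, Finset.card_image_le, fun x hx => ?_⟩
  have hq : ∃ y : S, f y = f ⟨x, hx⟩ := ⟨⟨x, hx⟩, rfl⟩
  refine Set.mem_biUnion (Finset.mem_coe.2 (Finset.mem_image_of_mem g
    (Finset.mem_univ (f ⟨x, hx⟩)))) ?_
  have hg : g (f ⟨x, hx⟩) = hq.choose.1 := dif_pos hq
  rw [hg]
  exact h _ ⟨x, hx⟩ hq.choose_spec

lemma Certified.covered (h : Certified H s) (ht : 1000 * t ≤ H.ncard)
    (hr : t * n < (r + 1) * H.ncard) {b : XORInstance H} {S : Set (Assignment n)} {d : ℝ}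
    (hS : ∀ x ∈ S, ∑ U, violated b x U ≤ t) (hd : (r : ℝ) ≤ d / 2) :
    CoveredByClusters S d (n * 2 ^ s) := by
  -- The label of `x` is a window with few violations together with the values of `x` on it.
  choose a ha using fun x : S => exists_windowViolated_le h.pos b s (hS x.1 x.2)
  have := coveredByClusters_of_fibers (S := S) (d := d) (κ := Fin n × (Fin s → ℤˣ))
    (fun x => (a x, fun l => x.1 (shift (a x) l))) fun x y hxy => ?_
  · simpa using this
  · obtain ⟨h1, h2⟩ := Prod.mk.inj hxy
    refine le_trans (Nat.cast_le.2 ?_) hd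
    refine h.hammingDist_le_of_window ht hr (hS x.1 x.2) (hS y.1 y.2) (ha x) (h1 ▸ ha y) ?_
    intro l hl
    have := congrFun h2 ⟨l, hl⟩
    rw [← h1] at this
    exact this

lemma Certified.covered_one (h : Certified H 1) (ht : 1000 * t ≤ H.ncard)
    (hr : t * n < (r + 1) * H.ncard) {b : XORInstance H} {S : Set (Assignment n)} {d : ℝ}
    (hS : ∀ x ∈ S, ∑ U, violated b x U ≤ t) (hd : (r : ℝ) ≤ d / 2) :
    CoveredByClusters S d 1 := by
  have := coveredByClusters_of_fibers (S := S) (d := d) (κ := Unit) (fun _ => ()) fun x y _ =>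
    le_trans (Nat.cast_le.2 (h.hammingDist_le_of_one ht hr (hS x.1 x.2) (hS y.1 y.2))) hd
  simpa using this

lemma covered_trivial (S : Set (Assignment n)) {d : ℝ} (hd : 0 ≤ d) :
    CoveredByClusters S d (2 ^ n) := by
  have := coveredByClusters_of_fibers (S := S) (d := d) (κ := Assignment n) (fun x => x.1)
    fun x y hxy => by rw [hxy, hammingDist_self]; simp only [Nat.cast_zero]; positivity
  simpa using this

end Covering


/-! ### Moments of a random set -/

section Moments

variable {ι : Type*} [Fintype ι]

/-- Independence: expanding the product of the two-term sums gives the sum over all subsets, with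
their probabilities as weights. -/
lemma integral_setBernoulli_prod (p : unitInterval) (g : ι → Prop → ℝ) :
    ∫ S, ∏ i, g i (i ∈ S) ∂(setBernoulli (Set.univ : Set ι) p) =
      ∏ i, ((p : ℝ) * g i True + (1 - p) * g i False) := by
  classical
  rw [integral_fintype Integrable.of_finite, Finset.prod_add,
    ← Fintype.finsetEquivSet.sum_comp, ← Finset.powerset_univ]
  refine Finset.sum_congr rfl fun S _ => ?_
  have h1 : (Fintype.finsetEquivSet S : Set ι) = (S : Set ι) := rfl
  rw [h1, setBernoulli_real_singleton p (Set.subset_univ _) Set.finite_univ]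
  have h2 : (Set.univ \ (S : Set ι)).ncard = (Finset.univ \ S).card := by
    rw [← Set.ncard_coe_finset]; simp
  rw [h2, Set.ncard_coe_finset, Finset.prod_mul_distrib, Finset.prod_mul_distrib,
    Finset.prod_const, Finset.prod_const, smul_eq_mul,
    ← Finset.prod_sdiff (Finset.subset_univ S)]
  have h3 : ∏ i ∈ S, g i (i ∈ (S : Set ι)) = ∏ i ∈ S, g i True :=
    Finset.prod_congr rfl fun i hi => by simp [hi]
  have h4 : ∏ i ∈ Finset.univ \ S, g i (i ∈ (S : Set ι)) = ∏ i ∈ Finset.univ \ S, g i False :=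
    Finset.prod_congr rfl fun i hi => by
      have : i ∉ S := by simpa using hi
      simp [this]
  rw [h3, h4]
  ring

open Classical in
/-- The centered indicator of `i ∈ S`. -/
noncomputable def centeredInd (p : ℝ) (S : Set ι) (i : ι) : ℝ := (if i ∈ S then 1 else 0) - p

lemma abs_centered_moment_le {p : ℝ} (h0 : 0 ≤ p) (h1 : p ≤ 1) {r : ℕ} (hr : 2 ≤ r) :
    |p * (1 - p) ^ r + (1 - p) * (0 - p) ^ r| ≤ p := by
  obtain ⟨q, rfl⟩ : ∃ q, r = q + 2 := ⟨r - 2, by omega⟩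
  have hp : 0 ≤ 1 - p := by linarith
  have ha : (1 - p) ^ (q + 2) ≤ (1 - p) ^ 2 * 1 := by
    rw [pow_add, mul_comm]
    exact mul_le_mul_of_nonneg_left (pow_le_one₀ hp (by linarith)) (by positivity)
  have hb : p ^ (q + 2) ≤ p ^ 2 * 1 := by
    rw [pow_add, mul_comm]
    exact mul_le_mul_of_nonneg_left (pow_le_one₀ h0 h1) (by positivity)
  calc |p * (1 - p) ^ (q + 2) + (1 - p) * (0 - p) ^ (q + 2)|
      ≤ |p * (1 - p) ^ (q + 2)| + |(1 - p) * (0 - p) ^ (q + 2)| := abs_add_le _ _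
    _ = p * (1 - p) ^ (q + 2) + (1 - p) * p ^ (q + 2) := by
        rw [abs_mul, abs_mul, abs_pow, abs_pow, abs_of_nonneg h0, abs_of_nonneg hp, zero_sub,
          abs_neg, abs_of_nonneg h0]
    _ ≤ p * ((1 - p) ^ 2 * 1) + (1 - p) * (p ^ 2 * 1) := by gcongr
    _ ≤ p := by nlinarith [mul_nonneg h0 hp]

open Classical in
-- A label that occurs exactly once contributes a centered factor and annihilates the expectation.
-- Otherwise every distinct label occurs at least twice and contributes at most `p`.
lemma abs_integral_prod_list_le (p : unitInterval) (L : List ι) :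
    |∫ S, (L.map (centeredInd (p : ℝ) S)).prod ∂(setBernoulli (Set.univ : Set ι) p)| ≤
      if 2 * L.toFinset.card ≤ L.length then (p : ℝ) ^ L.toFinset.card else 0 := by
  have h1 : ∀ S : Set ι, (L.map (centeredInd (p : ℝ) S)).prod =
      ∏ i, (fun (i : ι) (P : Prop) => ((if P then 1 else 0) - (p : ℝ)) ^ L.count i) i (i ∈ S) := by
    intro S
    rw [Finset.prod_list_map_count]
    refine Finset.prod_subset (Finset.subset_univ _) fun i _ hi => ?_
    rw [List.count_eq_zero_of_not_mem (by simpa using hi), pow_zero]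
  rw [integral_congr_ae (ae_of_all _ h1), integral_setBernoulli_prod p
    (fun (i : ι) (P : Prop) => ((if P then 1 else 0) - (p : ℝ)) ^ L.count i)]
  simp only [if_true, if_false]
  by_cases hone : ∃ i, L.count i = 1
  · obtain ⟨i, hi⟩ := hone
    rw [Finset.prod_eq_zero (Finset.mem_univ i) (by rw [hi]; ring), abs_zero]
    split_ifs
    · exact pow_nonneg p.2.1 _
    · exact le_rfl
  · push Not at hone
    have h2 : ∀ i ∈ L.toFinset, 2 ≤ L.count i := fun i hi => by
      have h3 : 0 < L.count i := List.count_pos_iff.2 (by simpa using hi)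
      have := hone i
      omega
    have h4 : 2 * L.toFinset.card ≤ L.length := by
      rw [← List.sum_toFinset_count_eq_length L, mul_comm, ← smul_eq_mul, ← Finset.sum_const]
      exact Finset.sum_le_sum h2
    rw [if_pos h4, ← Finset.prod_subset (Finset.subset_univ L.toFinset), Finset.abs_prod,
      ← Finset.prod_const]
    · exact Finset.prod_le_prod (fun _ _ => abs_nonneg _)
        fun i hi => abs_centered_moment_le p.2.1 p.2.2 (h2 i hi)
    · intro i _ hi
      rw [List.count_eq_zero_of_not_mem (by simpa using hi)]
      simp

variable {α : Type*} [Fintype α] [DecidableEq α] {s : ℕ}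

/-- The matrix whose `(v, b)` entry is the sum of the weights `w` over the labels `e l v b`. -/
def labelMatrix (e : Fin s → α → α → ι) (w : ι → ℝ) : Matrix α α ℝ :=
  Matrix.of fun v b => ∑ l, w (e l v b)

/-- The label read in a step from `v` to `b` when `T` more steps follow; the directions of the steps
alternate. -/
def stepLabel (e : Fin s → α → α → ι) (T : ℕ) (l : Fin s) (v b : α) : ι :=
  if Even T then e l b v else e l v b

/-- The sum over the alternating walks of `T` steps from `v` to `a` of the products of the weights. -/
def walkSum (e : Fin s → α → α → ι) (w : ι → ℝ) (a : α) : ℕ → α → ℝ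
  | 0, v => if v = a then 1 else 0
  | T + 1, v => ∑ l, ∑ b, w (stepLabel e T l v b) * walkSum e w a T b

open scoped Matrix in
lemma walkSum_two_mul (e : Fin s → α → α → ι) (w : ι → ℝ) (a : α) (k : ℕ) (v : α) :
    walkSum e w a (2 * k) v = ((labelMatrix e w * (labelMatrix e w)ᵀ) ^ k) v a := by
  induction k generalizing v with
  | zero => simp [walkSum, Matrix.one_apply]
  | succ k ih =>
    have h1 : ∀ b, walkSum e w a (2 * k + 1) b =
        ((labelMatrix e w)ᵀ * (labelMatrix e w * (labelMatrix e w)ᵀ) ^ k) b a := fun b => by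
      rw [walkSum, Finset.sum_comm, Matrix.mul_apply]
      refine Finset.sum_congr rfl fun c _ => ?_
      rw [← Finset.sum_mul, ih]
      simp [stepLabel, labelMatrix]
    have h2 : 2 * (k + 1) = 2 * k + 1 + 1 := by ring
    rw [h2, walkSum, Finset.sum_comm, pow_succ', Matrix.mul_assoc, Matrix.mul_apply]
    refine Finset.sum_congr rfl fun c _ => ?_
    rw [← Finset.sum_mul, h1]
    simp [stepLabel, labelMatrix]

open Classical in
-- `L` records the labels read so far, and the induction is on the number of remaining steps. Once
-- `L` has more than `K` distinct labels, some label of the complete walk occurs only once and the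
-- contribution vanishes. The next step either repeats a label of `L`, which by the injectivity of
-- `e` leaves at most `K` choices, or reads a new one, with `s * card α` choices of weight `p / c`
-- each. The factor `c ^ K` pays for replacing `p` by `p / c`, since at most `K` labels are new. The
-- parameter `c` is free to balance the two kinds of steps.
lemma abs_integral_walkSum_le (p : unitInterval) (e : Fin s → α → α → ι)
    (he : ∀ l v b l' v' b', e l v b = e l' v' b' → l = l' ∧ v = v' ∧ b = b') (a : α) (K : ℕ)
    {c : ℝ} (hc : 1 ≤ c) (T : ℕ) (v : α) (L : List ι) (hT : T + L.length = 2 * K) :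
    |∫ S, (L.map (centeredInd (p : ℝ) S)).prod * walkSum e (centeredInd (p : ℝ) S) a T v
        ∂(setBernoulli (Set.univ : Set ι) p)| ≤
      if L.toFinset.card ≤ K then c ^ K * (p / c) ^ L.toFinset.card *
        (K + s * Fintype.card α * (p / c)) ^ T else 0 := by
  have hp : (0 : ℝ) ≤ p := p.2.1
  have hc0 : 0 < c := by linarith
  have hq : (0 : ℝ) ≤ p / c := by positivity
  induction T generalizing v L with
  | zero =>
    have h1 := abs_integral_prod_list_le p L
    have h2 : |∫ S, (L.map (centeredInd (p : ℝ) S)).prod * walkSum e (centeredInd (p : ℝ) S) a 0 v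
        ∂(setBernoulli (Set.univ : Set ι) p)| ≤
        |∫ S, (L.map (centeredInd (p : ℝ) S)).prod ∂(setBernoulli (Set.univ : Set ι) p)| := by
      by_cases hv : v = a <;> simp [walkSum, hv]
    refine (h2.trans h1).trans ?_
    have hL : L.length = 2 * K := by omega
    rw [hL]
    by_cases hK : L.toFinset.card ≤ K
    · rw [if_pos (by omega), if_pos hK, pow_zero, mul_one, div_pow]
      have : (1 : ℝ) ≤ c ^ K / c ^ L.toFinset.card := by
        rw [one_le_div (by positivity)]
        exact pow_le_pow_right₀ hc hK
      calc (p : ℝ) ^ L.toFinset.card ≤ (c ^ K / c ^ L.toFinset.card) * p ^ L.toFinset.card :=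
            le_mul_of_one_le_left (by positivity) this
        _ = _ := by ring
    · rw [if_neg (by omega), if_neg hK]
  | succ T ih =>
    have h1 : ∀ S : Set ι, (L.map (centeredInd (p : ℝ) S)).prod *
        walkSum e (centeredInd (p : ℝ) S) a (T + 1) v = ∑ l, ∑ b,
        ((stepLabel e T l v b :: L).map (centeredInd (p : ℝ) S)).prod *
          walkSum e (centeredInd (p : ℝ) S) a T b := fun S => by
      rw [walkSum, Finset.mul_sum]
      refine Finset.sum_congr rfl fun l _ => ?_
      rw [Finset.mul_sum]
      refine Finset.sum_congr rfl fun b _ => ?_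
      rw [List.map_cons, List.prod_cons]
      ring
    simp only [h1]
    rw [integral_finsetSum _ fun _ _ => Integrable.of_finite]
    simp_rw [integral_finsetSum (Finset.univ : Finset α) fun _ _ => Integrable.of_finite]
    have h2 : ∀ l b, |∫ S, ((stepLabel e T l v b :: L).map (centeredInd (p : ℝ) S)).prod *
          walkSum e (centeredInd (p : ℝ) S) a T b ∂(setBernoulli (Set.univ : Set ι) p)| ≤
        if (stepLabel e T l v b :: L).toFinset.card ≤ K then
          c ^ K * (p / c) ^ (stepLabel e T l v b :: L).toFinset.card *
        (K + s * Fintype.card α * (p / c)) ^ T else 0 := fun l b =>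
      ih b _ (by rw [List.length_cons]; omega)
    have h3 := (Finset.abs_sum_le_sum_abs _ _).trans (Finset.sum_le_sum fun l
      (_ : l ∈ Finset.univ) => (Finset.abs_sum_le_sum_abs _ _).trans (Finset.sum_le_sum
        fun b (_ : b ∈ Finset.univ) => h2 l b))
    refine h3.trans ?_
    have hcard : ∀ l b, L.toFinset.card ≤ (stepLabel e T l v b :: L).toFinset.card := fun l b =>
      Finset.card_le_card (by intro x; simp +contextual)
    by_cases hK : L.toFinset.card ≤ K
    · rw [if_pos hK]
      set D : ℝ := c ^ K * (p / c) ^ L.toFinset.card * (K + s * Fintype.card α * (p / c)) ^ T with hD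
      have hD0 : 0 ≤ D := by positivity
      have h4 : ∀ l b, (if (stepLabel e T l v b :: L).toFinset.card ≤ K then
          c ^ K * (p / c) ^ (stepLabel e T l v b :: L).toFinset.card *
        (K + s * Fintype.card α * (p / c)) ^ T else 0) ≤
          -- A repeated label leaves the number of distinct labels unchanged; a new one increases it
          -- by one and costs `p / c`.
          D * ((if stepLabel e T l v b ∈ L.toFinset then 1 else 0) + p / c) := fun l b => by
        by_cases hm : stepLabel e T l v b ∈ L.toFinset
        · have : (stepLabel e T l v b :: L).toFinset = L.toFinset := by
            rw [List.toFinset_cons, Finset.insert_eq_of_mem hm]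
          rw [this, if_pos hK, if_pos hm, ← hD]
          nlinarith
        · have : (stepLabel e T l v b :: L).toFinset.card = L.toFinset.card + 1 := by
            rw [List.toFinset_cons, Finset.card_insert_of_notMem hm]
          rw [this, if_neg hm, zero_add]
          split_ifs
          · rw [hD, pow_succ]; exact le_of_eq (by ring)
          · positivity
      refine (Finset.sum_le_sum fun l _ => Finset.sum_le_sum fun b _ => h4 l b).trans ?_
      simp_rw [← Finset.mul_sum, Finset.sum_add_distrib]
      rw [pow_succ, ← mul_assoc, ← hD]
      refine mul_le_mul_of_nonneg_left (add_le_add ?_ ?_) hD0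
      -- The current vertex and the label determine the step, so there are no more repeating steps
      -- than distinct labels in `L`.
      · rw [← Finset.sum_product', Finset.sum_boole]
        refine Nat.cast_le.2 (le_trans ?_ hK)
        refine Finset.card_le_card_of_injOn (fun x : Fin s × α => stepLabel e T x.1 v x.2) ?_ ?_
        · intro x hx
          exact (Finset.mem_filter.1 (Finset.mem_coe.1 hx)).2
        · rintro ⟨l, b⟩ _ ⟨l', b'⟩ _ h
          simp only [stepLabel] at h
          split_ifs at h
          · have := he _ _ _ _ _ _ h; simp [this.1, this.2.1]
          · have := he _ _ _ _ _ _ h; simp [this.1, this.2.2]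
      · simp [mul_assoc]
    · rw [if_neg hK]
      refine le_of_eq (Finset.sum_eq_zero fun l _ => Finset.sum_eq_zero fun b _ => if_neg ?_)
      have := hcard l b
      omega

open scoped Matrix in
lemma sum_sq_eq_trace (A : Matrix α α ℝ) (k : ℕ) :
    ∑ i, ∑ j, ((A * Aᵀ) ^ k) i j ^ 2 = ∑ i, ((A * Aᵀ) ^ (2 * k)) i i := by
  have hs : ((A * Aᵀ) ^ k)ᵀ = (A * Aᵀ) ^ k := by
    rw [Matrix.transpose_pow, Matrix.transpose_mul, Matrix.transpose_transpose]
  refine Finset.sum_congr rfl fun i _ => ?_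
  rw [two_mul, pow_add, Matrix.mul_apply]
  refine Finset.sum_congr rfl fun j _ => ?_
  rw [sq]
  congr 1
  exact congrFun (congrFun hs.symm i) j

open scoped Matrix in
/-- The moment bound for a matrix of sums of independent centered indicators. -/
lemma integral_sum_sq_le (p : unitInterval) (e : Fin s → α → α → ι)
    (he : ∀ l v b l' v' b', e l v b = e l' v' b' → l = l' ∧ v = v' ∧ b = b') {k : ℕ} (hk : k ≠ 0)
    {d : ℝ} (hd : d = s * Fintype.card α * p) (hdk : 2 * k ≤ d) :
    ∫ S, ∑ i, ∑ j, ((labelMatrix e (centeredInd (p : ℝ) S) *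
      (labelMatrix e (centeredInd (p : ℝ) S))ᵀ) ^ k) i j ^ 2 ∂(setBernoulli (Set.univ : Set ι) p) ≤
      Fintype.card α * (8 * k * d) ^ (2 * k) := by
  have hk0 : (0 : ℝ) < 2 * k := by positivity
  -- The choice `c = d / (2k)` makes the weight of all new labels equal to the number `2k` of
  -- possible repetitions. The bound becomes `(d / (2k)) ^ (2k) * (4k) ^ (4k) = (8kd) ^ (2k)`.
  have hc : 1 ≤ d / (2 * k) := (one_le_div hk0).2 hdk
  have hd0 : 0 < d := by linarith
  simp only [sum_sq_eq_trace]
  rw [integral_finsetSum _ fun _ _ => Integrable.of_finite]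
  have h1 : ∀ i : α, ∫ S, ((labelMatrix e (centeredInd (p : ℝ) S) *
      (labelMatrix e (centeredInd (p : ℝ) S))ᵀ) ^ (2 * k)) i i
        ∂(setBernoulli (Set.univ : Set ι) p) ≤ (8 * k * d) ^ (2 * k) := fun i => by
    have h2 := le_of_abs_le (abs_integral_walkSum_le p e he i (2 * k) hc (2 * (2 * k)) i []
      (by simp))
    simp only [List.map_nil, List.prod_nil, one_mul, walkSum_two_mul, List.toFinset_nil,
      Finset.card_empty, Nat.zero_le, if_true, pow_zero, mul_one] at h2
    refine h2.trans (le_of_eq ?_)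
    have e1 : ((2 * k : ℕ) : ℝ) + s * Fintype.card α * (p / (d / (2 * k))) = 4 * k := by
      have : (s : ℝ) * Fintype.card α * (p / (d / (2 * k))) = d / d * (2 * k) := by
        rw [hd]; field_simp
      rw [this, div_self hd0.ne']; push_cast; ring
    rw [e1, pow_mul _ 2 (2 * k), ← mul_pow]
    congr 1
    field_simp
    ring
  calc _ ≤ ∑ _i : α, (8 * k * d) ^ (2 * k) := Finset.sum_le_sum fun i _ => h1 i
    _ = _ := by simp

end Moments


/-! ### Random hypergraphs are certified -/

section Chernoff

variable {ι : Type*} [Fintype ι]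

open Classical in
lemma integral_exp_sum_le (p : unitInterval) (F : Finset ι) (c : ℝ) :
    ∫ S, Real.exp (c * ∑ U ∈ F, if U ∈ S then 1 else 0) ∂(setBernoulli (Set.univ : Set ι) p) ≤
      Real.exp (p * F.card * (Real.exp c - 1)) := by
  have h1 : ∀ S : Set ι, Real.exp (c * ∑ U ∈ F, if U ∈ S then 1 else 0) =
      ∏ U, (fun (U : ι) (P : Prop) => if U ∈ F then (if P then Real.exp c else 1) else 1) U
        (U ∈ S) := fun S => by
    rw [Finset.mul_sum, Real.exp_sum, ← Finset.prod_filter_mul_prod_filter_not Finset.univ (· ∈ F)]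
    rw [Finset.prod_congr (s₂ := Finset.univ.filter (· ∉ F)) rfl (g := fun _ => (1 : ℝ))
      (fun U hU => by simp [(Finset.mem_filter.1 hU).2]), Finset.prod_const_one, mul_one]
    refine Finset.prod_congr (by simp) fun U hU => ?_
    by_cases hS : U ∈ S <;> simp_all
  rw [integral_congr_ae (ae_of_all _ h1), integral_setBernoulli_prod p
    (fun (U : ι) (P : Prop) => if U ∈ F then (if P then Real.exp c else 1) else 1)]
  have h2 : Real.exp (p * F.card * (Real.exp c - 1)) =
      ∏ _U ∈ F, Real.exp (p * (Real.exp c - 1)) := by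
    rw [Finset.prod_const, ← Real.exp_nat_mul]; ring_nf
  rw [h2, ← Finset.prod_subset (Finset.subset_univ F)]
  · refine Finset.prod_le_prod (fun U hU => ?_) fun U hU => ?_
    · simp only [hU, if_true, if_false]
      have := p.2.1
      have := p.2.2
      have := sub_nonneg.2 this
      positivity
    · simp only [hU, if_true, if_false]
      refine le_trans (le_of_eq ?_) (Real.add_one_le_exp _)
      ring
  · intro U _ hU
    simp [hU]

open Classical in
/-- A Chernoff bound for deviations in the direction given by the sign of `c`. -/
lemma chernoff (p : unitInterval) (F : Finset ι) {c : ℝ} (hc : |c| ≤ 1) :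
    (setBernoulli (Set.univ : Set ι) p).real
      {S | c * (p * F.card) + 2 * c ^ 2 * (p * F.card) ≤ c * ∑ U ∈ F, if U ∈ S then 1 else 0} ≤
      Real.exp (-(p * F.card * c ^ 2)) := by
  have h1 := mul_meas_ge_le_integral_of_nonneg (μ := setBernoulli (Set.univ : Set ι) p)
    (f := fun S => Real.exp (c * ∑ U ∈ F, if U ∈ S then 1 else 0))
    (ae_of_all _ fun _ => (Real.exp_pos _).le) Integrable.of_finite
    (Real.exp (c * (p * F.card) + 2 * c ^ 2 * (p * F.card)))
  have h2 := h1.trans (integral_exp_sum_le p F c)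
  simp only [Real.exp_le_exp] at h2
  rw [← le_div_iff₀' (Real.exp_pos _), ← Real.exp_sub] at h2
  refine h2.trans (Real.exp_le_exp.2 ?_)
  -- From `exp c - 1 ≤ c + c²` the exponent is at most `p|F|(c² - 2c²)`.
  have h3 := le_of_abs_le (Real.abs_exp_sub_one_sub_id_le hc)
  have h4 : (0 : ℝ) ≤ p * F.card := mul_nonneg p.2.1 (Nat.cast_nonneg _)
  nlinarith

end Chernoff

/-! ### Concentration of degrees, hyperedge count and window norms -/

section RandomHypergraph

variable {n : ℕ}

lemma place_self (c : Fin 3) (i j k : Fin n) : place c i j k c = i := by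
  fin_cases c <;> rfl

lemma sum_filter_edge (H : Hypergraph3 n) (c : Fin 3) (v : Fin n) :
    ∑ U ∈ Finset.univ.filter (fun U : Fin 3 → Fin n => U c = v), edge H U = degree H c v := by
  rw [Finset.sum_filter, sum_eq_sum_place c]
  simp only [place_self]
  rw [Finset.sum_eq_single v]
  · simp [degree]
  · intro b _ hb; simp [hb]
  · simp

lemma card_filter_apply_eq (c : Fin 3) (v : Fin n) :
    (Finset.univ.filter (fun U : Fin 3 → Fin n => U c = v)).card = n ^ 2 := by
  rw [Finset.card_filter, sum_eq_sum_place c]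
  simp [place_self, sq]

lemma sum_degree (H : Hypergraph3 n) (c : Fin 3) : ∑ v, degree H c v = H.ncard := by
  rw [← sum_edge, sum_eq_sum_place c]; rfl

lemma place_injective (c : Fin 3) {i j k i' j' k' : Fin n}
    (h : place c i j k = place c i' j' k') : i = i' ∧ j = j' ∧ k = k' := by
  have h0 := congrFun h 0
  have h1 := congrFun h 1
  have h2 := congrFun h 2
  fin_cases c <;> simp_all [place]

lemma shift_injective {s : ℕ} (hs : s ≤ n) (a : Fin n) {l l' : Fin s}
    (h : shift a l = shift a l') : l = l' := by
  have h1 : (a + l : ℕ) ≡ a + l' [MOD n] := congrArg Fin.val h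
  have h2 : (l : ℕ) ≡ l' [MOD n] := Nat.ModEq.add_left_cancel' _ h1
  exact Fin.ext (Nat.ModEq.eq_of_lt_of_lt h2 (l.2.trans_le hs) (l'.2.trans_le hs))

/-- The label of an entry of a window matrix. -/
def windowLabel (c : Fin 3) (s : ℕ) (a : Fin n) (l : Fin s) (j k : Fin n) : Fin 3 → Fin n :=
  place c (shift a l) j k

lemma labelMatrix_windowLabel (H : Hypergraph3 n) (c : Fin 3) (s : ℕ) (a : Fin n) (p : ℝ)
    (j k : Fin n) : labelMatrix (windowLabel c s a) (centeredInd p H) j k =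
      windowCount H c s a j k - s * p := by
  simp only [labelMatrix, windowLabel, centeredInd, Matrix.of_apply, windowCount,
    Finset.sum_sub_distrib]
  congr 1
  · rw [← Fin.sum_univ_eq_sum_range (fun l => edge H (place c (shift a l) j k))]
    push_cast
    exact Finset.sum_congr rfl fun l _ => by
      by_cases h : place c (shift a l) j k ∈ H <;> simp [edge, h]
  · simp

open scoped Matrix Matrix.Norms.L2Operator in
-- The certificate centers at the observed number of hyperedges instead of its mean, which adds a
-- constant matrix. The norm comes out below half of the threshold, and the spare factor `2 ^ (4 *
-- n.size)` absorbs the dimension factor `n` in the moment.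
lemma certified_of_bounds {H : Hypergraph3 n} {s : ℕ} {p : ℝ} (hn : 0 < n) (hs : 0 < s)
    (hp : 0 < p) (hdeg : ∀ c v, 999 / 1000 * (p * n ^ 2) ≤ degree H c v)
    (hm : (H.ncard : ℝ) ≤ 1001 / 1000 * (p * n ^ 3))
    (hB : ∀ c a, ‖labelMatrix (windowLabel c s a) (centeredInd p H)‖ ≤ s * n * p / 300) :
    Certified H s := by
  have hn' : (0 : ℝ) < n := by exact_mod_cast hn
  have hs' : (0 : ℝ) < s := by exact_mod_cast hs
  have hm2 : 999 / 1000 * (p * n ^ 3) ≤ (H.ncard : ℝ) := by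
    have h1 : ∑ v, (degree H 0 v : ℝ) = H.ncard := by exact_mod_cast sum_degree H 0
    rw [← h1]
    refine le_trans (le_of_eq ?_) (Finset.sum_le_sum fun v _ => hdeg 0 v)
    simp only [Finset.sum_const, Finset.card_univ, Fintype.card_fin, nsmul_eq_mul]; ring
  have hpn : 0 < p * n ^ 3 := by positivity
  refine ⟨hs, ?_, fun c v => ?_, fun c a => ?_⟩
  · have : (0 : ℝ) < H.ncard := by linarith
    exact_mod_cast this
  · have h1 := mul_le_mul_of_nonneg_left (hdeg c v) (by positivity : (0 : ℝ) ≤ 100 * n)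
    have : (99 : ℝ) * H.ncard ≤ 100 * n * degree H c v := by
      have : 100 * (n : ℝ) * (999 / 1000 * (p * n ^ 2)) = 999 / 10 * (p * n ^ 3) := by ring
      linarith
    exact_mod_cast this
  · set B : Matrix (Fin n) (Fin n) ℝ := (centeredMatrix H c s a).map (Int.cast : ℤ → ℝ) with hBdef
    have h2 : (((centeredMatrix H c s a * (centeredMatrix H c s a)ᵀ) ^ n.size).map
        (Int.cast : ℤ → ℝ)) = (B * Bᵀ) ^ n.size := by
      rw [hBdef, ← Matrix.transpose_map]
      have := map_pow (RingHom.mapMatrix (m := Fin n) (Int.castRingHom ℝ))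
        (centeredMatrix H c s a * (centeredMatrix H c s a)ᵀ) n.size
      rw [map_mul] at this
      exact this
    have hk : n.size ≠ 0 := (Nat.size_pos.2 hn).ne'
    have h3 : B = (100 * (n : ℝ) ^ 3) • labelMatrix (windowLabel c s a) (centeredInd p H) +
        Matrix.of fun _ _ => 100 * s * (p * n ^ 3 - H.ncard) := by
      ext j k
      simp only [hBdef, centeredMatrix, Matrix.map_apply, Matrix.of_apply, Matrix.add_apply,
        Matrix.smul_apply, smul_eq_mul, labelMatrix_windowLabel]
      push_cast; ring
    -- The random part contributes `100/300 = 1/3` and the constant matrix `100/1000 = 1/10`.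
    have h4 : ‖B‖ ≤ 13 / 30 * (s * n * (p * n ^ 3)) := by
      rw [h3]
      refine (norm_add_le _ _).trans ?_
      have e1 := norm_smul_le (100 * (n : ℝ) ^ 3)
        (labelMatrix (windowLabel c s a) (centeredInd p H))
      rw [Real.norm_of_nonneg (by positivity)] at e1
      have e2 := mul_le_mul_of_nonneg_left (hB c a) (by positivity : (0 : ℝ) ≤ 100 * (n : ℝ) ^ 3)
      have e3 := norm_const_le (ι := Fin n) (100 * s * (p * n ^ 3 - H.ncard))
      have e4 : |100 * s * (p * n ^ 3 - H.ncard)| ≤ 100 * s * (p * n ^ 3 / 1000) := by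
        rw [abs_mul, abs_of_nonneg (by positivity : (0 : ℝ) ≤ 100 * s)]
        refine mul_le_mul_of_nonneg_left (abs_le.2 ⟨?_, ?_⟩) (by positivity) <;> linarith
      rw [Fintype.card_fin] at e3
      have e5 := mul_le_mul_of_nonneg_left e4 hn'.le
      have e6 : 100 * (n : ℝ) ^ 3 * (s * n * p / 300) + n * (100 * s * (p * n ^ 3 / 1000)) =
        13 / 30 * (s * n * (p * n ^ 3)) := by ring
      linarith
    have h5 : (2 : ℝ) * ‖B‖ ≤ s * H.ncard * n := by
      have : (s : ℝ) * n * (999 / 1000 * (p * n ^ 3)) ≤ s * n * H.ncard :=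
        mul_le_mul_of_nonneg_left hm2 (by positivity)
      have : (0 : ℝ) < s * n * (p * n ^ 3) := by positivity
      linarith
    have h6 := sum_sq_le_card_mul_norm_pow B hk
    rw [← h2, Fintype.card_fin] at h6
    simp only [Matrix.map_apply] at h6
    have h7 : (n : ℝ) * ‖B‖ ^ (4 * n.size) ≤ (s * H.ncard * n : ℝ) ^ (4 * n.size) := by
      refine le_trans ?_ (pow_le_pow_left₀ (by positivity) h5 _)
      rw [mul_pow]
      refine mul_le_mul_of_nonneg_right ?_ (by positivity)
      have : (n : ℝ) ≤ 2 ^ n.size := by exact_mod_cast (Nat.lt_size_self n).le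
      exact this.trans (pow_le_pow_right₀ one_le_two (by omega))
    have h8 := h6.trans h7
    exact_mod_cast h8

open scoped Matrix Matrix.Norms.L2Operator in
-- Markov's inequality for the moment of order `4 * n.size`; `720000 = 8 * 300 ^ 2`.
lemma measure_norm_gt_le {p : unitInterval} {s : ℕ} (hn : 0 < n) (hsn : s ≤ n) {d : ℝ}
    (hd : d = s * n * p) (hdk : 2 * n.size ≤ d) (c : Fin 3) (a : Fin n) :
    (setBernoulli (Set.univ : Set (Fin 3 → Fin n)) p).real
      {H | ¬ ‖labelMatrix (windowLabel c s a) (centeredInd (p : ℝ) H)‖ ≤ d / 300} ≤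
      n * (720000 * n.size / d) ^ (2 * n.size) := by
  have hk : n.size ≠ 0 := (Nat.size_pos.2 hn).ne'
  have hk0 : (0 : ℝ) < n.size := by exact_mod_cast Nat.size_pos.2 hn
  have hd0 : 0 < d := by linarith
  have h1 := integral_sum_sq_le p (windowLabel c s a) (fun l v b l' v' b' h => by
    obtain ⟨h1, h2, h3⟩ := place_injective c h
    exact ⟨shift_injective hsn a h1, h2, h3⟩) hk (by rw [Fintype.card_fin]; exact hd) hdk
  have h2 := (mul_meas_ge_le_integral_of_nonneg
    (μ := setBernoulli (Set.univ : Set (Fin 3 → Fin n)) p)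
    (f := fun S => ∑ i, ∑ j, ((labelMatrix (windowLabel c s a) (centeredInd (p : ℝ) S) *
      (labelMatrix (windowLabel c s a) (centeredInd (p : ℝ) S))ᵀ) ^ n.size) i j ^ 2)
    (ae_of_all _ fun _ => by positivity) Integrable.of_finite ((d / 300) ^ (4 * n.size))).trans h1
  rw [← le_div_iff₀' (by positivity)] at h2
  refine le_trans (measureReal_mono fun H hH => ?_) (h2.trans (le_of_eq ?_))
  · refine le_trans (pow_le_pow_left₀ (by positivity) (le_of_not_ge hH) _)
      (norm_pow_le_sum_sq _ hk)
  · rw [Fintype.card_fin, mul_div_assoc, show 4 * n.size = 2 * (2 * n.size) by ring,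
      pow_mul (d / 300) 2 (2 * n.size), ← div_pow]
    congr 2
    field_simp
    norm_num

/-- The probability that a random hypergraph is not certified. -/
lemma measure_not_certified_le {p : unitInterval} {s : ℕ} (hn : 0 < n) (hs : 0 < s) (hsn : s ≤ n)
    {d : ℝ} (hd : d = s * n * p) (hdk : 2 * n.size ≤ d) :
    (setBernoulli (Set.univ : Set (Fin 3 → Fin n)) p).real {H | ¬ Certified H s} ≤
      (3 * n + 1) * Real.exp (-(p * n ^ 2 / 2000 ^ 2)) +
        3 * n * (n * (720000 * n.size / d) ^ (2 * n.size)) := by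
  classical
  have hn' : (1 : ℝ) ≤ n := by exact_mod_cast hn
  have hk0 : (0 : ℝ) < n.size := by exact_mod_cast Nat.size_pos.2 hn
  have hd0 : 0 < d := by linarith
  have hp : (0 : ℝ) < p := by
    rcases lt_or_eq_of_le p.2.1 with h | h
    · exact h
    · rw [← h] at hd; simp at hd; linarith
  set μ := setBernoulli (Set.univ : Set (Fin 3 → Fin n)) p
  set A : Fin 3 → Fin n → Set (Hypergraph3 n) := fun c v =>
    {H | ¬ 999 / 1000 * ((p : ℝ) * n ^ 2) ≤ degree H c v}
  set A' : Set (Hypergraph3 n) := {H | ¬ (H.ncard : ℝ) ≤ 1001 / 1000 * (p * n ^ 3)}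
  set A'' : Fin 3 → Fin n → Set (Hypergraph3 n) := fun c a =>
    {H | ¬ (Matrix.instL2OpNormedAddCommGroup.norm
      (labelMatrix (windowLabel c s a) (centeredInd (p : ℝ) H))) ≤ d / 300}
  have hsub : {H : Hypergraph3 n | ¬ Certified H s} ⊆
      ((⋃ c, ⋃ v, A c v) ∪ A') ∪ ⋃ c, ⋃ a, A'' c a := by
    intro H hH
    by_contra hcon
    simp only [Set.mem_union, Set.mem_iUnion, not_or, not_exists] at hcon
    refine hH (certified_of_bounds hn hs hp (fun c v => ?_) ?_ fun c a => ?_)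
    · exact not_not.1 (hcon.1.1 c v)
    · exact not_not.1 hcon.1.2
    · rw [← hd]; exact not_not.1 (hcon.2 c a)
  have hA : ∀ c v, μ.real (A c v) ≤ Real.exp (-(p * n ^ 2 / 2000 ^ 2)) := fun c v => by
    -- In `chernoff` the relative deviation is `2|c|`, here `1/1000`; a negative `c` gives the lower
    -- tail.
    have h1 := chernoff p (Finset.univ.filter (fun U : Fin 3 → Fin n => U c = v))
      (c := -(1 / 2000)) (by norm_num [abs_le])
    rw [card_filter_apply_eq] at h1
    refine le_trans (measureReal_mono fun H hH => ?_) (h1.trans (le_of_eq ?_))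
    · have h2 : (degree H c v : ℝ) < 999 / 1000 * (p * n ^ 2) := not_le.1 hH
      have h3 : ∑ U ∈ Finset.univ.filter (fun U : Fin 3 → Fin n => U c = v),
          (if U ∈ H then (1 : ℝ) else 0) = degree H c v := by
        rw [← sum_filter_edge]; simp [edge]
      simp only [Set.mem_ofPred_eq]
      rw [h3]
      push_cast
      linarith
    · push_cast; ring_nf
  have hA' : μ.real A' ≤ Real.exp (-(p * n ^ 2 / 2000 ^ 2)) := by
    have h1 := chernoff p (Finset.univ : Finset (Fin 3 → Fin n))
      (c := 1 / 2000) (by norm_num [abs_le])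
    have hc : ((Finset.univ : Finset (Fin 3 → Fin n)).card : ℝ) = n ^ 3 := by simp
    rw [hc] at h1
    refine le_trans (measureReal_mono fun H hH => ?_) (h1.trans (Real.exp_le_exp.2 ?_))
    · have h2 : 1001 / 1000 * ((p : ℝ) * n ^ 3) < (H.ncard : ℝ) := not_le.1 hH
      have h3 : ∑ U, (if U ∈ H then (1 : ℝ) else 0) = H.ncard := by
        rw [← sum_edge]; simp [edge]
      simp only [Set.mem_ofPred_eq]
      rw [h3]
      linarith
    · have : (p : ℝ) * n ^ 2 ≤ p * n ^ 3 :=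
        mul_le_mul_of_nonneg_left (pow_le_pow_right₀ hn' (by norm_num)) hp.le
      norm_num; linarith
  have hA'' : ∀ c a, μ.real (A'' c a) ≤ n * (720000 * n.size / d) ^ (2 * n.size) := fun c a =>
    measure_norm_gt_le hn hsn hd hdk c a
  have hU : ∀ (D : Fin 3 → Fin n → Set (Hypergraph3 n)) (x : ℝ), (∀ c v, μ.real (D c v) ≤ x) →
      μ.real (⋃ c, ⋃ v, D c v) ≤ 3 * n * x := fun D x hD => by
    refine (measureReal_iUnion_fintype_le _).trans ?_
    refine (Finset.sum_le_sum fun c _ => (measureReal_iUnion_fintype_le _).trans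
      (Finset.sum_le_sum fun v _ => hD c v)).trans (le_of_eq ?_)
    simp [mul_assoc]
  calc μ.real {H | ¬ Certified H s} ≤ _ := measureReal_mono hsub
    _ ≤ _ := measureReal_union_le _ _
    _ ≤ (μ.real (⋃ c, ⋃ v, A c v) + μ.real A') + μ.real (⋃ c, ⋃ a, A'' c a) := by
        gcongr; exact measureReal_union_le _ _
    _ ≤ (3 * n * Real.exp (-(p * n ^ 2 / 2000 ^ 2)) + Real.exp (-(p * n ^ 2 / 2000 ^ 2))) +
        3 * n * (n * (720000 * n.size / d) ^ (2 * n.size)) := by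
        gcongr
        · exact hU A _ hA
        · exact hU A'' _ hA''
    _ = _ := by ring

end RandomHypergraph


/-! ### The certifiers and their output on random hypergraphs -/

section Certifiers

open Classical in
/-- The certifier that examines windows of length `σ n r` and outputs `N n (σ n r)` if the
certificate is valid, and the trivial bound otherwise. -/
noncomputable def windowCertifier (σ N : ℕ → ℕ → ℕ) : Certifier := fun n H t r =>
  if Certified H (σ n r) ∧ 1000 * t ≤ H.ncard ∧ t * n < (r + 1) * H.ncard then N n (σ n r)
  else 2 ^ n

/-- The window length for sparse hypergraphs. -/
def windowLength (n r : ℕ) : ℕ := min n ((r + 1) ^ 2 / n + 1)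

lemma isSound_windowCertifier_sparse (σ : ℕ → ℕ → ℕ) :
    (windowCertifier σ fun n s => n * 2 ^ s).IsSound := by
  intro n H η d hη hd b
  unfold windowCertifier
  split_ifs with h
  · refine h.1.covered h.2.1 h.2.2 (fun x hx => sum_violated_le hx) ?_
    exact Nat.floor_le (by positivity)
  · exact covered_trivial _ hd

lemma isSound_windowCertifier_dense : (windowCertifier (fun _ _ => 1) fun _ _ => 1).IsSound := by
  intro n H η d hη hd b
  unfold windowCertifier
  split_ifs with h
  · refine h.1.covered_one h.2.1 h.2.2 (fun x hx => sum_violated_le hx) ?_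
    exact Nat.floor_le (by positivity)
  · exact covered_trivial _ hd

end Certifiers

/-! ### Choice of parameters and asymptotic estimates -/

section Asymptotics

open Filter

lemma eventually_log_ge (c : ℝ) : ∀ᶠ n : ℕ in atTop, c ≤ Real.log n :=
  (Real.tendsto_log_atTop.comp tendsto_natCast_atTop_atTop).eventually_ge_atTop c

lemma eventually_log_pow_le_rpow {δ : ℝ} (hδ : 0 < δ) (c : ℝ) (k : ℕ) (hc : 0 < c) :
    ∀ᶠ n : ℕ in atTop, c * Real.log n ^ k ≤ (n : ℝ) ^ δ := by
  have h1 := (Real.isLittleO_pow_log_id_atTop (n := k)).comp_tendsto (tendsto_rpow_atTop hδ)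
  have h2 := (h1.comp_tendsto tendsto_natCast_atTop_atTop).bound
    (by positivity : (0 : ℝ) < δ ^ k / c)
  filter_upwards [h2, eventually_log_ge 0, eventually_gt_atTop 0] with n hn hl hn0
  have hn0' : (0 : ℝ) < n := by exact_mod_cast hn0
  simp only [Function.comp_apply, id_eq, Real.log_rpow hn0', mul_pow, norm_mul, norm_pow] at hn
  rw [Real.norm_of_nonneg hδ.le, Real.norm_of_nonneg hl,
    Real.norm_of_nonneg (by positivity)] at hn
  have h3 : δ ^ k / c * (n : ℝ) ^ δ = δ ^ k * ((n : ℝ) ^ δ / c) := by ring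
  rw [h3, mul_le_mul_iff_right₀ (by positivity), le_div_iff₀ hc] at hn
  linarith

lemma log_le_size {n : ℕ} (hn : 0 < n) : Real.log n ≤ n.size := by
  have h1 : (n : ℝ) ≤ 2 ^ n.size := by exact_mod_cast (Nat.lt_size_self n).le
  have h2 := Real.log_le_log (by exact_mod_cast hn) h1
  rw [Real.log_pow] at h2
  have h3 : (n.size : ℝ) * Real.log 2 ≤ n.size * 1 :=
    mul_le_mul_of_nonneg_left (by linarith [Real.log_two_lt_d9]) (Nat.cast_nonneg _)
  linarith

lemma size_le_log {n : ℕ} (hn : 0 < n) : (n.size : ℝ) ≤ 2 * Real.log n + 1 := by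
  obtain ⟨k, hk⟩ : ∃ k, n.size = k + 1 := ⟨n.size - 1, by have := Nat.size_pos.2 hn; omega⟩
  have h0 : 2 ^ k ≤ n := Nat.lt_size.1 (by omega)
  have h1 : (2 : ℝ) ^ k ≤ n := by exact_mod_cast h0
  have h2 := Real.log_le_log (by positivity) h1
  rw [Real.log_pow] at h2
  have h3 : (k : ℝ) * (1 / 2) ≤ k * Real.log 2 :=
    mul_le_mul_of_nonneg_left (by linarith [Real.log_two_gt_d9]) (Nat.cast_nonneg _)
  rw [hk]; push_cast; linarith

lemma exp_neg_mul_log {n : ℕ} (hn : 0 < n) (j : ℕ) :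
    Real.exp (-(j * Real.log n)) = 1 / (n : ℝ) ^ j := by
  rw [Real.exp_neg, Real.exp_nat_mul, Real.exp_log (by exact_mod_cast hn), one_div]

lemma edge_probability {n : ℕ} (hn : 0 < n) {δ : ℝ} (hδ2 : δ < 2) :
    ((Set.projIcc (0 : ℝ) 1 zero_le_one ((n : ℝ) ^ δ * n / (n : ℝ) ^ 3) : unitInterval) : ℝ) =
      (n : ℝ) ^ δ / n ^ 2 := by
  have hn' : (0 : ℝ) < n := by exact_mod_cast hn
  have h1 : (n : ℝ) ^ δ * n / (n : ℝ) ^ 3 = (n : ℝ) ^ δ / n ^ 2 := by field_simp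
  rw [h1, Set.projIcc_of_mem _ ⟨by positivity, ?_⟩]
  rw [div_le_one (by positivity), ← Real.rpow_natCast]
  exact Real.rpow_le_rpow_of_exponent_le (by exact_mod_cast hn) (by push_cast; linarith)

/-- The expected degree `d` of a window graph is at least `log² n / 4`, while `n.size` is of order
`log n`. The base of the moment bound thus tends to zero, and its exponent `2 * n.size` turns a
small constant base into any inverse power of `n`. The Chernoff terms are negligible because the
expected vertex degree `n ^ δ` dominates `log n`. -/
lemma eventually_measure_not_certified_le {δ : ℝ} (hδ : 0 < δ) (hδ2 : δ < 2) (K : ℕ) :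
    ∀ᶠ n : ℕ in atTop, ∀ s : ℕ, 0 < s → s ≤ n → Real.log n ^ 2 / 4 ≤ s * (n : ℝ) ^ δ / n →
      (randomHypergraph3 n ((n : ℝ) ^ δ * n)).real {H | ¬ Certified H s} ≤ 1 / (n : ℝ) ^ K := by
  -- The constant is `4 * 3 * 720000`, from `d ≥ log² n / 4` and `n.size ≤ 3 log n`; the constant
  -- `4000000 = 2000 ^ 2` comes from the Chernoff exponent. The surplus powers of `n` pay for the
  -- union bounds.
  filter_upwards [eventually_log_ge (8640000 * Real.exp (K + 5)),
    eventually_log_pow_le_rpow hδ (4000000 * (K + 3)) 1 (by positivity),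
    eventually_ge_atTop 4] with n hlog hpow hn s hs hsn hd
  have hn0 : 0 < n := by omega
  have hn' : (4 : ℝ) ≤ n := by exact_mod_cast hn
  have hl : 8640000 ≤ Real.log n := by
    have : (1 : ℝ) ≤ Real.exp (K + 5) := Real.one_le_exp (by positivity)
    linarith
  have hsize := size_le_log hn0
  set d : ℝ := s * (n : ℝ) ^ δ / n with hddef
  have hp := edge_probability hn0 hδ2
  have hdk : 2 * (n.size : ℝ) ≤ d := by nlinarith
  have hd0 : 0 < d := by nlinarith
  have h1 := measure_not_certified_le (d := d) hn0 hs hsn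
    (by rw [hp, hddef]; field_simp) hdk
  rw [hp] at h1
  refine h1.trans ?_
  have hA : Real.exp (-((n : ℝ) ^ δ / n ^ 2 * n ^ 2 / 2000 ^ 2)) ≤ 1 / (n : ℝ) ^ (K + 3) := by
    rw [← exp_neg_mul_log hn0]
    refine Real.exp_le_exp.2 (neg_le_neg ?_)
    push_cast
    rw [div_mul_cancel₀ _ (by positivity)]
    rw [pow_one] at hpow
    linarith
  have hB : (720000 * n.size / d) ^ (2 * n.size) ≤ 1 / (n : ℝ) ^ (K + 5) := by
    have h2 : 720000 * n.size / d ≤ Real.exp (-(K + 5)) := by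
      rw [div_le_iff₀ hd0, Real.exp_neg]
      have h3 : Real.log n * (8640000 * Real.exp (K + 5)) / 4 ≤ d := by
        refine le_trans ?_ hd
        rw [sq]
        have := mul_le_mul_of_nonneg_left hlog (by linarith : (0 : ℝ) ≤ Real.log n)
        linarith
      have h4 := mul_le_mul_of_nonneg_left h3 (inv_nonneg.2 (Real.exp_pos (K + 5)).le)
      have h5 : (Real.exp ((K : ℝ) + 5))⁻¹ * (Real.log n * (8640000 * Real.exp (K + 5)) / 4) =
        2160000 * Real.log n := by
        field_simp; norm_num
      rw [h5] at h4
      linarith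
    refine (pow_le_pow_left₀ (by positivity) h2 _).trans ?_
    rw [← Real.exp_nat_mul]
    rw [← exp_neg_mul_log hn0]
    refine Real.exp_le_exp.2 ?_
    have h7 := log_le_size hn0
    have h8 : ((K : ℝ) + 5) * Real.log n ≤ (K + 5) * (2 * n.size) :=
      mul_le_mul_of_nonneg_left (by linarith) (by positivity)
    push_cast
    linarith
  calc _ ≤ (3 * (n : ℝ) + 1) * (1 / (n : ℝ) ^ (K + 3)) + 3 * n * (n * (1 / (n : ℝ) ^ (K + 5))) := by
        gcongr
    _ = ((3 * (n : ℝ) + 1) / n ^ 3 + 3 / n ^ 3) * (1 / (n : ℝ) ^ K) := by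
        field_simp
        ring
    _ ≤ 1 * (1 / (n : ℝ) ^ K) := by
        refine mul_le_mul_of_nonneg_right ?_ (by positivity)
        rw [← add_div, div_le_one (by positivity)]
        nlinarith [mul_self_nonneg ((n : ℝ) - 4), mul_nonneg (by linarith : (0 : ℝ) ≤ n)
          (mul_self_nonneg ((n : ℝ) - 4))]
    _ = _ := one_mul _

/-- This keeps `log (1 / θ)` at least `log 2`, so that it can absorb constants. -/
lemma clusterScale_le_half {δ : ℝ} (hδ : 0 < δ) : ∀ᶠ n : ℕ in atTop, ∀ η : ℝ, 0 ≤ η →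
    η ≤ 1 / 1000 → clusterScale n ((n : ℝ) ^ δ) η ≤ 1 / 2 := by
  filter_upwards [eventually_log_pow_le_rpow (half_pos hδ) 2 1 two_pos,
    eventually_gt_atTop 0] with n hn hn0 η h0 h1
  have hn' : (0 : ℝ) < n := by exact_mod_cast hn0
  refine max_le (by linarith) ?_
  rw [← Real.rpow_mul hn'.le, show δ * -(1 / 2) = -(δ / 2) by ring, Real.rpow_neg hn'.le,
    inv_mul_le_iff₀ (by positivity)]
  rw [pow_one] at hn
  linarith

/-- This is the purpose of the term `Δ^{-1/2} log n` in `θ`: windows of `θ²n/4` vertices have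
expected degree at least `log² n / 4`. -/
lemma log_sq_le_clusterScale {n : ℕ} (hn : 0 < n) {δ : ℝ} (hl : 0 ≤ Real.log n) (η : ℝ) :
    Real.log n ^ 2 ≤ clusterScale n ((n : ℝ) ^ δ) η ^ 2 * (n : ℝ) ^ δ := by
  have hn' : (0 : ℝ) < n := by exact_mod_cast hn
  have h1 : ((n : ℝ) ^ δ) ^ (-(1 / 2) : ℝ) * Real.log n ≤ clusterScale n ((n : ℝ) ^ δ) η :=
    le_max_right _ _
  have h2 := pow_le_pow_left₀ (by positivity) h1 2
  have h3 := mul_le_mul_of_nonneg_right h2 (by positivity : (0 : ℝ) ≤ (n : ℝ) ^ δ)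
  refine le_trans (le_of_eq ?_) h3
  have h4 : (((n : ℝ) ^ δ) ^ (-(1 / 2) : ℝ)) ^ 2 * (n : ℝ) ^ δ = 1 := by
    rw [← Real.rpow_natCast, ← Real.rpow_mul (by positivity), ← Real.rpow_mul hn'.le,
      ← Real.rpow_add hn']
    rw [show δ * (-(1 / 2) * ((2 : ℕ) : ℝ)) + δ = 0 by push_cast; ring, Real.rpow_zero]
  rw [mul_pow]
  rw [mul_right_comm, h4, one_mul]

/-- If certified hypergraphs have probability at least `1 - ε` and the output on them is small, then
the output is small with probability at least `1 - ε`. -/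
lemma measure_windowCertifier_ge {n : ℕ} {σ N : ℕ → ℕ → ℕ} {m η θ ε x : ℝ} (hη0 : 0 ≤ η)
    (hη : η ≤ 1 / 1000) (hηθ : 2 * η ≤ θ)
    (hcert : (randomHypergraph3 n m).real {H | ¬ Certified H (σ n ⌊θ * n / 2⌋₊)} ≤ ε)
    (hN : (N n (σ n ⌊θ * n / 2⌋₊) : ℝ) ≤ x) :
    1 - ε ≤ (randomHypergraph3 n m).real {H | (windowCertifier σ N n H ⌊η * (H.ncard : ℝ)⌋₊
      ⌊θ * n / 2⌋₊ : ℝ) ≤ x} := by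
  have : IsProbabilityMeasure (randomHypergraph3 n m) := by
    unfold randomHypergraph3; infer_instance
  set A : Set (Hypergraph3 n) := {H | (windowCertifier σ N n H ⌊η * (H.ncard : ℝ)⌋₊
      ⌊θ * n / 2⌋₊ : ℝ) ≤ x}
  set B : Set (Hypergraph3 n) := {H | ¬ Certified H (σ n ⌊θ * n / 2⌋₊)}
  have hsub : (Set.univ : Set (Hypergraph3 n)) ⊆ A ∪ B := by
    intro H _
    by_cases hH : Certified H (σ n ⌊θ * n / 2⌋₊)
    · left
      have hm : (0 : ℝ) < H.ncard := by exact_mod_cast hH.2.1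
      have ht : ((⌊η * (H.ncard : ℝ)⌋₊ : ℕ) : ℝ) ≤ η * H.ncard := Nat.floor_le (by positivity)
      have h1 : 1000 * ⌊η * (H.ncard : ℝ)⌋₊ ≤ H.ncard := by
        have h2 : (1000 : ℝ) * (⌊η * (H.ncard : ℝ)⌋₊ : ℕ) ≤ H.ncard := by
          have := mul_le_mul_of_nonneg_right hη hm.le
          linarith
        exact_mod_cast h2
      -- Here `2η ≤ θ` is used: small-distance solutions are within `ηn ≤ θn/2`, and distances are
      -- integers.
      have h2 : ⌊η * (H.ncard : ℝ)⌋₊ * n < (⌊θ * n / 2⌋₊ + 1) * H.ncard := by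
        have h3 : ((⌊η * (H.ncard : ℝ)⌋₊ : ℕ) : ℝ) * n < ((⌊θ * n / 2⌋₊ : ℕ) + 1) * H.ncard := by
          calc ((⌊η * (H.ncard : ℝ)⌋₊ : ℕ) : ℝ) * n ≤ (η * H.ncard) * n := by gcongr
            _ = (2 * η * n / 2) * H.ncard := by ring
            _ ≤ (θ * n / 2) * H.ncard := by gcongr
            _ < _ := by
              refine mul_lt_mul_of_pos_right ?_ hm
              exact_mod_cast Nat.lt_floor_add_one (θ * n / 2)
        exact_mod_cast h3
      change (windowCertifier σ N n H ⌊η * (H.ncard : ℝ)⌋₊ ⌊θ * n / 2⌋₊ : ℝ) ≤ x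
      rw [windowCertifier, if_pos ⟨hH, h1, h2⟩]
      exact hN
    · right; exact hH
  have h1 := (measureReal_mono (μ := randomHypergraph3 n m) hsub).trans (measureReal_union_le A B)
  rw [probReal_univ] at h1
  linarith

/-- For `δ > 1` the link of a single vertex has expected degree `n ^ (δ - 1)`, which exceeds `log²
n`. The output is `1`, and the claimed bound is at least `1` because `θ ≤ 1`. -/
lemma eventually_dense_bound {δ : ℝ} (hδ : 1 < δ) (hδ2 : δ < 2) (K : ℕ) :
    ∀ᶠ n : ℕ in atTop, ∀ η : ℝ, 0 ≤ η → η ≤ 1 / 1000 →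
      1 - 1 / (n : ℝ) ^ K ≤ (randomHypergraph3 n ((n : ℝ) ^ δ * n)).real
        {H | (windowCertifier (fun _ _ => 1) (fun _ _ => 1) n H ⌊η * (H.ncard : ℝ)⌋₊
          ⌊clusterScale n ((n : ℝ) ^ δ) η * n / 2⌋₊ : ℝ) ≤
          Real.exp (5 * (clusterScale n ((n : ℝ) ^ δ) η ^ 2 *
            Real.log (1 / clusterScale n ((n : ℝ) ^ δ) η)) * n)} := by
  filter_upwards [eventually_measure_not_certified_le (by linarith : 0 < δ) hδ2 K,
    clusterScale_le_half (by linarith : 0 < δ), eventually_log_ge 1, eventually_gt_atTop 0,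
    eventually_log_pow_le_rpow (sub_pos.2 hδ) 1 2 one_pos] with n hcert hhalf hlog hn hpow η h0 h1
  have hn' : (0 : ℝ) < n := by exact_mod_cast hn
  refine measure_windowCertifier_ge h0 h1 (le_max_left _ _) (hcert 1 one_pos hn ?_) ?_
  · rw [Real.rpow_sub_one hn'.ne'] at hpow
    rw [Nat.cast_one, one_mul]
    linarith [sq_nonneg (Real.log n)]
  · have h2 := hhalf η h0 h1
    have hθ : 0 < clusterScale n ((n : ℝ) ^ δ) η := by
      refine lt_of_lt_of_le ?_ (le_max_right _ _)
      positivity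
    have h3 : 0 ≤ Real.log (1 / clusterScale n ((n : ℝ) ^ δ) η) :=
      Real.log_nonneg (by rw [le_div_iff₀ hθ]; linarith)
    rw [Nat.cast_one]
    exact Real.one_le_exp (by positivity)

/-- For `δ ≤ 1` one has `θ²n ≥ θ²Δ ≥ log² n`, so the factor `n` in the output is harmless. The
window length is at most `θ²n + 1` and, unless capped at `n`, at least `θ²n/4`. -/
lemma eventually_sparse_bound {δ : ℝ} (hδ : 0 < δ) (hδ1 : δ ≤ 1) (K : ℕ) :
    ∀ᶠ n : ℕ in atTop, ∀ η : ℝ, 0 ≤ η → η ≤ 1 / 1000 →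
      1 - 1 / (n : ℝ) ^ K ≤ (randomHypergraph3 n ((n : ℝ) ^ δ * n)).real
        {H | (windowCertifier windowLength (fun n s => n * 2 ^ s) n H ⌊η * (H.ncard : ℝ)⌋₊
          ⌊clusterScale n ((n : ℝ) ^ δ) η * n / 2⌋₊ : ℝ) ≤
          Real.exp (5 * (clusterScale n ((n : ℝ) ^ δ) η ^ 2 *
            Real.log (1 / clusterScale n ((n : ℝ) ^ δ) η)) * n)} := by
  filter_upwards [eventually_measure_not_certified_le hδ (by linarith) K,
    clusterScale_le_half hδ, eventually_log_ge 2, eventually_gt_atTop 0,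
    eventually_log_pow_le_rpow hδ 1 2 one_pos] with n hcert hhalf hlog hn hpow η h0 h1
  have hn' : (0 : ℝ) < n := by exact_mod_cast hn
  have hsq := log_sq_le_clusterScale hn (δ := δ) (by linarith) η
  have h2 := hhalf η h0 h1
  set θ : ℝ := clusterScale n ((n : ℝ) ^ δ) η with hθdef
  have hθ : 0 < θ := by
    refine lt_of_lt_of_le ?_ (le_max_right _ _)
    have : (0 : ℝ) < Real.log n := by linarith
    positivity
  have hnδ : (n : ℝ) ^ δ ≤ n := by
    calc (n : ℝ) ^ δ ≤ (n : ℝ) ^ (1 : ℝ) :=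
          Real.rpow_le_rpow_of_exponent_le (by exact_mod_cast hn) hδ1
      _ = n := Real.rpow_one _
  have hθn : Real.log n ^ 2 ≤ θ ^ 2 * n := hsq.trans (by gcongr)
  have hfl := Nat.lt_floor_add_one (θ * n / 2)
  have hfl2 := Nat.floor_le (by positivity : 0 ≤ θ * n / 2)
  set r : ℕ := ⌊θ * n / 2⌋₊
  have hspos : 0 < windowLength n r := lt_min hn (Nat.succ_pos _)
  have hlen : (((r + 1) ^ 2 / n : ℕ) : ℝ) ≤ ((r : ℝ) + 1) ^ 2 / n := by
    have := Nat.cast_div_le (α := ℝ) (m := (r + 1) ^ 2) (n := n)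
    exact_mod_cast this
  have hlen2 : ((r : ℝ) + 1) ^ 2 / n ≤ (((r + 1) ^ 2 / n : ℕ) : ℝ) + 1 := by
    rw [div_le_iff₀ hn']
    have := (Nat.lt_div_mul_add hn (a := (r + 1) ^ 2)).le
    have h3 : ((r + 1) ^ 2 : ℕ) ≤ ((r + 1) ^ 2 / n + 1) * n := by linarith
    exact_mod_cast h3
  refine measure_windowCertifier_ge h0 h1 (le_max_left _ _)
    (hcert _ hspos (min_le_left _ _) ?_) ?_
  -- If the window is the whole vertex set, the degree is `n ^ δ`. Otherwise `r + 1 > θn/2` gives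
  -- the required length.
  · rcases min_cases n ((r + 1) ^ 2 / n + 1) with hm | hm
    · rw [windowLength, hm.1, mul_div_assoc, mul_div_cancel₀ _ hn'.ne']
      nlinarith [sq_nonneg (Real.log n)]
    · rw [windowLength, hm.1]
      have h3 : (θ * n / 2) ^ 2 / n ≤ (((r + 1) ^ 2 / n + 1 : ℕ) : ℝ) := by
        push_cast
        refine le_trans ?_ hlen2
        gcongr
      calc Real.log n ^ 2 / 4 ≤ θ ^ 2 * (n : ℝ) ^ δ / 4 := by linarith
        _ = (θ * n / 2) ^ 2 / n * (n : ℝ) ^ δ / n := by field_simp; norm_num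
        _ ≤ _ := by gcongr
  -- Since `θn ≥ 2`, also `r + 1 ≤ θn`, which bounds the window length from above.
  · have hθ2n : (2 : ℝ) ≤ θ * n := by nlinarith
    have hs : (windowLength n r : ℝ) ≤ θ ^ 2 * n + 1 := by
      have h3 : (windowLength n r : ℝ) ≤ (((r + 1) ^ 2 / n : ℕ) : ℝ) + 1 := by
        exact_mod_cast min_le_right n ((r + 1) ^ 2 / n + 1)
      have h4 : ((r : ℝ) + 1) ^ 2 / n ≤ (θ * n) ^ 2 / n := by
        gcongr; linarith
      have h5 : (θ * n) ^ 2 / n = θ ^ 2 * n := by field_simp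
      linarith
    have h3 : Real.log 2 ≤ Real.log (1 / θ) :=
      Real.log_le_log two_pos (by rw [le_div_iff₀ hθ]; linarith)
    have h4 : (0.69 : ℝ) ≤ Real.log (1 / θ) := by linarith [Real.log_two_gt_d9]
    push_cast
    calc (n : ℝ) * 2 ^ windowLength n r
        = Real.exp (Real.log n + windowLength n r * Real.log 2) := by
          rw [Real.exp_add, Real.exp_log hn', mul_comm (windowLength n r : ℝ), Real.exp_mul,
            Real.exp_log two_pos, Real.rpow_natCast]
      _ ≤ _ := Real.exp_le_exp.2 ?_
    have h5 : (windowLength n r : ℝ) * Real.log 2 ≤ windowLength n r * 1 :=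
      mul_le_mul_of_nonneg_left (by linarith [Real.log_two_lt_d9]) (Nat.cast_nonneg _)
    have h6 : θ ^ 2 * n * 0.69 ≤ θ ^ 2 * n * Real.log (1 / θ) :=
      mul_le_mul_of_nonneg_left h4 (by positivity)
    -- As `log n + 1 ≤ log² n ≤ θ²n`, the exponent is at most `2θ²n`, below `5 * 0.69 * θ²n`.
    nlinarith

end Asymptotics


/-! ### Structured programs with bounded loops and modular assignments -/

section Programs

open RAM

/-- The weight of an expression: its values have at most `weight * b` bits when all cells have at
most `b` bits. -/
def weight : Expr → ℕ
  | .const k => Nat.size k + 1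
  | .read _ i => weight i + 1
  | .add e f => weight e + weight f
  | .sub e f => weight e + weight f
  | .mul e f => weight e + weight f
  | .div e f => weight e + weight f

/-- The evaluation of an expression costs at most `costWeight * b` when all cells have at most `b`
bits. -/
def costWeight : Expr → ℕ
  | .const k => Nat.size k + 1
  | .read _ i => costWeight i + weight i + 2
  | .add e f => costWeight e + costWeight f + weight e + weight f + 1
  | .sub e f => costWeight e + costWeight f + weight e + weight f + 1
  | .mul e f => costWeight e + costWeight f + weight e + weight f + 1
  | .div e f => costWeight e + costWeight f + weight e + weight f + 1

/-- All cells have at most `b` bits. -/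
def Bounded (M : Memory) (b : ℕ) : Prop := ∀ a i, M a i < 2 ^ b

lemma weight_pos (e : Expr) : 0 < weight e := by
  induction e <;> simp only [weight] <;> omega

lemma eval_lt {M : Memory} {b : ℕ} (hM : Bounded M b) (hb : 1 ≤ b) (e : Expr) :
    e.eval M < 2 ^ (weight e * b) := by
  have hpos : ∀ e : Expr, 1 ≤ weight e * b := fun e => Nat.mul_pos (weight_pos e) hb
  induction e with
  | const k =>
    refine (Nat.lt_size_self k).trans_le (Nat.pow_le_pow_right two_pos ?_)
    simp only [weight]; nlinarith
  | read a i _ =>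
    refine (hM _ _).trans_le (Nat.pow_le_pow_right two_pos ?_)
    simp only [weight]; nlinarith [Nat.zero_le (weight i * b)]
  | add e f he hf =>
    simp only [Expr.eval, weight, add_mul, pow_add]
    -- Both powers are at least `2`, so their sum is at most their product.
    have h1 := Nat.pow_le_pow_right two_pos (hpos e)
    have h2 := Nat.pow_le_pow_right two_pos (hpos f)
    nlinarith
  | sub e f he hf =>
    simp only [Expr.eval, weight]
    refine (Nat.sub_le _ _).trans_lt (he.trans_le (Nat.pow_le_pow_right two_pos ?_))
    exact Nat.mul_le_mul_right _ (Nat.le_add_right _ _)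
  | mul e f he hf =>
    simp only [Expr.eval, weight, add_mul, pow_add]
    exact Nat.mul_lt_mul'' he hf
  | div e f he hf =>
    simp only [Expr.eval, weight]
    refine (Nat.div_le_self _ _).trans_lt (he.trans_le (Nat.pow_le_pow_right two_pos ?_))
    exact Nat.mul_le_mul_right _ (Nat.le_add_right _ _)

lemma size_eval_le {M : Memory} {b : ℕ} (hM : Bounded M b) (hb : 1 ≤ b) (e : Expr) :
    Nat.size (e.eval M) ≤ weight e * b := Nat.size_le.2 (eval_lt hM hb e)

lemma cost_le {M : Memory} {b : ℕ} (hM : Bounded M b) (hb : 1 ≤ b) (e : Expr) :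
    e.cost M ≤ costWeight e * b := by
  have hs := fun e => size_eval_le hM hb e
  induction e with
  | const k => simp only [Expr.cost, costWeight]; nlinarith
  | read a i ih =>
    have h1 : Nat.size (M a (i.eval M)) ≤ b := Nat.size_le.2 (hM _ _)
    have h2 := hs i
    simp only [Expr.cost, costWeight, add_mul]; omega
  | add e f he hf | sub e f he hf | mul e f he hf | div e f he hf =>
    have h1 := hs e
    have h2 := hs f
    simp only [Expr.cost, costWeight, add_mul]; omega

/-- The memory `M` with the content of cell `i` of bank `a` replaced by `x`. -/
def setCell (M : Memory) (a i x : ℕ) : Memory := Function.update M a (Function.update (M a) i x)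

lemma setCell_of_ne {M : Memory} {a a' : ℕ} (h : a' ≠ a) (i x : ℕ) : setCell M a i x a' = M a' := by
  simp [setCell, h]

lemma setCell_same (M : Memory) (a i x j : ℕ) :
    setCell M a i x a j = if j = i then x else M a j := by
  simp [setCell, Function.update_apply]

lemma setCell_setCell (M : Memory) (a i x y : ℕ) :
    setCell (setCell M a i x) a i y = setCell M a i y := by
  simp [setCell]

lemma Bounded.setCell {M : Memory} {b : ℕ} (hM : Bounded M b) {x : ℕ} (hx : x < 2 ^ b) (a i : ℕ) :
    Bounded (setCell M a i x) b := fun a' j => by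
  rcases eq_or_ne a' a with rfl | h
  · rw [setCell_same]; split_ifs
    · exact hx
    · exact hM _ _
  · rw [setCell_of_ne h]; exact hM _ _

/-- The content of cell `0` of bank `a`. -/
abbrev cell (a : ℕ) : Expr := .read a (.const 0)

/-- Structured programs: assignments modulo the content of cell `0` of bank `3`, and loops whose
counter runs through the numbers below the content of cell `0` of bank `0`. -/
inductive Code : Type
  | assign (a : ℕ) (i e : Expr) : Code
  | seq (p q : Code) : Code
  | ite (g : Expr) (p q : Code) : Code
  | loop (v : ℕ) (p : Code) : Code

/-- Iteration of a step that depends on the index. -/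
def iter (f : ℕ → Memory → Memory) : ℕ → Memory → Memory
  | 0, M => M
  | i + 1, M => f i (iter f i M)

namespace Code

/-- The effect of a structured program. -/
def exec : Code → Memory → Memory
  | assign a i e, M => setCell M a (i.eval M) (e.eval M % M 3 0)
  | seq p q, M => exec q (exec p M)
  | ite g p q, M => if g.eval M = 0 then exec q M else exec p M
  | loop v p, M =>
      setCell (iter (fun i M' => exec p (setCell M' v 0 i)) (M 0 0) M) v 0 (M 0 0)

/-- The translation to machine programs. -/
def compile : Code → Prog
  | assign a i e => .write a i (.sub e (.mul (cell 3) (.div e (cell 3))))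
  | seq p q => .seq p.compile q.compile
  | ite g p q => .ite g p.compile q.compile
  | loop v p => .seq (.write v (.const 0) (.const 0)) (.loop (.sub (cell 0) (cell v))
      (.seq p.compile (.write v (.const 0) (.add (cell v) (.const 1)))))

/-- The banks that a program may change. -/
def banks : Code → List ℕ
  | assign a _ _ => [a]
  | seq p q => p.banks ++ q.banks
  | ite _ p q => p.banks ++ q.banks
  | loop v p => v :: p.banks

/-- No loop counter is changed inside its loop. -/
def Disciplined : Code → Prop
  | assign _ _ _ => True
  | seq p q => p.Disciplined ∧ q.Disciplined
  | ite _ p q => p.Disciplined ∧ q.Disciplined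
  | loop v p => v ∉ p.banks ∧ p.Disciplined

lemma exec_of_notMem {p : Code} {a : ℕ} (h : a ∉ p.banks) (M : Memory) : p.exec M a = M a := by
  induction p generalizing M with
  | assign a' i e =>
    simp only [banks, List.mem_singleton] at h
    exact setCell_of_ne h _ _
  | seq p q hp hq =>
    simp only [banks, List.mem_append, not_or] at h
    rw [exec, hq h.2, hp h.1]
  | ite g p q hp hq =>
    simp only [banks, List.mem_append, not_or] at h
    rw [exec]; split_ifs
    · exact hq h.2 M
    · exact hp h.1 M
  | loop v p hp =>
    simp only [banks, List.mem_cons, not_or] at h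
    rw [exec, setCell_of_ne h.1]
    induction M 0 0 with
    | zero => rfl
    | succ k ih => rw [iter, hp h.2, setCell_of_ne h.1, ih]

lemma iter_of_notMem {p : Code} {a v : ℕ} (h : a ∉ p.banks) (hv : a ≠ v) (k : ℕ) (M : Memory) :
    iter (fun i M' => p.exec (setCell M' v 0 i)) k M a = M a := by
  induction k with
  | zero => rfl
  | succ k ih => rw [iter, exec_of_notMem h, setCell_of_ne hv, ih]

/-- Structured programs run in polynomial time. -/
theorem exists_run {p : Code} (hd : p.Disciplined) (h0 : 0 ∉ p.banks) (h3 : 3 ∉ p.banks) :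
    ∃ Q : Polynomial ℕ, ∀ (M : Memory) (b : ℕ), Bounded M b → 1 ≤ b → M 0 0 ≤ b → 0 < M 3 0 →
      Bounded (p.exec M) b ∧ ∃ T ≤ Q.eval b, Run p.compile M (p.exec M) T := by
  induction p with
  | assign a i e =>
    -- The machine has no remainder operation; `x % w` is computed as `x - w * (x / w)`.
    set e' : Expr := .sub e (.mul (cell 3) (.div e (cell 3))) with he'
    refine ⟨Polynomial.C (costWeight i + costWeight e' + weight i + weight e' + 1) * Polynomial.X,
      fun M b hM hb hn hW => ?_⟩
    have hev : e'.eval M = e.eval M % M 3 0 := by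
      rw [Nat.mod_def]; rfl
    -- The reduction keeps the new value below the modulus, so the same bit bound `b` holds
    -- throughout the run and the cost bounds merely add up.
    have hmod : e.eval M % M 3 0 < 2 ^ b := (Nat.mod_lt _ hW).trans (hM _ _)
    have hrun := Run.write M a i e'
    rw [hev] at hrun
    refine ⟨hM.setCell hmod _ _, _, ?_, hrun⟩
    · have h1 := cost_le hM hb i
      have h2 := cost_le hM hb e'
      have h4 := size_eval_le hM hb i
      have h5 := size_eval_le hM hb e'
      rw [hev] at h5
      simp only [Polynomial.eval_mul, Polynomial.eval_C, Polynomial.eval_X, add_mul]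
      omega
  | seq p q hp hq =>
    simp only [banks, List.mem_append, not_or] at h0 h3
    obtain ⟨Q, hQ⟩ := hp hd.1 h0.1 h3.1
    obtain ⟨Q', hQ'⟩ := hq hd.2 h0.2 h3.2
    refine ⟨Q + Q', fun M b hM hb hn hW => ?_⟩
    obtain ⟨h1, T, hT, hr⟩ := hQ M b hM hb hn hW
    obtain ⟨h1', T', hT', hr'⟩ := hQ' (p.exec M) b h1 hb
      (by rw [exec_of_notMem h0.1]; exact hn) (by rw [exec_of_notMem h3.1]; exact hW)
    exact ⟨h1', T + T', by rw [Polynomial.eval_add]; omega, Run.seq hr hr'⟩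
  | ite g p q hp hq =>
    simp only [banks, List.mem_append, not_or] at h0 h3
    obtain ⟨Q, hQ⟩ := hp hd.1 h0.1 h3.1
    obtain ⟨Q', hQ'⟩ := hq hd.2 h0.2 h3.2
    refine ⟨Q + Q' + Polynomial.C (costWeight g) * Polynomial.X + 1, fun M b hM hb hn hW => ?_⟩
    obtain ⟨h1, T, hT, hr⟩ := hQ M b hM hb hn hW
    obtain ⟨h1', T', hT', hr'⟩ := hQ' M b hM hb hn hW
    have hg := cost_le hM hb g
    simp only [Polynomial.eval_add, Polynomial.eval_mul, Polynomial.eval_C, Polynomial.eval_X,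
      Polynomial.eval_one]
    rw [exec]
    split_ifs with h
    · exact ⟨h1', g.cost M + T' + 1, by omega, Run.ite_false h hr'⟩
    · exact ⟨h1, g.cost M + T + 1, by omega, Run.ite_true h hr⟩
  | loop v p hp =>
    simp only [banks, List.mem_cons, not_or] at h0 h3
    obtain ⟨Q, hQ⟩ := hp hd.2 h0.2 h3.2
    set g : Expr := .sub (cell 0) (cell v) with hg
    set inc : Expr := .add (cell v) (.const 1) with hinc
    set c₁ := costWeight g + costWeight inc + weight inc + 5 with hc₁
    refine ⟨Polynomial.X * (Q + Polynomial.C c₁ * Polynomial.X) +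
      Polynomial.C (c₁ + 5) * Polynomial.X, fun M b hM hb hn hW => ?_⟩
    set f : ℕ → Memory → Memory := fun i M' => p.exec (setCell M' v 0 i) with hf
    have hsmall : ∀ i ≤ M 0 0, i < 2 ^ b := fun i hi =>
      lt_of_le_of_lt (hi.trans hn) Nat.lt_two_pow_self
    have hstate : ∀ i, iter f i M 0 0 = M 0 0 ∧ iter f i M 3 0 = M 3 0 := fun i =>
      ⟨by rw [hf, iter_of_notMem h0.2 h0.1], by rw [hf, iter_of_notMem h3.2 h3.1]⟩
    have hbd : ∀ i ≤ M 0 0, Bounded (iter f i M) b := fun i => by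
      induction i with
      | zero => exact fun _ => hM
      | succ i ih =>
        intro hi
        refine (hQ _ b ((ih (by omega)).setCell (hsmall i (by omega)) v 0) hb ?_ ?_).1
        · rw [setCell_of_ne h0.1, (hstate i).1]; exact hn
        · rw [setCell_of_ne h3.1, (hstate i).2]; exact hW
    -- Induction on the number `j` of remaining rounds; there are at most `M 0 0 ≤ b` rounds in all.
    have hloop : ∀ j i, i + j = M 0 0 → ∃ T ≤ j * (Q.eval b + c₁ * b) + c₁ * b,
        Run (.loop g (.seq p.compile (.write v (.const 0) inc))) (setCell (iter f i M) v 0 i)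
          (setCell (iter f (M 0 0) M) v 0 (M 0 0)) T := fun j => by
      induction j with
      | zero =>
        intro i hi
        have hi' : i = M 0 0 := by omega
        subst hi'
        have hB : Bounded (setCell (iter f (M 0 0) M) v 0 (M 0 0)) b :=
          (hbd _ le_rfl).setCell (hsmall _ le_rfl) v 0
        refine ⟨_, ?_, Run.loop_done ?_⟩
        · have := cost_le hB hb g
          have e : c₁ * b = costWeight g * b + costWeight inc * b + weight inc * b + 5 * b := by
            rw [hc₁]; ring
          omega
        · simp only [hg, Expr.eval, setCell_of_ne h0.1, setCell_same, if_true, (hstate _).1]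
          omega
      | succ j ih =>
        intro i hi
        set S := setCell (iter f i M) v 0 i with hS
        have hB : Bounded S b := (hbd i (by omega)).setCell (hsmall i (by omega)) v 0
        have hS0 : S 0 0 = M 0 0 := by rw [hS, setCell_of_ne h0.1, (hstate i).1]
        have hS3 : S 3 0 = M 3 0 := by rw [hS, setCell_of_ne h3.1, (hstate i).2]
        have hSv : S v 0 = i := by rw [hS, setCell_same, if_pos rfl]
        obtain ⟨h1, T, hT, hr⟩ := hQ S b hB hb (by rw [hS0]; exact hn) (by rw [hS3]; exact hW)
        have hv : p.exec S v 0 = i := by rw [exec_of_notMem hd.1, hSv]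
        have hw := Run.write (p.exec S) v (.const 0) inc
        have hinc2 : inc.eval (p.exec S) = i + 1 := by
          simp only [hinc, Expr.eval, hv]
        have hci := cost_le h1 hb inc
        have hsi := size_eval_le h1 hb inc
        obtain ⟨T', hT', hr'⟩ := ih (i + 1) (by omega)
        have hgne : g.eval S ≠ 0 := by
          simp only [hg, Expr.eval, hS0, hSv]; omega
        have hst : Function.update (p.exec S) v (Function.update (p.exec S v)
            (Expr.eval (p.exec S) (.const 0)) (inc.eval (p.exec S))) =
            setCell (iter f (i + 1) M) v 0 (i + 1) := by
          rw [hinc2]; rfl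
        rw [hst] at hw
        refine ⟨_, ?_, Run.loop_step hgne (Run.seq hr hw) hr'⟩
        have hcg := cost_le hB hb g
        have e : c₁ * b = costWeight g * b + costWeight inc * b + weight inc * b + 5 * b := by
          rw [hc₁]; ring
        have e2 : (j + 1) * (Q.eval b + c₁ * b) = j * (Q.eval b + c₁ * b) + (Q.eval b + c₁ * b) := by
          ring
        simp only [Expr.cost, Expr.eval, Nat.size_zero]
        omega
    refine ⟨(hbd _ le_rfl).setCell (hsmall _ le_rfl) v 0, ?_⟩
    obtain ⟨T, hT, hr⟩ := hloop (M 0 0) 0 (zero_add _)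
    refine ⟨_, ?_, Run.seq (Run.write M v (.const 0) (.const 0)) hr⟩
    simp only [Polynomial.eval_add, Polynomial.eval_mul, Polynomial.eval_C, Polynomial.eval_X,
      Expr.cost, Expr.eval, Nat.size_zero]
    have : M 0 0 * (Q.eval b + c₁ * b) ≤ b * (Q.eval b + c₁ * b) := Nat.mul_le_mul_right _ hn
    nlinarith

end Code

end Programs


/-! ### Reasoning about loops -/

section Loops

open RAM Code

/-- The memory `M` has the number `n` in cell `0` of bank `0` and the modulus `W` in cell `0` of
bank `3`, and all its cells outside these banks are below `W`. -/
structure Reduced (M : Memory) (n W : ℕ) : Prop where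
  size_eq : M 0 0 = n
  modulus_eq : M 3 0 = W
  size_lt : n < W
  cell_lt : ∀ a, a ≠ 0 → a ≠ 3 → ∀ i, M a i < W

variable {n W : ℕ} {M : Memory} {p : Code} {v : ℕ}

lemma Reduced.setCell (h : Reduced M n W) {a x : ℕ} (h0 : a ≠ 0) (h3 : a ≠ 3) (hx : x < W) (i : ℕ) :
    Reduced (setCell M a i x) n W where
  size_eq := by rw [setCell_of_ne h0.symm, h.size_eq]
  modulus_eq := by rw [setCell_of_ne h3.symm, h.modulus_eq]
  size_lt := h.size_lt
  cell_lt a' h0' h3' j := by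
    rcases eq_or_ne a' a with rfl | hne
    · rw [setCell_same]; split_ifs
      · exact hx
      · exact h.cell_lt _ h0 h3 _
    · rw [setCell_of_ne hne]; exact h.cell_lt _ h0' h3' _

lemma Reduced.exec (h : Reduced M n W) (h0 : 0 ∉ p.banks) (h3 : 3 ∉ p.banks) :
    Reduced (p.exec M) n W := by
  induction p generalizing M with
  | assign a i e =>
    simp only [banks, List.mem_singleton] at h0 h3
    refine h.setCell (Ne.symm h0) (Ne.symm h3) ?_ _
    rw [h.modulus_eq]
    exact Nat.mod_lt _ (by have := h.size_lt; omega)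
  | seq p q hp hq =>
    simp only [banks, List.mem_append, not_or] at h0 h3
    exact hq (hp h h0.1 h3.1) h0.2 h3.2
  | ite g p q hp hq =>
    simp only [banks, List.mem_append, not_or] at h0 h3
    rw [Code.exec]; split_ifs
    · exact hq h h0.2 h3.2
    · exact hp h h0.1 h3.1
  | loop v p hp =>
    simp only [banks, List.mem_cons, not_or] at h0 h3
    have hk : ∀ k ≤ n, Reduced (iter (fun i M' => p.exec (XORCert.setCell M' v 0 i)) k M) n W := by
      intro k
      induction k with
      | zero => exact fun _ => h
      | succ k ih =>
        intro hk
        have := h.size_lt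
        exact hp ((ih (by omega)).setCell (Ne.symm h0.1) (Ne.symm h3.1) (by omega) 0) h0.2 h3.2
    rw [Code.exec, h.size_eq]
    exact (hk n le_rfl).setCell (Ne.symm h0.1) (Ne.symm h3.1) h.size_lt 0

/-- Induction along a loop, for a property of the memory that does not depend on the counter. -/
lemma exec_loop_induction (h : Reduced M n W) (h0 : 0 ∉ (loop v p).banks)
    (h3 : 3 ∉ (loop v p).banks) (P : ℕ → Memory → Prop)
    (hv : ∀ i M' x, P i M' → P i (setCell M' v 0 x)) (hM : P 0 M)
    (hstep : ∀ i < n, ∀ M', Reduced M' n W → (∀ c ∉ (loop v p).banks, M' c = M c) →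
      M' v 0 = i → P i M' → P (i + 1) (p.exec M')) : P n ((loop v p).exec M) := by
  have h0' := h0
  have h3' := h3
  simp only [banks, List.mem_cons, not_or] at h0 h3
  set f : ℕ → Memory → Memory := fun i M' => p.exec (setCell M' v 0 i) with hf
  have hk : ∀ k ≤ n, Reduced (iter f k M) n W ∧ P k (iter f k M) ∧
      ∀ c ∉ (loop v p).banks, iter f k M c = M c := by
    intro k
    induction k with
    | zero => exact fun _ => ⟨h, hM, fun _ _ => rfl⟩
    | succ k ih =>
      intro hk
      obtain ⟨i1, i2, i3⟩ := ih (by omega)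
      have hs := h.size_lt
      have hr : Reduced (setCell (iter f k M) v 0 k) n W :=
        i1.setCell (Ne.symm h0.1) (Ne.symm h3.1) (by omega) 0
      have ha : ∀ c ∉ (loop v p).banks, setCell (iter f k M) v 0 k c = M c := fun c hc => by
        rw [setCell_of_ne (fun hcv => hc (by simp [banks, hcv])), i3 c hc]
      refine ⟨hr.exec h0.2 h3.2, hstep k (by omega) _ hr ha (by simp [setCell_same])
        (hv _ _ _ i2), fun c hc => ?_⟩
      have hcp : c ∉ p.banks := fun hcp => hc (by simp [banks, hcp])
      exact (exec_of_notMem hcp (setCell (iter f k M) v 0 k)).trans (ha c hc)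
  rw [Code.exec, h.size_eq]
  exact hv _ _ _ (hk n le_rfl).2.1

/-- A loop whose body adds `val i` to cell `0` of bank `a`. -/
lemma exec_loop_add (h : Reduced M n W) (h0 : 0 ∉ (loop v p).banks) (h3 : 3 ∉ (loop v p).banks)
    {a : ℕ} (hav : a ≠ v) {R : Type*} [CommRing R] (val : Fin n → R)
    (hstep : ∀ (i : Fin n) (M' : Memory), Reduced M' n W → (∀ c ∉ (loop v p).banks, M' c = M c) →
      M' v 0 = i → ((p.exec M' a 0 : ℕ) : R) = (M' a 0 : ℕ) + val i) :
    (((loop v p).exec M a 0 : ℕ) : R) = (M a 0 : ℕ) + ∑ i, val i := by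
  have key := exec_loop_induction h h0 h3 (fun i M' => ((M' a 0 : ℕ) : R) =
    (M a 0 : ℕ) + ∑ j ∈ Finset.range i, if hj : j < n then val ⟨j, hj⟩ else 0)
    (fun i M' x hM' => by rw [setCell_of_ne hav]; exact hM') (by simp)
    (fun i hi M' hr ha hvi hP => by
      rw [hstep ⟨i, hi⟩ M' hr ha hvi, hP, Finset.sum_range_succ, dif_pos hi, add_assoc])
  rw [key, Finset.sum_range]
  simp

/-- A loop whose body keeps the flag in cell `0` of bank `a` at zero exactly when `good i` holds. -/
lemma exec_loop_flag (h : Reduced M n W) (h0 : 0 ∉ (loop v p).banks) (h3 : 3 ∉ (loop v p).banks)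
    {a : ℕ} (hav : a ≠ v) (good : Fin n → Prop)
    (hstep : ∀ (i : Fin n) (M' : Memory), Reduced M' n W → (∀ c ∉ (loop v p).banks, M' c = M c) →
      M' v 0 = i → (p.exec M' a 0 = 0 ↔ M' a 0 = 0 ∧ good i)) :
    (loop v p).exec M a 0 = 0 ↔ M a 0 = 0 ∧ ∀ i, good i := by
  have key := exec_loop_induction h h0 h3 (fun i M' => M' a 0 = 0 ↔
    M a 0 = 0 ∧ ∀ j : Fin n, (j : ℕ) < i → good j)
    (fun i M' x hM' => by rw [setCell_of_ne hav]; exact hM') (by simp)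
    (fun i hi M' hr ha hvi hP => by
      rw [hstep ⟨i, hi⟩ M' hr ha hvi, hP, and_assoc, and_congr_right_iff]
      intro _
      constructor
      · rintro ⟨h1, h2⟩ j hj
        rcases Nat.lt_succ_iff_lt_or_eq.1 hj with hlt | heq
        · exact h1 j hlt
        · have : j = ⟨i, hi⟩ := Fin.ext heq
          exact this ▸ h2
      · exact fun h1 => ⟨fun j hj => h1 j (by omega), h1 ⟨i, hi⟩ (by simp)⟩)
  rw [key]
  simp

/-- Bank `a` holds the matrix `A`. -/
def Holds {R : Type*} [CommRing R] (M : Memory) (a : ℕ) (A : Matrix (Fin n) (Fin n) R) : Prop :=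
  ∀ j k : Fin n, ((M a (j * n + k) : ℕ) : R) = A j k

lemma index_injective {j k j' k' : ℕ} (hk : k < n) (hk' : k' < n)
    (h : j * n + k = j' * n + k') : j = j' ∧ k = k' := by
  have h1 := congrArg (· % n) h
  have h2 := congrArg (· / n) h
  have hn : 0 < n := by omega
  simp only [Nat.mul_add_mod_self_right, Nat.mod_eq_of_lt hk, Nat.mod_eq_of_lt hk'] at h1
  rw [add_comm, add_comm (j' * n)] at h2
  simp only [Nat.add_mul_div_right _ _ hn, Nat.div_eq_of_lt hk, Nat.div_eq_of_lt hk',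
    zero_add] at h2
  exact ⟨h2, h1⟩

/-- A double loop whose body writes the entry `A j k`. -/
lemma exec_fill (h : Reduced M n W) {u a : ℕ} (h0 : 0 ∉ (loop u (loop v p)).banks)
    (h3 : 3 ∉ (loop u (loop v p)).banks) (hu : u ∉ (loop v p).banks) (hau : a ≠ u) (hav : a ≠ v)
    {R : Type*} [CommRing R]
    (A : Matrix (Fin n) (Fin n) R)
    (hstep : ∀ (j k : Fin n) (M' : Memory), Reduced M' n W →
      (∀ c ∉ (loop u (loop v p)).banks, M' c = M c) → M' u 0 = j → M' v 0 = k →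
      ∃ x : ℕ, p.exec M' a = Function.update (M' a) (j * n + k) x ∧ (x : R) = A j k) :
    Holds ((loop u (loop v p)).exec M) a A := by
  have h0' : 0 ∉ (loop v p).banks := fun hc => h0 (by rw [banks]; exact List.mem_cons_of_mem _ hc)
  have h3' : 3 ∉ (loop v p).banks := fun hc => h3 (by rw [banks]; exact List.mem_cons_of_mem _ hc)
  have key := exec_loop_induction h h0 h3 (fun i M' => ∀ j k : Fin n, (j : ℕ) < i →
    ((M' a (j * n + k) : ℕ) : R) = A j k)
    (fun i M' x hM' => by rw [setCell_of_ne hau]; exact hM') (fun j k hj => absurd hj (by simp))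
    (fun i hi M' hr ha hui hP => ?_)
  · exact fun j k => key j k j.2
  · have inner := exec_loop_induction hr h0' h3' (fun i' M'' => ∀ j k : Fin n,
      ((j : ℕ) < i ∨ (j : ℕ) = i ∧ (k : ℕ) < i') → ((M'' a (j * n + k) : ℕ) : R) = A j k)
      (fun i M' x hM' => by rw [setCell_of_ne hav]; exact hM')
      (fun j k hj => hP j k (by omega)) (fun i' hi' M'' hr' ha' hvi hP' j k hjk => ?_)
    · intro j k hj
      exact inner j k (by rcases Nat.lt_succ_iff_lt_or_eq.1 hj with h1 | h1
                          · exact Or.inl h1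
                          · exact Or.inr ⟨h1, k.2⟩)
    · obtain ⟨x, hx, hxA⟩ := hstep ⟨i, hi⟩ ⟨i', hi'⟩ M'' hr' (fun c hc => by
        rw [ha' c (fun hcb => hc (by rw [banks]; exact List.mem_cons_of_mem _ hcb)), ha c hc])
        (by rw [ha' u hu, hui]) hvi
      rw [hx, Function.update_apply]
      split_ifs with heq
      · obtain ⟨e1, e2⟩ := index_injective k.2 hi' heq
        have e1' : j = ⟨i, hi⟩ := Fin.ext e1
        have e2' : k = ⟨i', hi'⟩ := Fin.ext e2
        rw [hxA, e1', e2']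
      · refine hP' j k ?_
        rcases hjk with h1 | ⟨h1, h2⟩
        · exact Or.inl h1
        · refine Or.inr ⟨h1, ?_⟩
          rcases Nat.lt_succ_iff_lt_or_eq.1 h2 with h4 | h4
          · exact h4
          · exact absurd (by rw [h1, h4]) heq

/-- The reduction is invisible in `ZMod W`, so the programs are verified there by ring computations.
`eq_of_cast_eq` returns to natural numbers once the value is known to be below `W`. -/
lemma cast_exec_assign (h : M 3 0 = W) (a : ℕ) (i e : Expr) :
    (((assign a i e).exec M a (i.eval M) : ℕ) : ZMod W) = (e.eval M : ℕ) := by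
  rw [exec, setCell_same, if_pos rfl, h, ZMod.natCast_mod]

lemma eq_of_cast_eq {x y : ℕ} (hx : x < W) (hy : y < W) (h : (x : ZMod W) = y) : x = y := by
  have := (ZMod.natCast_eq_natCast_iff' x y W).1 h
  rwa [Nat.mod_eq_of_lt hx, Nat.mod_eq_of_lt hy] at this

end Loops


/-! ### The certification program -/

section CertificationProgram

open RAM Code

variable {n W : ℕ} {M : Memory} {H : Hypergraph3 n} {t r s : ℕ}

/-- The index of entry `(e, f)` of an `n × n` matrix. -/
def idx (e f : Expr) : Expr := .add (.mul e (cell 0)) f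

/-- The entry of the adjacency tensor at the triple `place c x y z`. -/
def adjacency (c : Fin 3) (x y z : Expr) : Expr :=
  match c with
  | 0 => .read 1 (idx (idx x y) z)
  | 1 => .read 1 (idx (idx y x) z)
  | 2 => .read 1 (idx (idx y z) x)

lemma eval_idx (h : M 0 0 = n) (e f : Expr) : (idx e f).eval M = e.eval M * n + f.eval M := by
  simp [idx, Expr.eval, h]

lemma inputMemory_edge (H : Hypergraph3 n) (t r : ℕ) (U : Fin 3 → Fin n) :
    inputMemory n H t r 1 (((U 0 : ℕ) * n + (U 1 : ℕ)) * n + (U 2 : ℕ)) = edge H U := by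
  have h1 : (∃ V ∈ H, ((U 0 : ℕ) * n + (U 1 : ℕ)) * n + (U 2 : ℕ) =
      ((V 0 : ℕ) * n + (V 1 : ℕ)) * n + (V 2 : ℕ)) ↔ U ∈ H := by
    constructor
    · rintro ⟨V, hV, hVU⟩
      obtain ⟨h2, h3⟩ := index_injective (U 2).2 (V 2).2 hVU
      obtain ⟨h4, h5⟩ := index_injective (U 1).2 (V 1).2 h2
      have : U = V := by
        funext i
        fin_cases i
        · exact Fin.ext h4
        · exact Fin.ext h5
        · exact Fin.ext h3
      exact this ▸ hV
    · exact fun hU => ⟨U, hU, rfl⟩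
  unfold edge
  by_cases hU : U ∈ H
  · rw [if_pos hU]; simp only [inputMemory]; rw [if_pos (h1.2 hU)]
  · rw [if_neg hU]; simp only [inputMemory]; rw [if_neg (fun hc => hU (h1.1 hc))]

lemma eval_adjacency (h0 : M 0 0 = n) (h1 : M 1 = inputMemory n H t r 1) (c : Fin 3)
    {x y z : Expr} {i j k : Fin n} (hx : x.eval M = i) (hy : y.eval M = j) (hz : z.eval M = k) :
    (adjacency c x y z).eval M = edge H (place c i j k) := by
  have := inputMemory_edge H t r (place c i j k)
  fin_cases c
  · simp only [adjacency, Expr.eval, eval_idx h0, hx, hy, hz, h1]; exact this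
  · simp only [adjacency, Expr.eval, eval_idx h0, hx, hy, hz, h1]; exact this
  · simp only [adjacency, Expr.eval, eval_idx h0, hx, hy, hz, h1]; exact this

/-- Store the sum of `e`, over the values of the counter in bank `13`, in bank `27`. -/
def sumCode (e : Expr) : Code :=
  seq (assign 27 (.const 0) (.const 0)) (loop 13 (assign 27 (.const 0) (.add (cell 27) e)))

lemma exec_sumCode (h : Reduced M n W) (e : Expr) (val : Fin n → ZMod W)
    (he : ∀ (l : Fin n) (M' : Memory), Reduced M' n W → (∀ c ∉ [13, 27], M' c = M c) →
      M' 13 0 = l → ((e.eval M' : ℕ) : ZMod W) = val l) :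
    (((sumCode e).exec M 27 0 : ℕ) : ZMod W) = ∑ l, val l := by
  have h1 : Reduced ((assign 27 (.const 0) (.const 0)).exec M) n W :=
    h.exec (by simp [banks]) (by simp [banks])
  rw [sumCode, exec, exec_loop_add h1 (by simp [banks]) (by simp [banks]) (by decide) val]
  · have := cast_exec_assign h.modulus_eq 27 (.const 0) (.const 0)
    simp only [Expr.eval] at this
    rw [this, Nat.cast_zero, zero_add]
  · intro l M' hr ha hl
    have h2 := cast_exec_assign hr.modulus_eq 27 (.const 0) (.add (cell 27) e)
    simp only [Expr.eval] at h2
    rw [h2, Nat.cast_add, he l M' hr (fun c hc => ?_) hl]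
    rw [ha c (by simpa [banks] using hc), exec_of_notMem (by simp at hc; simp [banks, hc])]

/-- Fill the matrix in bank `a` with the values of `e` at the counters in banks `11` and `12`. -/
def fillCode (a : ℕ) (e : Expr) : Code :=
  loop 11 (loop 12 (assign a (idx (cell 11) (cell 12)) e))

lemma exec_fillCode (h : Reduced M n W) {a : ℕ} (ha : a ∉ [0, 3, 11, 12]) (e : Expr)
    (A : Matrix (Fin n) (Fin n) (ZMod W))
    (he : ∀ (j k : Fin n) (M' : Memory), Reduced M' n W → (∀ c ∉ [11, 12, a], M' c = M c) →
      M' 11 0 = j → M' 12 0 = k → ((e.eval M' : ℕ) : ZMod W) = A j k) :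
    Holds ((fillCode a e).exec M) a A := by
  simp only [List.mem_cons, List.not_mem_nil, or_false, not_or] at ha
  refine exec_fill h (by simp [banks]; omega) (by simp [banks]; omega) (by simp [banks]; omega)
    ha.2.2.1 ha.2.2.2 A fun j k M' hr hag hj hk => ?_
  refine ⟨e.eval M' % M' 3 0, ?_, ?_⟩
  · simp only [exec, setCell, Function.update_self, eval_idx hr.size_eq, Expr.eval, hj, hk]
  · rw [hr.modulus_eq, ZMod.natCast_mod]
    exact he j k M' hr (fun c hc => hag c (by simpa [banks] using hc)) hj hk

/-- Fill the matrix in bank `a` with the values of `e'`, which may use the sum of `e` in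
bank `27`. -/
def fillSumCode (a : ℕ) (e e' : Expr) : Code :=
  loop 11 (loop 12 (seq (sumCode e) (assign a (idx (cell 11) (cell 12)) e')))

/-- The map `φ` postprocesses the inner sum: it is the identity for matrix products, and the affine
centering for window matrices. -/
lemma exec_fillSumCode (h : Reduced M n W) {a : ℕ} (ha : a ∉ [0, 3, 11, 12, 13, 27]) (e e' : Expr)
    (val : Fin n → Fin n → Fin n → ZMod W) (φ : ZMod W → ZMod W)
    (he : ∀ (j k l : Fin n) (M' : Memory), Reduced M' n W →
      (∀ c ∉ [11, 12, 13, 27, a], M' c = M c) → M' 11 0 = j → M' 12 0 = k → M' 13 0 = l →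
      ((e.eval M' : ℕ) : ZMod W) = val j k l)
    (he' : ∀ M' : Memory, Reduced M' n W → (∀ c ∉ [11, 12, 13, 27, a], M' c = M c) →
      ((e'.eval M' : ℕ) : ZMod W) = φ (M' 27 0 : ℕ)) :
    Holds ((fillSumCode a e e').exec M) a (Matrix.of fun j k => φ (∑ l, val j k l)) := by
  simp only [List.mem_cons, List.not_mem_nil, or_false, not_or] at ha
  refine exec_fill h (by simp [banks, sumCode]; omega) (by simp [banks, sumCode]; omega)
    (by simp [banks, sumCode]; omega) ha.2.2.1 ha.2.2.2.1 _ fun j k M' hr hag hj hk => ?_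
  have hb : ∀ c, c ∉ [11, 12, 13, 27, a] → M' c = M c := fun c hc =>
    hag c (by simp at hc; simp [banks, sumCode]; omega)
  have h2 : ∀ c, c ∉ [13, 27] → (sumCode e).exec M' c = M' c := fun c hc =>
    exec_of_notMem (by simp at hc; simp [banks, sumCode]; omega) M'
  have hr2 : Reduced ((sumCode e).exec M') n W :=
    hr.exec (by simp [banks, sumCode]) (by simp [banks, sumCode])
  refine ⟨e'.eval ((sumCode e).exec M') % (sumCode e).exec M' 3 0, ?_, ?_⟩
  · simp only [exec, setCell, Function.update_self, eval_idx hr2.size_eq, Expr.eval,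
      h2 11 (by decide), h2 12 (by decide), hj, hk]
    rw [h2 a (by simp; omega)]
  · rw [hr2.modulus_eq, ZMod.natCast_mod, he' _ hr2 (fun c hc => ?_), exec_sumCode hr e (val j k)]
    · rfl
    · intro l M'' hr'' hag'' hl
      refine he j k l M'' hr'' (fun c hc => ?_) ?_ ?_ hl
      · rw [hag'' c (by simp at hc; simp; omega), hb c hc]
      · rw [hag'' 11 (by decide), hj]
      · rw [hag'' 12 (by decide), hk]
    · rw [h2 c (by simp at hc; simp; omega), hb c hc]

/-- Fill bank `d` with the sums of the products of the entries of the rows of the matrix in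
bank `a` with the values of `e`. -/
def mulCode (d a : ℕ) (e : Expr) : Code :=
  fillSumCode d (.mul (.read a (idx (cell 11) (cell 13))) e) (cell 27)

lemma exec_mulCode (h : Reduced M n W) {d a b : ℕ} (hd : d ∉ [0, 3, 11, 12, 13, 27])
    (ha : a ∉ [11, 12, 13, 27, d]) (hb : b ∉ [11, 12, 13, 27, d])
    {A B : Matrix (Fin n) (Fin n) (ZMod W)} (hA : Holds M a A) (hB : Holds M b B) :
    Holds ((mulCode d a (.read b (idx (cell 13) (cell 12)))).exec M) d (A * B) := by
  have := exec_fillSumCode h hd (.mul (.read a (idx (cell 11) (cell 13)))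
    (.read b (idx (cell 13) (cell 12)))) (cell 27) (fun j k l => A j l * B l k) id
    (fun j k l M' hr hag hj hk hl => ?_) (fun M' _ _ => rfl)
  · exact this
  · simp only [Expr.eval, eval_idx hr.size_eq, hj, hk, hl, hag a ha, hag b hb]
    rw [Nat.cast_mul, hA j l, hB l k]

open scoped Matrix in
lemma exec_mulCode_transpose (h : Reduced M n W) {d a b : ℕ} (hd : d ∉ [0, 3, 11, 12, 13, 27])
    (ha : a ∉ [11, 12, 13, 27, d]) (hb : b ∉ [11, 12, 13, 27, d])
    {A B : Matrix (Fin n) (Fin n) (ZMod W)} (hA : Holds M a A) (hB : Holds M b B) :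
    Holds ((mulCode d a (.read b (idx (cell 12) (cell 13)))).exec M) d (A * Bᵀ) := by
  have := exec_fillSumCode h hd (.mul (.read a (idx (cell 11) (cell 13)))
    (.read b (idx (cell 12) (cell 13)))) (cell 27) (fun j k l => A j l * B k l) id
    (fun j k l M' hr hag hj hk hl => ?_) (fun M' _ _ => rfl)
  · exact this
  · simp only [Expr.eval, eval_idx hr.size_eq, hj, hk, hl, hag a ha, hag b hb]
    rw [Nat.cast_mul, hA j l, hB k l]

/-- Set the flag in bank `22` unless the value of `g` is zero. -/
def flagCode (g : Expr) : Code :=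
  assign 22 (.const 0) (.sub (.const 1) (.sub (.const 1) (.add (cell 22) g)))

/-- With truncated subtraction `1 - (1 - x)` is `min x 1`, so the flag stays in `{0, 1}`; `0 < n <
W` ensures that the reduction does not turn `1` into `0`. -/
lemma exec_flagCode (h : Reduced M n W) (hn : 0 < n) (g : Expr) :
    (flagCode g).exec M 22 0 = 0 ↔ M 22 0 = 0 ∧ g.eval M = 0 := by
  have hW := h.size_lt
  simp only [flagCode, exec, Expr.eval, setCell_same, if_true, h.modulus_eq]
  rw [Nat.mod_eq_of_lt (by omega)]
  omega

end CertificationProgram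


/-! ### Computing the window matrices and their moments -/

section Checks

open RAM Code

variable {n W : ℕ} {M : Memory} {H : Hypergraph3 n} {t r s : ℕ}

/-- The memory holds the adjacency tensor of `H`, its number of hyperedges and the window
length `s`. -/
structure Loaded (M : Memory) (W : ℕ) (H : Hypergraph3 n) (t r s : ℕ) : Prop
    extends Reduced M n W where
  tensor_eq : M 1 = inputMemory n H t r 1
  count_eq : M 20 0 = H.ncard
  length_eq : M 21 0 = s

lemma Loaded.congr (h : Loaded M W H t r s) {M' : Memory} (hr : Reduced M' n W) (h1 : M' 1 = M 1)
    (h20 : M' 20 = M 20) (h21 : M' 21 = M 21) : Loaded M' W H t r s where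
  toReduced := hr
  tensor_eq := h1.trans h.tensor_eq
  count_eq := by rw [h20, h.count_eq]
  length_eq := by rw [h21, h.length_eq]

lemma Loaded.exec (h : Loaded M W H t r s) {p : Code} (h0 : 0 ∉ p.banks) (h3 : 3 ∉ p.banks)
    (h1 : 1 ∉ p.banks) (h20 : 20 ∉ p.banks) (h21 : 21 ∉ p.banks) :
    Loaded (p.exec M) W H t r s :=
  h.congr (h.toReduced.exec h0 h3) (exec_of_notMem h1 M) (exec_of_notMem h20 M)
    (exec_of_notMem h21 M)

/-- `n ^ 3`. -/
def cubeExpr : Expr := .mul (cell 0) (.mul (cell 0) (cell 0))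

/-- `s * m`. -/
def lengthMulCount : Expr := .mul (cell 21) (cell 20)

/-- Store the centered window matrix in bank `30`. -/
def windowCode (c : Fin 3) : Code :=
  fillSumCode 30
    (.mul (.sub (.const 1) (.sub (.const 1) (.sub (cell 21) (cell 13))))
      (adjacency c (.sub (.add (cell 14) (cell 13))
        (.mul (cell 0) (.div (.add (cell 14) (cell 13)) (cell 0)))) (cell 11) (cell 12)))
    (.mul (.const 100) (.sub (.add (.mul cubeExpr (cell 27)) (.mul (cell 3) lengthMulCount))
      lengthMulCount))

/-- Every loop counter runs up to `n`, so a window is cut out by the indicator `1 - (1 - (s - l))`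
of `l < s`. -/
lemma windowCount_eq_sum (hs : s ≤ n) (c : Fin 3) (a j k : Fin n) :
    windowCount H c s a j k =
      ∑ l : Fin n, (1 - (1 - (s - l))) * edge H (place c (shift a l) j k) := by
  rw [Fin.sum_univ_eq_sum_range (fun l => (1 - (1 - (s - l))) * edge H (place c (shift a l) j k)),
    windowCount, ← Finset.sum_subset (Finset.range_mono hs)]
  · refine Finset.sum_congr rfl fun l hl => ?_
    have : 1 - (1 - (s - l)) = 1 := by have := Finset.mem_range.1 hl; omega
    rw [this, one_mul]
  · intro l _ hl
    have : 1 - (1 - (s - l)) = 0 := by rw [Finset.mem_range] at hl; omega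
    rw [this, zero_mul]

lemma exec_windowCode (h : Loaded M W H t r s) (hs : s ≤ n) (c : Fin 3) {a : Fin n}
    (ha : M 14 0 = a) : Holds ((windowCode c).exec M) 30
      ((centeredMatrix H c s a).map (Int.castRingHom (ZMod W))) := by
  have key := exec_fillSumCode h.toReduced (a := 30) (by decide)
    (.mul (.sub (.const 1) (.sub (.const 1) (.sub (cell 21) (cell 13))))
      (adjacency c (.sub (.add (cell 14) (cell 13))
        (.mul (cell 0) (.div (.add (cell 14) (cell 13)) (cell 0)))) (cell 11) (cell 12)))
    (.mul (.const 100) (.sub (.add (.mul cubeExpr (cell 27)) (.mul (cell 3) lengthMulCount))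
      lengthMulCount))
    (fun j k l => (((1 - (1 - (s - l))) * edge H (place c (shift a l) j k) : ℕ) : ZMod W))
    (fun x => 100 * ((n : ZMod W) ^ 3 * x - s * H.ncard))
    (fun j k l M' hr hag hj hk hl => ?_) (fun M' hr hag => ?_)
  · intro j k
    refine (key j k).trans ?_
    simp only [Matrix.of_apply, Matrix.map_apply, centeredMatrix, windowCount_eq_sum hs,
      eq_intCast]
    push_cast
    rfl
  · have hL : Loaded M' W H t r s := h.congr hr (hag 1 (by decide)) (hag 20 (by decide))
      (hag 21 (by decide))
    simp only [Expr.eval]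
    rw [eval_adjacency hL.size_eq hL.tensor_eq c (i := shift a l) (y := cell 11) (z := cell 12)
      ?_ hj hk, hL.length_eq, hl]
    simp only [Expr.eval, hl, hL.size_eq, hag 14 (by decide), ha]
    exact (Nat.mod_def _ _).symm
  · have hL : Loaded M' W H t r s := h.congr hr (hag 1 (by decide)) (hag 20 (by decide))
      (hag 21 (by decide))
    simp only [Expr.eval, cubeExpr, lengthMulCount, hL.size_eq, hL.modulus_eq, hL.length_eq,
      hL.count_eq]
    have hWpos : 1 ≤ W := by have := h.size_lt; omega
    -- The added multiple of `W` prevents truncation in the subtraction and vanishes in `ZMod W`.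
    have hle : s * H.ncard ≤ n * (n * n) * M' 27 0 + W * (s * H.ncard) :=
      le_add_left (Nat.le_mul_of_pos_left _ hWpos)
    rw [Nat.cast_mul, Nat.cast_sub hle]
    push_cast
    rw [ZMod.natCast_self]
    ring

/-- Multiply the matrix in bank `32` by the matrix in bank `31` and bank `23` by the fourth power of
`s * m * n`, and halve bank `25`. -/
def powerStep : Code :=
  seq (mulCode 33 32 (.read 31 (idx (cell 13) (cell 12))))
    (seq (fillCode 32 (.read 33 (idx (cell 11) (cell 12))))
      (seq (assign 23 (.const 0) (.mul (cell 23)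
          (.mul (.mul (.mul lengthMulCount (cell 0)) (.mul lengthMulCount (cell 0)))
            (.mul (.mul lengthMulCount (cell 0)) (.mul lengthMulCount (cell 0))))))
        (assign 25 (.const 0) (.div (cell 25) (.const 2)))))

/-- Raise the matrix in bank `31` to the power `Nat.size n`, in bank `32`; bank `23` receives the
power `4 * Nat.size n` of `s * m * n`. -/
def powerCode : Code :=
  seq (fillCode 32 (.sub (.const 1) (.add (.sub (cell 11) (cell 12)) (.sub (cell 12) (cell 11)))))
    (seq (assign 23 (.const 0) (.const 1))
      (seq (assign 25 (.const 0) (cell 0))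
        (loop 15 (.ite (cell 25) powerStep (assign 25 (.const 0) (cell 25))))))

lemma exec_powerStep (h : Loaded M W H t r s) {A Z : Matrix (Fin n) (Fin n) (ZMod W)}
    (hA : Holds M 31 A) (hZ : Holds M 32 Z) :
    Holds (powerStep.exec M) 32 (Z * A) ∧
      ((powerStep.exec M 23 0 : ℕ) : ZMod W) = (M 23 0 : ℕ) * ((s * H.ncard * n : ℕ) : ZMod W) ^ 4 ∧
      powerStep.exec M 25 0 = M 25 0 / 2 := by
  set M₁ := (mulCode 33 32 (.read 31 (idx (cell 13) (cell 12)))).exec M with hM₁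
  set M₂ := (fillCode 32 (.read 33 (idx (cell 11) (cell 12)))).exec M₁ with hM₂
  have h1 : Loaded M₁ W H t r s := h.exec (by simp [banks, mulCode, fillSumCode, sumCode])
    (by simp [banks, mulCode, fillSumCode, sumCode]) (by simp [banks, mulCode, fillSumCode, sumCode])
    (by simp [banks, mulCode, fillSumCode, sumCode]) (by simp [banks, mulCode, fillSumCode, sumCode])
  have h2 : Loaded M₂ W H t r s := h1.exec (by simp [banks, fillCode])
    (by simp [banks, fillCode]) (by simp [banks, fillCode])
    (by simp [banks, fillCode]) (by simp [banks, fillCode])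
  have e1 : Holds M₁ 33 (Z * A) :=
    exec_mulCode h.toReduced (by decide) (by decide) (by decide) hZ hA
  have e2 : Holds M₂ 32 (Z * A) := by
    refine exec_fillCode h1.toReduced (by decide) _ _ fun j k M' hr hag hj hk => ?_
    simp only [Expr.eval, eval_idx hr.size_eq, hj, hk, hag 33 (by decide)]
    exact e1 j k
  have e23 : M₂ 23 = M 23 := by
    rw [hM₂, exec_of_notMem (by simp [banks, fillCode]), hM₁,
      exec_of_notMem (by simp [banks, mulCode, fillSumCode, sumCode])]
  have e25 : M₂ 25 = M 25 := by
    rw [hM₂, exec_of_notMem (by simp [banks, fillCode]), hM₁,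
      exec_of_notMem (by simp [banks, mulCode, fillSumCode, sumCode])]
  refine ⟨?_, ?_, ?_⟩
  · intro j k
    rw [← e2 j k]
    simp only [powerStep, exec, ← hM₁, ← hM₂]
    rw [setCell_of_ne (by decide), setCell_of_ne (by decide)]
  · have := cast_exec_assign h2.modulus_eq 23 (.const 0) (.mul (cell 23)
          (.mul (.mul (.mul lengthMulCount (cell 0)) (.mul lengthMulCount (cell 0)))
            (.mul (.mul lengthMulCount (cell 0)) (.mul lengthMulCount (cell 0)))))
    have e3 : powerStep.exec M 23 0 = (assign 23 (.const 0) (.mul (cell 23)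
          (.mul (.mul (.mul lengthMulCount (cell 0)) (.mul lengthMulCount (cell 0)))
            (.mul (.mul lengthMulCount (cell 0)) (.mul lengthMulCount (cell 0)))))).exec M₂ 23 0 := by
      simp only [powerStep, exec, ← hM₁, ← hM₂]
      rw [setCell_of_ne (by decide)]
    rw [e3]
    simp only [Expr.eval] at this ⊢
    rw [this]
    simp only [lengthMulCount, Expr.eval, h2.size_eq, h2.length_eq, h2.count_eq, e23]
    push_cast
    ring
  · simp only [powerStep, exec, ← hM₁, ← hM₂, Expr.eval, setCell_same, if_true,
      setCell_of_ne (show 25 ≠ 23 by decide), setCell_of_ne (show 3 ≠ 23 by decide), e25,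
      h2.modulus_eq]
    refine Nat.mod_eq_of_lt (lt_of_le_of_lt (Nat.div_le_self _ _) ?_)
    exact h.cell_lt 25 (by decide) (by decide) 0

/-- Repeated halving of `n` is used as a clock: among the `n` rounds of the power loop exactly the
first `n.size` multiply. -/
lemma div_two_pow_eq_zero_iff (n i : ℕ) : n / 2 ^ i = 0 ↔ n.size ≤ i := by
  rw [Nat.div_eq_zero_iff, Nat.size_le]
  simp

lemma size_le_self (n : ℕ) : n.size ≤ n := Nat.size_le.2 Nat.lt_two_pow_self

lemma exec_powerCode (h : Loaded M W H t r s) {A : Matrix (Fin n) (Fin n) (ZMod W)}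
    (hA : Holds M 31 A) :
    Holds (powerCode.exec M) 32 (A ^ n.size) ∧
      ((powerCode.exec M 23 0 : ℕ) : ZMod W) = ((s * H.ncard * n : ℕ) : ZMod W) ^ (4 * n.size) := by
  set M₁ := (fillCode 32 (.sub (.const 1) (.add (.sub (cell 11) (cell 12))
    (.sub (cell 12) (cell 11))))).exec M with hM₁
  set M₂ := (assign 23 (.const 0) (.const 1)).exec M₁ with hM₂
  set M₃ := (assign 25 (.const 0) (cell 0)).exec M₂ with hM₃
  have h1 : Loaded M₁ W H t r s := h.exec (by simp [banks, fillCode])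
    (by simp [banks, fillCode]) (by simp [banks, fillCode])
    (by simp [banks, fillCode]) (by simp [banks, fillCode])
  have h2 : Loaded M₂ W H t r s := h1.exec (by simp [banks]) (by simp [banks]) (by simp [banks])
    (by simp [banks]) (by simp [banks])
  have h3 : Loaded M₃ W H t r s := h2.exec (by simp [banks]) (by simp [banks]) (by simp [banks])
    (by simp [banks]) (by simp [banks])
  have e1 : Holds M₁ 32 (1 : Matrix (Fin n) (Fin n) (ZMod W)) := by
    refine exec_fillCode h.toReduced (by decide) _ _ fun j k M' hr hag hj hk => ?_
    -- With truncated subtraction, `(j - k) + (k - j)` is the distance of `j` and `k`; hence the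
    -- entries of the identity matrix.
    simp only [Expr.eval, hj, hk, Matrix.one_apply]
    rcases lt_trichotomy (j : ℕ) k with hjk | hjk | hjk
    · rw [if_neg (fun hc => by rw [hc] at hjk; omega)]
      have : 1 - ((j : ℕ) - k + (k - j)) = 0 := by omega
      rw [this, Nat.cast_zero]
    · rw [if_pos (Fin.ext hjk), hjk]; simp
    · rw [if_neg (fun hc => by rw [hc] at hjk; omega)]
      have : 1 - ((j : ℕ) - k + (k - j)) = 0 := by omega
      rw [this, Nat.cast_zero]
  have e32 : M₃ 32 = M₁ 32 := by
    rw [hM₃, exec_of_notMem (by simp [banks]), hM₂, exec_of_notMem (by simp [banks])]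
  have e31 : M₃ 31 = M 31 := by
    rw [hM₃, exec_of_notMem (by simp [banks]), hM₂, exec_of_notMem (by simp [banks]), hM₁,
      exec_of_notMem (by simp [banks, fillCode])]
  have e23 : ((M₃ 23 0 : ℕ) : ZMod W) = 1 := by
    have := cast_exec_assign h1.modulus_eq 23 (.const 0) (.const 1)
    rw [hM₃, exec_of_notMem (by simp [banks]), hM₂]
    simp only [Expr.eval, Nat.cast_one] at this
    exact this
  have e25 : M₃ 25 0 = n := by
    simp only [hM₃, exec, Expr.eval, setCell_same, if_true, h2.size_eq, h2.modulus_eq]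
    exact Nat.mod_eq_of_lt h.size_lt
  have hb : (loop 15 (.ite (cell 25) powerStep (assign 25 (.const 0) (cell 25)))).banks =
    [15, 11, 12, 27, 13, 27, 33, 11, 12, 32, 23, 25, 25] := rfl
  -- The invariant has the exponent `min i n.size`: it is frozen once bank `25` reaches zero.
  have key := exec_loop_induction h3.toReduced (v := 15)
    (p := .ite (cell 25) powerStep (assign 25 (.const 0) (cell 25)))
    (by rw [hb]; decide) (by rw [hb]; decide)
    (fun i M' => Holds M' 32 (A ^ (min i n.size)) ∧ ((M' 23 0 : ℕ) : ZMod W) =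
      ((s * H.ncard * n : ℕ) : ZMod W) ^ (4 * min i n.size) ∧ M' 25 0 = n / 2 ^ i)
    (fun i M' x hM' => ?_) ⟨?_, ?_, ?_⟩ (fun i hi M' hr hag _ hM' => ?_)
  · have e : powerCode.exec M =
      (loop 15 (.ite (cell 25) powerStep (assign 25 (.const 0) (cell 25)))).exec M₃ := rfl
    rw [min_eq_right (size_le_self n)] at key
    rw [e]
    exact ⟨key.1, key.2.1⟩
  · refine ⟨fun j k => ?_, ?_, ?_⟩
    · rw [setCell_of_ne (by decide)]; exact hM'.1 j k
    · rw [setCell_of_ne (by decide)]; exact hM'.2.1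
    · rw [setCell_of_ne (by decide)]; exact hM'.2.2
  · intro j k; rw [e32]; simpa using e1 j k
  · simpa using e23
  · simpa using e25
  · obtain ⟨p1, p2, p3⟩ := hM'
    have hL : Loaded M' W H t r s := h3.congr hr (hag 1 (by rw [hb]; decide))
      (hag 20 (by rw [hb]; decide)) (hag 21 (by rw [hb]; decide))
    by_cases h0 : M' 25 0 = 0
    · have hsz : n.size ≤ i := by rwa [p3, div_two_pow_eq_zero_iff] at h0
      have e : (Code.ite (cell 25) powerStep (assign 25 (.const 0) (cell 25))).exec M' =
          setCell M' 25 0 (M' 25 0 % M' 3 0) := by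
        rw [exec, if_pos (show (cell 25).eval M' = 0 from h0)]; rfl
      rw [e, min_eq_right (by omega : n.size ≤ i + 1)]
      rw [min_eq_right hsz] at p1 p2
      refine ⟨fun j k => ?_, ?_, ?_⟩
      · rw [setCell_of_ne (by decide)]; exact p1 j k
      · rw [setCell_of_ne (by decide)]; exact p2
      · rw [setCell_same, if_pos rfl, h0, Nat.zero_mod]
        exact ((div_two_pow_eq_zero_iff n (i + 1)).2 (by omega)).symm
    · have hsz : i < n.size := by
        by_contra hc
        exact h0 (by rw [p3, div_two_pow_eq_zero_iff]; omega)
      have e : (Code.ite (cell 25) powerStep (assign 25 (.const 0) (cell 25))).exec M' =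
          powerStep.exec M' := by
        rw [exec, if_neg (show (cell 25).eval M' ≠ 0 from h0)]
      have hA' : Holds M' 31 A := fun j k => by
        rw [hag 31 (by rw [hb]; decide), e31]; exact hA j k
      obtain ⟨q1, q2, q3⟩ := exec_powerStep hL hA' p1
      rw [min_eq_left hsz.le] at q1 p2
      rw [e, min_eq_left (by omega : i + 1 ≤ n.size)]
      refine ⟨?_, ?_, ?_⟩
      · rw [pow_succ]; exact q1
      · rw [q2, p2, ← pow_add]; ring_nf
      · rw [q3, p3, Nat.div_div_eq_div_mul, pow_succ]

/-- Store the sum of the squared entries of the matrix in bank `32` in bank `24`. -/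
def frobeniusCode : Code :=
  seq (assign 24 (.const 0) (.const 0)) (loop 11 (loop 12 (assign 24 (.const 0)
    (.add (cell 24) (.mul (.read 32 (idx (cell 11) (cell 12)))
      (.read 32 (idx (cell 11) (cell 12))))))))

lemma exec_frobeniusCode (h : Reduced M n W) {A : Matrix (Fin n) (Fin n) (ZMod W)}
    (hA : Holds M 32 A) :
    ((frobeniusCode.exec M 24 0 : ℕ) : ZMod W) = ∑ j, ∑ k, A j k ^ 2 := by
  have h1 : Reduced ((assign 24 (.const 0) (.const 0)).exec M) n W :=
    h.exec (by simp [banks]) (by simp [banks])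
  have h32 : (assign 24 (.const 0) (.const 0)).exec M 32 = M 32 := exec_of_notMem (by simp [banks]) M
  rw [frobeniusCode, exec, exec_loop_add h1 (by simp [banks]) (by simp [banks]) (by decide)
    fun j => ∑ k, A j k ^ 2]
  · have := cast_exec_assign h.modulus_eq 24 (.const 0) (.const 0)
    simp only [Expr.eval] at this
    rw [this, Nat.cast_zero, zero_add]
  · intro j M' hr hag hj
    refine exec_loop_add hr (by simp [banks]) (by simp [banks]) (by decide) _
      fun k M'' hr' hag' hk => ?_
    have h2 := cast_exec_assign hr'.modulus_eq 24 (.const 0)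
      (.add (cell 24) (.mul (.read 32 (idx (cell 11) (cell 12)))
      (.read 32 (idx (cell 11) (cell 12)))))
    simp only [Expr.eval] at h2
    rw [h2, Nat.cast_add, eval_idx hr'.size_eq]
    simp only [Expr.eval, hk, hag' 11 (by simp [banks]), hj, hag' 32 (by simp [banks]),
      hag 32 (by simp [banks]), h32]
    rw [Nat.cast_mul, hA j k, sq]

end Checks


/-! ### Tested quantities lie below the modulus -/

section Bounds

variable {n : ℕ} {H : Hypergraph3 n} {s : ℕ}

lemma edge_le_one (H : Hypergraph3 n) (U : Fin 3 → Fin n) : edge H U ≤ 1 := by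
  unfold edge; split_ifs <;> simp

lemma ncard_le (H : Hypergraph3 n) : H.ncard ≤ n ^ 3 := by
  rw [← sum_edge]
  refine (Finset.sum_le_sum fun U _ => edge_le_one H U).trans (le_of_eq ?_)
  simp

lemma degree_le (H : Hypergraph3 n) (c : Fin 3) (v : Fin n) : degree H c v ≤ n ^ 2 := by
  refine (Finset.sum_le_sum fun j _ => Finset.sum_le_sum fun k _ => edge_le_one H _).trans
    (le_of_eq ?_)
  simp [sq]

lemma windowCount_le (H : Hypergraph3 n) (c : Fin 3) (s : ℕ) (a j k : Fin n) :
    windowCount H c s a j k ≤ s := by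
  refine (Finset.sum_le_sum fun l _ => edge_le_one H _).trans (le_of_eq ?_)
  simp

lemma abs_centeredMatrix_le (hs : s ≤ n) (c : Fin 3) (a j k : Fin n) :
    |centeredMatrix H c s a j k| ≤ 100 * (n : ℤ) ^ 4 := by
  have h1 : (windowCount H c s a j k : ℤ) ≤ n := by
    exact_mod_cast (windowCount_le H c s a j k).trans hs
  have h2 : (H.ncard : ℤ) ≤ n ^ 3 := by exact_mod_cast ncard_le H
  have hs' : (s : ℤ) ≤ n := by exact_mod_cast hs
  have h3 : (n : ℤ) ^ 3 * windowCount H c s a j k ≤ n ^ 3 * n :=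
    mul_le_mul_of_nonneg_left h1 (by positivity)
  have h4 : (s : ℤ) * H.ncard ≤ n * n ^ 3 := mul_le_mul hs' h2 (by positivity) (by positivity)
  have h5 : (0 : ℤ) ≤ (n : ℤ) ^ 3 * windowCount H c s a j k := by positivity
  have h6 : (0 : ℤ) ≤ (s : ℤ) * H.ncard := by positivity
  rw [centeredMatrix, Matrix.of_apply, abs_mul, abs_of_pos (by norm_num : (0 : ℤ) < 100)]
  refine mul_le_mul_of_nonneg_left (abs_le.2 ⟨?_, ?_⟩) (by norm_num) <;> nlinarith

lemma abs_mul_apply_le {A B : Matrix (Fin n) (Fin n) ℤ} {x y : ℤ} (hx0 : 0 ≤ x)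
    (hA : ∀ j k, |A j k| ≤ x) (hB : ∀ j k, |B j k| ≤ y) (j k : Fin n) :
    |(A * B) j k| ≤ n * (x * y) := by
  rw [Matrix.mul_apply]
  refine (Finset.abs_sum_le_sum_abs _ _).trans ?_
  refine (Finset.sum_le_sum (g := fun _ => x * y) fun l _ => ?_).trans (le_of_eq (by simp))
  rw [abs_mul]
  exact mul_le_mul (hA j l) (hB l k) (abs_nonneg _) hx0

open scoped Matrix in
-- The entries of `B` are at most `100n⁴`, and each multiplication by `B * Bᵀ` costs a factor of at
-- most `10000n¹⁰`. With `k = n.size` and `n ≤ 2 ^ k` the sum is at most `2 ^ (20k² + 30k)`, and `k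
-- ≤ n`.
lemma moment_lt (hs : s ≤ n) (c : Fin 3) (a : Fin n) :
    ∑ j, ∑ k, ((centeredMatrix H c s a * (centeredMatrix H c s a)ᵀ) ^ n.size) j k ^ 2 <
      (2 : ℤ) ^ (50 * n ^ 2 + 1) := by
  set B := centeredMatrix H c s a
  have hn : 0 < n := Fin.pos a
  have hB : ∀ j k, |B j k| ≤ 100 * (n : ℤ) ^ 4 := abs_centeredMatrix_le hs c a
  have hG : ∀ j k, |(B * Bᵀ) j k| ≤ n * (100 * (n : ℤ) ^ 4 * (100 * (n : ℤ) ^ 4)) :=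
    abs_mul_apply_le (by positivity) hB fun j k => hB k j
  have hP : ∀ i : ℕ, ∀ j k, |((B * Bᵀ) ^ i) j k| ≤ (10000 * (n : ℤ) ^ 10) ^ i := by
    intro i
    induction i with
    | zero =>
      intro j k
      rw [pow_zero, pow_zero, Matrix.one_apply]
      split_ifs <;> simp
    | succ i ih =>
      intro j k
      rw [pow_succ]
      refine (abs_mul_apply_le (by positivity) ih hG j k).trans (le_of_eq ?_)
      ring
  have hk : 0 < n.size := Nat.size_pos.2 hn
  have hkn := size_le_self n
  have hn2 : (n : ℤ) ≤ 2 ^ n.size := by exact_mod_cast (Nat.lt_size_self n).le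
  have h1 : 10000 * (n : ℤ) ^ 10 ≤ 2 ^ (14 + 10 * n.size) := by
    rw [pow_add, mul_comm 10, pow_mul]
    gcongr
    norm_num
  have h2 : ∀ j k, ((B * Bᵀ) ^ n.size) j k ^ 2 ≤ (2 : ℤ) ^ ((14 + 10 * n.size) * n.size * 2) := by
    intro j k
    rw [← sq_abs, pow_mul, pow_mul]
    gcongr
    exact (hP n.size j k).trans (by gcongr)
  calc ∑ j, ∑ k, ((B * Bᵀ) ^ n.size) j k ^ 2
      ≤ ∑ _j : Fin n, ∑ _k : Fin n, (2 : ℤ) ^ ((14 + 10 * n.size) * n.size * 2) :=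
        Finset.sum_le_sum fun j _ => Finset.sum_le_sum fun k _ => h2 j k
    _ = (n : ℤ) * (n * (2 : ℤ) ^ ((14 + 10 * n.size) * n.size * 2)) := by simp
    _ ≤ 2 ^ n.size * (2 ^ n.size * (2 : ℤ) ^ ((14 + 10 * n.size) * n.size * 2)) := by gcongr
    _ = 2 ^ (n.size + (n.size + (14 + 10 * n.size) * n.size * 2)) := by rw [pow_add, pow_add]
    _ < 2 ^ (50 * n ^ 2 + 1) := by
        refine pow_lt_pow_right₀ (by norm_num) ?_
        nlinarith

lemma length_pow_lt (hn : 0 < n) (hs : s ≤ n) :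
    (s * H.ncard * n) ^ (4 * n.size) < 2 ^ (50 * n ^ 2 + 1) := by
  have hkn := size_le_self n
  have hn2 : n ≤ 2 ^ n.size := (Nat.lt_size_self n).le
  have hk : 0 < n.size := Nat.size_pos.2 hn
  calc (s * H.ncard * n) ^ (4 * n.size) ≤ (n * n ^ 3 * n) ^ (4 * n.size) := by
        gcongr; exact ncard_le H
    _ = (n ^ 5) ^ (4 * n.size) := by ring_nf
    _ ≤ ((2 ^ n.size) ^ 5) ^ (4 * n.size) := by gcongr
    _ = 2 ^ (n.size * 5 * (4 * n.size)) := by rw [← pow_mul, ← pow_mul, mul_assoc]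
    _ < _ := Nat.pow_lt_pow_right (by norm_num) (by nlinarith)

lemma pow_three_lt (n : ℕ) : n ^ 3 < 2 ^ (50 * n ^ 2 + 1) := by
  have hn2 : n ≤ 2 ^ n := Nat.lt_two_pow_self.le
  calc n ^ 3 ≤ (2 ^ n) ^ 3 := by gcongr
    _ = 2 ^ (n * 3) := by rw [← pow_mul]
    _ < _ := Nat.pow_lt_pow_right (by norm_num) (by nlinarith)

end Bounds

/-! ### Deciding the certificate -/

section Decision

open RAM Code

variable {n W : ℕ} {M : Memory} {H : Hypergraph3 n} {t r s : ℕ}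

/-- Test the moment condition for the window that starts at the counter in bank `14`. -/
def momentCode (c : Fin 3) : Code :=
  seq (windowCode c) (seq (mulCode 31 30 (.read 30 (idx (cell 12) (cell 13))))
    (seq powerCode (seq frobeniusCode (flagCode (.sub (cell 24) (cell 23))))))

lemma banks_momentCode (c : Fin 3) : (momentCode c).banks = [11, 12, 27, 13, 27, 30, 11, 12, 27, 13,
    27, 31, 11, 12, 32, 23, 25, 15, 11, 12, 27, 13, 27, 33, 11, 12, 32, 23, 25, 25, 24, 11, 12, 24,
    22] := rfl

open scoped Matrix in
-- Both sides of the moment inequality are computed only modulo `W`, but both lie in `[0, W)`, so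
-- the stored residues are the true values and comparing them is exact.
lemma exec_momentCode (hW : W = 2 ^ (50 * n ^ 2 + 1)) (h : Loaded M W H t r s) (hs : s ≤ n)
    (c : Fin 3) {a : Fin n} (ha : M 14 0 = a) :
    (momentCode c).exec M 22 0 = 0 ↔ M 22 0 = 0 ∧
      ∑ j, ∑ k, ((centeredMatrix H c s a * (centeredMatrix H c s a)ᵀ) ^ n.size) j k ^ 2 ≤
      ((s * H.ncard * n : ℕ) : ℤ) ^ (4 * n.size) := by
  have hn : 0 < n := Fin.pos a
  set S : ℤ := ∑ j, ∑ k, ((centeredMatrix H c s a * (centeredMatrix H c s a)ᵀ) ^ n.size) j k ^ 2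
    with hS
  set M₁ := (windowCode c).exec M with hM₁
  set M₂ := (mulCode 31 30 (.read 30 (idx (cell 12) (cell 13)))).exec M₁ with hM₂
  set M₃ := powerCode.exec M₂ with hM₃
  set M₄ := frobeniusCode.exec M₃ with hM₄
  have b1 : (windowCode c).banks = [11, 12, 27, 13, 27, 30] := rfl
  have b2 : (mulCode 31 30 (.read 30 (idx (cell 12) (cell 13)))).banks =
    [11, 12, 27, 13, 27, 31] := rfl
  have b3 : powerCode.banks = [11, 12, 32, 23, 25, 15, 11, 12, 27, 13, 27, 33, 11, 12, 32, 23, 25,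
    25] := rfl
  have b4 : frobeniusCode.banks = [24, 11, 12, 24] := rfl
  have h1 : Loaded M₁ W H t r s := h.exec (by rw [b1]; decide) (by rw [b1]; decide)
    (by rw [b1]; decide) (by rw [b1]; decide) (by rw [b1]; decide)
  have h2 : Loaded M₂ W H t r s := h1.exec (by rw [b2]; decide) (by rw [b2]; decide)
    (by rw [b2]; decide) (by rw [b2]; decide) (by rw [b2]; decide)
  have h3 : Loaded M₃ W H t r s := h2.exec (by rw [b3]; decide) (by rw [b3]; decide)
    (by rw [b3]; decide) (by rw [b3]; decide) (by rw [b3]; decide)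
  have h4 : Loaded M₄ W H t r s := h3.exec (by rw [b4]; decide) (by rw [b4]; decide)
    (by rw [b4]; decide) (by rw [b4]; decide) (by rw [b4]; decide)
  have e1 := exec_windowCode h hs c ha
  rw [← hM₁] at e1
  have e2 := exec_mulCode_transpose h1.toReduced (d := 31) (by decide) (by decide) (by decide) e1 e1
  rw [← hM₂] at e2
  obtain ⟨e3, e3'⟩ := exec_powerCode h2 e2
  rw [← hM₃] at e3 e3'
  have e4 := exec_frobeniusCode h3.toReduced e3
  rw [← hM₄] at e4
  have e5 : (momentCode c).exec M = (flagCode (.sub (cell 24) (cell 23))).exec M₄ := rfl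
  have f22 : M₄ 22 = M 22 := by
    rw [hM₄, exec_of_notMem (by rw [b4]; decide), hM₃, exec_of_notMem (by rw [b3]; decide), hM₂,
      exec_of_notMem (by rw [b2]; decide), hM₁, exec_of_notMem (by rw [b1]; decide)]
  have f23 : M₄ 23 = M₃ 23 := by rw [hM₄, exec_of_notMem (by rw [b4]; decide)]
  have hS0 : 0 ≤ S := by positivity
  have hSW : S < (W : ℤ) := by rw [hW]; push_cast; exact moment_lt hs c a
  have hcast : ((centeredMatrix H c s a).map (Int.castRingHom (ZMod W)) *
      ((centeredMatrix H c s a).map (Int.castRingHom (ZMod W)))ᵀ) ^ n.size =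
      ((centeredMatrix H c s a * (centeredMatrix H c s a)ᵀ) ^ n.size).map
        (Int.castRingHom (ZMod W)) := by
    have := map_pow (RingHom.mapMatrix (m := Fin n) (Int.castRingHom (ZMod W)))
      (centeredMatrix H c s a * (centeredMatrix H c s a)ᵀ) n.size
    rw [map_mul] at this
    exact this.symm
  have g24 : M₄ 24 0 = S.toNat := by
    refine eq_of_cast_eq (h4.cell_lt 24 (by decide) (by decide) 0) (by omega) ?_
    rw [e4, hcast]
    have : ((S.toNat : ℕ) : ZMod W) = ((S.toNat : ℤ) : ZMod W) := by norm_cast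
    rw [this, Int.toNat_of_nonneg hS0, hS]
    push_cast
    rfl
  have g23 : M₄ 23 0 = (s * H.ncard * n) ^ (4 * n.size) := by
    refine eq_of_cast_eq (h4.cell_lt 23 (by decide) (by decide) 0) ?_ ?_
    · rw [hW]; exact length_pow_lt hn hs
    · rw [f23, e3', Nat.cast_pow]
  rw [e5, exec_flagCode h4.toReduced hn, f22]
  simp only [Expr.eval, g24, g23]
  rw [Nat.sub_eq_zero_iff_le, Int.toNat_le, Nat.cast_pow]

/-- Test the degree of the vertex that is the counter in bank `10`. -/
def degreeCode (c : Fin 3) : Code :=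
  seq (assign 26 (.const 0) (.const 0)) (seq (loop 11 (loop 12 (assign 26 (.const 0)
    (.add (cell 26) (adjacency c (cell 10) (cell 11) (cell 12))))))
      (flagCode (.sub (.mul (.const 99) (cell 20)) (.mul (.mul (.const 100) (cell 0)) (cell 26)))))

lemma exec_degreeCode (hW : W = 2 ^ (50 * n ^ 2 + 1)) (h : Loaded M W H t r s)
    (c : Fin 3) {v : Fin n} (hv : M 10 0 = v) :
    (degreeCode c).exec M 22 0 = 0 ↔ M 22 0 = 0 ∧ 99 * H.ncard ≤ 100 * n * degree H c v := by
  have hn : 0 < n := Fin.pos v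
  set q := loop 11 (loop 12 (assign 26 (.const 0)
    (.add (cell 26) (adjacency c (cell 10) (cell 11) (cell 12))))) with hq
  set M₁ := (assign 26 (.const 0) (.const 0)).exec M with hM₁
  set M₂ := q.exec M₁ with hM₂
  have b2 : q.banks = [11, 12, 26] := rfl
  have h1 : Loaded M₁ W H t r s := h.exec (by simp [banks]) (by simp [banks]) (by simp [banks])
    (by simp [banks]) (by simp [banks])
  have h2 : Loaded M₂ W H t r s := h1.exec (by rw [b2]; decide) (by rw [b2]; decide)
    (by rw [b2]; decide) (by rw [b2]; decide) (by rw [b2]; decide)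
  have hv1 : M₁ 10 0 = v := by rw [hM₁, exec_of_notMem (by simp [banks]), hv]
  have e0 : ((M₁ 26 0 : ℕ) : ZMod W) = 0 := by
    have := cast_exec_assign h.modulus_eq 26 (.const 0) (.const 0)
    simpa only [Expr.eval, Nat.cast_zero] using this
  have e1 : ((M₂ 26 0 : ℕ) : ZMod W) = (degree H c v : ℕ) := by
    rw [hM₂, hq, exec_loop_add h1.toReduced (by simp [banks]) (by simp [banks]) (by decide)
      (fun j => ∑ k, ((edge H (place c v j k) : ℕ) : ZMod W)), e0, zero_add]
    · simp [degree]
    · intro j M' hr hag hj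
      refine exec_loop_add hr (by simp [banks]) (by simp [banks]) (by decide) _
        fun k M'' hr' hag' hk => ?_
      have h2 := cast_exec_assign hr'.modulus_eq 26 (.const 0)
        (.add (cell 26) (adjacency c (cell 10) (cell 11) (cell 12)))
      have h3 := eval_adjacency (M := M'') (H := H) (t := t) (r := r) hr'.size_eq
        (by rw [hag' 1 (by simp [banks]), hag 1 (by simp [banks]), h1.tensor_eq]) c
        (x := cell 10) (y := cell 11) (z := cell 12) (i := v) (j := j) (k := k)
        (by simp only [Expr.eval]; rw [hag' 10 (by simp [banks]), hag 10 (by simp [banks]), hv1])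
        (by simp only [Expr.eval]; rw [hag' 11 (by simp [banks]), hj])
        (by simp only [Expr.eval]; rw [hk])
      simp only [Expr.eval, h3] at h2
      rw [h2, Nat.cast_add]
  have g26 : M₂ 26 0 = degree H c v := by
    refine eq_of_cast_eq (h2.cell_lt 26 (by decide) (by decide) 0) ?_ e1
    refine (degree_le H c v).trans_lt (lt_of_le_of_lt ?_ (hW ▸ pow_three_lt n))
    exact Nat.pow_le_pow_right hn (by norm_num)
  have f22 : M₂ 22 = M 22 := by
    rw [hM₂, exec_of_notMem (by rw [b2]; decide), hM₁, exec_of_notMem (by simp [banks])]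
  have e5 : (degreeCode c).exec M = (flagCode (.sub (.mul (.const 99) (cell 20))
    (.mul (.mul (.const 100) (cell 0)) (cell 26)))).exec M₂ := rfl
  rw [e5, exec_flagCode h2.toReduced hn, f22]
  simp only [Expr.eval, g26, h2.count_eq, h2.size_eq]
  rw [Nat.sub_eq_zero_iff_le]

/-- All tests for the position `c`. -/
def positionCode (c : Fin 3) : Code :=
  seq (loop 10 (degreeCode c)) (loop 14 (momentCode c))

/-- The tests for the position `c` succeed. -/
def PositionCertified (H : Hypergraph3 n) (s : ℕ) (c : Fin 3) : Prop :=
  (∀ v, 99 * H.ncard ≤ 100 * n * degree H c v) ∧ ∀ a, ∑ j, ∑ k,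
    ((centeredMatrix H c s a * (centeredMatrix H c s a).transpose) ^ n.size) j k ^ 2 ≤
      ((s * H.ncard * n : ℕ) : ℤ) ^ (4 * n.size)

lemma banks_loop_degreeCode (c : Fin 3) :
    (loop 10 (degreeCode c)).banks = [10, 26, 11, 12, 26, 22] := rfl

lemma banks_loop_momentCode (c : Fin 3) :
    (loop 14 (momentCode c)).banks = 14 :: (momentCode c).banks := rfl

lemma banks_positionCode (c : Fin 3) : (positionCode c).banks =
    [10, 26, 11, 12, 26, 22] ++ 14 :: (momentCode c).banks := rfl

lemma Loaded.exec_positionCode (h : Loaded M W H t r s) (c : Fin 3) :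
    Loaded ((positionCode c).exec M) W H t r s := by
  apply h.exec <;> rw [banks_positionCode, banks_momentCode] <;> decide

lemma exec_positionCode (hW : W = 2 ^ (50 * n ^ 2 + 1)) (h : Loaded M W H t r s) (hs : s ≤ n)
    (c : Fin 3) : (positionCode c).exec M 22 0 = 0 ↔ M 22 0 = 0 ∧ PositionCertified H s c := by
  have h1 : Loaded ((loop 10 (degreeCode c)).exec M) W H t r s := by
    apply h.exec <;> rw [banks_loop_degreeCode] <;> decide
  rw [positionCode, exec, exec_loop_flag h1.toReduced
    (by rw [banks_loop_momentCode, banks_momentCode]; decide)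
    (by rw [banks_loop_momentCode, banks_momentCode]; decide) (by decide) _
    (fun a M' hr hag ha => exec_momentCode hW (h1.congr hr
      (hag 1 (by rw [banks_loop_momentCode, banks_momentCode]; decide))
      (hag 20 (by rw [banks_loop_momentCode, banks_momentCode]; decide))
      (hag 21 (by rw [banks_loop_momentCode, banks_momentCode]; decide))) hs c ha),
    exec_loop_flag h.toReduced (by rw [banks_loop_degreeCode]; decide)
    (by rw [banks_loop_degreeCode]; decide) (by decide) _
    (fun v M' hr hag hv => exec_degreeCode hW (h.congr hr
      (hag 1 (by rw [banks_loop_degreeCode]; decide))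
      (hag 20 (by rw [banks_loop_degreeCode]; decide))
      (hag 21 (by rw [banks_loop_degreeCode]; decide))) c hv), and_assoc]
  rfl

/-- Store the number of hyperedges in bank `20`. -/
def countCode : Code :=
  seq (assign 20 (.const 0) (.const 0)) (loop 10 (loop 11 (loop 12 (assign 20 (.const 0)
    (.add (cell 20) (adjacency 0 (cell 10) (cell 11) (cell 12)))))))

lemma exec_countCode (hW : W = 2 ^ (50 * n ^ 2 + 1)) (h : Reduced M n W)
    (h1 : M 1 = inputMemory n H t r 1) : countCode.exec M 20 0 = H.ncard := by
  have hr : Reduced (countCode.exec M) n W := h.exec (by simp [banks, countCode])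
    (by simp [banks, countCode])
  refine eq_of_cast_eq (hr.cell_lt 20 (by decide) (by decide) 0)
    ((ncard_le H).trans_lt (hW ▸ pow_three_lt n)) ?_
  have h2 : Reduced ((assign 20 (.const 0) (.const 0)).exec M) n W :=
    h.exec (by simp [banks]) (by simp [banks])
  have e0 : (((assign 20 (.const 0) (.const 0)).exec M 20 0 : ℕ) : ZMod W) = 0 := by
    have := cast_exec_assign h.modulus_eq 20 (.const 0) (.const 0)
    simpa only [Expr.eval, Nat.cast_zero] using this
  rw [countCode, exec, exec_loop_add h2 (by simp [banks]) (by simp [banks]) (by decide)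
    (fun i => ∑ j, ∑ k, ((edge H (place 0 i j k) : ℕ) : ZMod W)), e0, zero_add]
  · rw [← sum_edge, sum_eq_sum_place 0]; simp
  · intro i M' hr hag hi
    refine exec_loop_add hr (by simp [banks]) (by simp [banks]) (by decide) _
      fun j M'' hr' hag' hj => ?_
    refine exec_loop_add hr' (by simp [banks]) (by simp [banks]) (by decide) _
      fun k M''' hr'' hag'' hk => ?_
    have h2 := cast_exec_assign hr''.modulus_eq 20 (.const 0)
      (.add (cell 20) (adjacency 0 (cell 10) (cell 11) (cell 12)))
    have h3 := eval_adjacency (M := M''') (H := H) (t := t) (r := r) hr''.size_eq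
      (by rw [hag'' 1 (by simp [banks]), hag' 1 (by simp [banks]), hag 1 (by simp [banks]),
        exec_of_notMem (by simp [banks]), h1]) 0
      (x := cell 10) (y := cell 11) (z := cell 12) (i := i) (j := j) (k := k)
      (by simp only [Expr.eval]; rw [hag'' 10 (by simp [banks]), hag' 10 (by simp [banks]), hi])
      (by simp only [Expr.eval]; rw [hag'' 11 (by simp [banks]), hj])
      (by simp only [Expr.eval]; rw [hk])
    simp only [Expr.eval, h3] at h2
    rw [h2, Nat.cast_add]

end Decision


/-! ### Output and correctness of the whole program -/

section Output

open RAM Code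

variable {n W : ℕ} {M : Memory} {H : Hypergraph3 n} {t r s : ℕ}

/-- Store `2 ^ n` in bank `2`. -/
def trivialCode : Code :=
  seq (assign 2 (.const 0) (.const 1)) (loop 10 (assign 2 (.const 0) (.mul (.const 2) (cell 2))))

lemma exec_trivialCode (h : Reduced M n W) (hW : 2 ^ n < W) : trivialCode.exec M 2 0 = 2 ^ n := by
  have h1 : Reduced ((assign 2 (.const 0) (.const 1)).exec M) n W :=
    h.exec (by simp [banks]) (by simp [banks])
  rw [trivialCode, exec]
  refine exec_loop_induction h1 (by simp [banks]) (by simp [banks]) (fun i M' => M' 2 0 = 2 ^ i)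
    (fun i M' x hM' => by rw [setCell_of_ne (by decide)]; exact hM') ?_ fun i hi M' hr _ _ hP => ?_
  · have : 1 ≤ 2 ^ n := Nat.one_le_two_pow
    simp only [exec, Expr.eval, setCell_same, if_true, h.modulus_eq, pow_zero]
    exact Nat.mod_eq_of_lt (by omega)
  · have h2 : 2 ^ (i + 1) ≤ 2 ^ n := Nat.pow_le_pow_right two_pos hi
    simp only [exec, Expr.eval, setCell_same, if_true, hr.modulus_eq, hP]
    rw [← pow_succ', Nat.mod_eq_of_lt (by omega)]

/-- Store `n * 2 ^ s` in bank `2`. -/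
def sparseCode : Code :=
  seq (assign 2 (.const 0) (cell 0)) (loop 10 (assign 2 (.const 0) (.add (cell 2)
    (.mul (cell 2) (.sub (.const 1) (.sub (.const 1) (.sub (cell 21) (cell 10))))))))

/-- The loop has `n` rounds, but the indicator of `i < s` lets only the first `s` of them double the
value. -/
lemma exec_sparseCode (h : Loaded M W H t r s) (hs : s ≤ n) (hW : n * 2 ^ n < W) :
    sparseCode.exec M 2 0 = n * 2 ^ s := by
  have h1 : Loaded ((assign 2 (.const 0) (cell 0)).exec M) W H t r s :=
    h.exec (by simp [banks]) (by simp [banks]) (by simp [banks]) (by simp [banks]) (by simp [banks])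
  have key := exec_loop_induction (v := 10) (p := assign 2 (.const 0) (.add (cell 2)
    (.mul (cell 2) (.sub (.const 1) (.sub (.const 1) (.sub (cell 21) (cell 10)))))))
    h1.toReduced (by simp [banks]) (by simp [banks])
    (fun i M' => M' 2 0 = n * 2 ^ min i s)
    (fun i M' x hM' => by rw [setCell_of_ne (by decide)]; exact hM') ?_
    fun i hi M' hr hag hc hP => ?_
  · rw [min_eq_right hs] at key
    exact key
  · have := h.size_lt
    simp only [exec, Expr.eval, setCell_same, if_true, h.modulus_eq, h.size_eq]
    simp [Nat.mod_eq_of_lt this]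
  · have h21 : M' 21 0 = s := by rw [hag 21 (by simp [banks]), h1.length_eq]
    have h2 : n * 2 ^ min (i + 1) s ≤ n * 2 ^ n :=
      Nat.mul_le_mul_left _ (Nat.pow_le_pow_right two_pos ((min_le_right _ _).trans hs))
    simp only [exec, Expr.eval, setCell_same, if_true, hr.modulus_eq, hP, h21, hc]
    rcases lt_or_ge i s with hlt | hge
    · have h3 : 1 - (1 - (s - i)) = 1 := by omega
      have h4 : n * 2 ^ min i s + n * 2 ^ min i s * 1 = n * 2 ^ min (i + 1) s := by
        rw [min_eq_left hlt.le, min_eq_left (by omega : i + 1 ≤ s)]; ring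
      rw [h3, h4, Nat.mod_eq_of_lt (by omega)]
    · have h3 : 1 - (1 - (s - i)) = 0 := by omega
      have h4 : min i s = min (i + 1) s := by omega
      rw [h3, mul_zero, add_zero, h4, Nat.mod_eq_of_lt (by omega)]

/-- Zero if and only if the certificate is valid. -/
def failure : Expr :=
  .add (cell 22) (.add (.sub (.const 1) (cell 21)) (.add (.sub (.const 1) (cell 20))
    (.add (.sub (.mul (.const 1000) (.read 0 (.const 1))) (cell 20))
      (.sub (.add (.const 1) (.mul (.read 0 (.const 1)) (cell 0)))
        (.mul (.add (.read 0 (.const 2)) (.const 1)) (cell 20))))))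

/-- The certification program for the window length `σ`, with output computed by `out`. -/
def certifyCode (σ : Expr) (out : Code) : Code :=
  seq countCode (seq (assign 21 (.const 0) σ) (seq (assign 22 (.const 0) (.const 0))
    (seq (positionCode 0) (seq (positionCode 1) (seq (positionCode 2)
      (ite failure trivialCode out))))))

lemma certified_iff : Certified H s ↔ 0 < s ∧ 0 < H.ncard ∧ ∀ c, PositionCertified H s c := by
  simp only [Certified, PositionCertified]
  exact ⟨fun h => ⟨h.1, h.2.1, fun c => ⟨h.2.2.1 c, h.2.2.2 c⟩⟩,
    fun h => ⟨h.1, h.2.1, fun c => (h.2.2 c).1, fun c => (h.2.2 c).2⟩⟩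

/-- The computed window length has to agree with `σ n r` only for `n > 0`: for `n = 0` there are no
hyperedges, and the condition `t * n < (r + 1) * m` fails for every window length. -/
lemma exec_certifyCode (hW : W = 2 ^ (50 * n ^ 2 + 1)) (h : Reduced M n W)
    (h0 : M 0 = inputMemory n H t r 0) (h1 : M 1 = inputMemory n H t r 1) (hs : s ≤ n)
    {σ N : ℕ → ℕ → ℕ} (hσ : 0 < n → s = σ n r) {σE : Expr} {out : Code}
    (hσE : ∀ M' : Memory, M' 0 = M 0 → σE.eval M' = s)
    (hout : ∀ M' : Memory, Loaded M' W H t r s → out.exec M' 2 0 = N n s) :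
    (certifyCode σE out).exec M 2 0 = windowCertifier σ N n H t r := by
  set M₁ := countCode.exec M with hM₁
  set M₂ := (assign 21 (.const 0) σE).exec M₁ with hM₂
  set M₃ := (assign 22 (.const 0) (.const 0)).exec M₂ with hM₃
  set M₄ := (positionCode 0).exec M₃ with hM₄
  set M₅ := (positionCode 1).exec M₄ with hM₅
  set M₆ := (positionCode 2).exec M₅ with hM₆
  have hsW := h.size_lt
  have b1 : countCode.banks = [20, 10, 11, 12, 20] := rfl
  have r1 : Reduced M₁ n W := h.exec (by rw [b1]; decide) (by rw [b1]; decide)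
  have c1 : M₁ 20 0 = H.ncard := exec_countCode hW h h1
  have l2 : Loaded M₂ W H t r s := by
    refine ⟨r1.exec (by simp [banks]) (by simp [banks]), ?_, ?_, ?_⟩
    · rw [hM₂, exec_of_notMem (by simp [banks]), hM₁, exec_of_notMem (by rw [b1]; decide), h1]
    · rw [hM₂, exec_of_notMem (by simp [banks]), c1]
    · rw [hM₂, exec, Expr.eval, setCell_same, if_pos rfl, r1.modulus_eq, hσE _
        (by rw [hM₁, exec_of_notMem (by rw [b1]; decide)]), Nat.mod_eq_of_lt (by omega)]
  have l3 : Loaded M₃ W H t r s := l2.exec (by simp [banks]) (by simp [banks]) (by simp [banks])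
    (by simp [banks]) (by simp [banks])
  have f3 : M₃ 22 0 = 0 := by
    rw [hM₃, exec, Expr.eval, setCell_same, if_pos rfl, Nat.zero_mod]
  have l4 := l3.exec_positionCode 0
  have l5 := l4.exec_positionCode 1
  have l6 := l5.exec_positionCode 2
  have z4 := exec_positionCode hW l3 hs 0
  have z5 := exec_positionCode hW l4 hs 1
  have z6 := exec_positionCode hW l5 hs 2
  have hflag : M₆ 22 0 = 0 ↔ ∀ c, PositionCertified H s c := by
    rw [z6, z5, z4, f3]
    simp only [Fin.forall_fin_succ, true_and, and_assoc]
    simp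
  have hz : M₆ 0 = inputMemory n H t r 0 := by
    rw [hM₆, exec_of_notMem (by rw [banks_positionCode, banks_momentCode]; decide), hM₅,
      exec_of_notMem (by rw [banks_positionCode, banks_momentCode]; decide), hM₄,
      exec_of_notMem (by rw [banks_positionCode, banks_momentCode]; decide), hM₃,
      exec_of_notMem (by simp [banks]), hM₂, exec_of_notMem (by simp [banks]), hM₁,
      exec_of_notMem (by rw [b1]; decide), h0]
  have e00 : M₆ 0 0 = n := l6.size_eq
  have e01 : M₆ 0 1 = t := by rw [hz]; rfl
  have e02 : M₆ 0 2 = r := by rw [hz]; rfl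
  have e20 : M₆ 20 0 = H.ncard := l6.count_eq
  have e21 : M₆ 21 0 = s := l6.length_eq
  have hfail : failure.eval M₆ = 0 ↔
      Certified H s ∧ 1000 * t ≤ H.ncard ∧ t * n < (r + 1) * H.ncard := by
    rw [certified_iff, ← hflag]
    simp only [failure, Expr.eval, e00, e01, e02, e20, e21]
    omega
  have hiff : (Certified H s ∧ 1000 * t ≤ H.ncard ∧ t * n < (r + 1) * H.ncard) ↔
      (Certified H (σ n r) ∧ 1000 * t ≤ H.ncard ∧ t * n < (r + 1) * H.ncard) := by
    rcases Nat.eq_zero_or_pos n with rfl | hn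
    · have := ncard_le H
      constructor <;> (rintro ⟨-, -, h3⟩; nlinarith)
    · rw [hσ hn]
  have e : (certifyCode σE out).exec M = (ite failure trivialCode out).exec M₆ := rfl
  rw [e, exec, windowCertifier]
  by_cases hc : Certified H s ∧ 1000 * t ≤ H.ncard ∧ t * n < (r + 1) * H.ncard
  · have hn : 0 < n := by
      rcases Nat.eq_zero_or_pos n with rfl | hn
      · have := ncard_le H
        obtain ⟨-, -, h3⟩ := hc
        nlinarith
      · exact hn
    rw [if_pos (hfail.2 hc), if_pos (hiff.1 hc), hout _ l6, hσ hn]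
  · rw [if_neg (fun hc' => hc (hfail.1 hc')), if_neg (fun hc' => hc (hiff.2 hc'))]
    refine exec_trivialCode l6.toReduced ?_
    rw [hW]
    exact Nat.pow_lt_pow_right (by norm_num) (by nlinarith)

end Output

/-! ### Computing the modulus and assembling the machine program -/

section Modulus

open RAM

lemma setCell_comm (M : Memory) {a a' : ℕ} (h : a ≠ a') (i x i' x' : ℕ) :
    setCell (setCell M a i x) a' i' x' = setCell (setCell M a' i' x') a i x := by
  unfold setCell
  rw [Function.update_of_ne h.symm, Function.update_of_ne h, Function.update_comm h]

/-- Store `k * e ^ n` in bank `d`, with the counter in bank `5`. -/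
def powerLoop (d k : ℕ) (e : Expr) : Prog :=
  .seq (.write d (.const 0) (.const k)) (.seq (.write 5 (.const 0) (.const 0))
    (.loop (.sub (cell 0) (cell 5)) (.seq (.write d (.const 0) (.mul (cell d) e))
      (.write 5 (.const 0) (.add (cell 5) (.const 1))))))

/-- The memory after `i` rounds of `powerLoop`. -/
def powerState (M : Memory) (d k f i : ℕ) : Memory := setCell (setCell M d 0 (k * f ^ i)) 5 0 i

/-- This loop runs before a modulus is available, so the sizes are controlled directly: the
intermediate values `k * f ^ i` do not exceed the last one. Two such loops are needed, as the
exponent of the modulus is quadratic in `n`. -/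
lemma exists_run_powerLoop {d : ℕ} (h0 : d ≠ 0) (h5 : d ≠ 5) (k : ℕ) (e : Expr) :
    ∃ Q : Polynomial ℕ, ∀ (M : Memory) (b f : ℕ), Bounded M b → 1 ≤ b → M 0 0 ≤ b → 0 < f →
      k * f ^ M 0 0 < 2 ^ b → (∀ i, e.eval (powerState M d k f i) = f) →
        Bounded (powerState M d k f (M 0 0)) b ∧
        ∃ T ≤ Q.eval b, Run (powerLoop d k e) M (powerState M d k f (M 0 0)) T := by
  set g : Expr := .sub (cell 0) (cell 5) with hg
  set e' : Expr := .mul (cell d) e with he'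
  set inc : Expr := .add (cell 5) (.const 1) with hinc
  set c := costWeight g + costWeight e' + weight e' + costWeight inc + weight inc + 10 with hc
  refine ⟨Polynomial.C c * Polynomial.X * (Polynomial.X + 1) + Polynomial.C (2 * k.size + 10),
    fun M b f hM hb hn hf hlt hev => ?_⟩
  set n := M 0 0 with hndef
  have hsmall : ∀ i ≤ n, i < 2 ^ b := fun i hi => lt_of_le_of_lt (hi.trans hn) Nat.lt_two_pow_self
  have hpow : ∀ i ≤ n, k * f ^ i < 2 ^ b := fun i hi =>
    lt_of_le_of_lt (Nat.mul_le_mul_left _ (Nat.pow_le_pow_right hf hi)) hlt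
  have hB : ∀ i ≤ n, Bounded (powerState M d k f i) b := fun i hi =>
    (hM.setCell (hpow i hi) d 0).setCell (hsmall i hi) 5 0
  have hS0 : ∀ i, powerState M d k f i 0 0 = n := fun i => by
    rw [powerState, setCell_of_ne (by decide), setCell_of_ne h0.symm]
  have hS5 : ∀ i, powerState M d k f i 5 0 = i := fun i => by
    rw [powerState, setCell_same, if_pos rfl]
  have hSd : ∀ i, powerState M d k f i d 0 = k * f ^ i := fun i => by
    rw [powerState, setCell_of_ne h5, setCell_same, if_pos rfl]
  have ec : c * b = costWeight g * b + costWeight e' * b + weight e' * b + costWeight inc * b +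
      weight inc * b + 10 * b := by rw [hc]; ring
  have hloop : ∀ j i, i + j = n → ∃ T ≤ (j + 1) * (c * b),
      Run (.loop g (.seq (.write d (.const 0) e') (.write 5 (.const 0) inc)))
        (powerState M d k f i) (powerState M d k f n) T := fun j => by
    induction j with
    | zero =>
      intro i hi
      have hi' : i = n := by omega
      subst hi'
      refine ⟨_, ?_, Run.loop_done (by simp only [hg, Expr.eval, hS0, hS5]; omega)⟩
      have := cost_le (hB _ le_rfl) hb g
      omega
    | succ j ih =>
      intro i hi
      set S := powerState M d k f i with hS
      have hBi : Bounded S b := hB i (by omega)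
      have z0 : S 0 0 = n := hS0 i
      have z5 : S 5 0 = i := hS5 i
      have zd : S d 0 = k * f ^ i := hSd i
      have ze : e.eval S = f := hev i
      have e1 : e'.eval S = k * f ^ (i + 1) := by
        simp only [he', Expr.eval, zd, ze]; ring
      have w1 := Run.write S d (.const 0) e'
      have hB' : Bounded (setCell S d 0 (k * f ^ (i + 1))) b := hBi.setCell (hpow _ (by omega)) d 0
      have w2 := Run.write (setCell S d 0 (k * f ^ (i + 1))) 5 (.const 0) inc
      have e2 : inc.eval (setCell S d 0 (k * f ^ (i + 1))) = i + 1 := by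
        simp only [hinc, Expr.eval]; rw [setCell_of_ne h5.symm, z5]
      have s1 : Function.update S d (Function.update (S d) (Expr.eval S (.const 0)) (e'.eval S)) =
          setCell S d 0 (k * f ^ (i + 1)) := by rw [e1]; rfl
      have s2 : Function.update (setCell S d 0 (k * f ^ (i + 1))) 5
          (Function.update (setCell S d 0 (k * f ^ (i + 1)) 5)
            (Expr.eval (setCell S d 0 (k * f ^ (i + 1))) (.const 0))
            (inc.eval (setCell S d 0 (k * f ^ (i + 1))))) = powerState M d k f (i + 1) := by
        rw [e2, hS, powerState, setCell_comm _ h5.symm, setCell_setCell]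
        change setCell (setCell _ 5 0 i) 5 0 (i + 1) = _
        rw [setCell_setCell, powerState]
      rw [s1] at w1
      rw [s2] at w2
      obtain ⟨T, hT, hr⟩ := ih (i + 1) (by omega)
      refine ⟨_, ?_, Run.loop_step (by simp only [hg, Expr.eval, z0, z5]; omega)
        (Run.seq w1 w2) hr⟩
      have c1 := cost_le hBi hb g
      have c2 := cost_le hBi hb e'
      have c3 := size_eval_le hBi hb e'
      have c4 := cost_le hB' hb inc
      have c5 := size_eval_le hB' hb inc
      have e3 : (j + 1 + 1) * (c * b) = (j + 1) * (c * b) + c * b := by ring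
      simp only [Expr.cost, Expr.eval, Nat.size_zero]
      omega
  refine ⟨hB _ le_rfl, ?_⟩
  obtain ⟨T, hT, hr⟩ := hloop n 0 (zero_add _)
  have s0 : Function.update (setCell M d 0 k) 5 (Function.update (setCell M d 0 k 5)
      (Expr.eval (setCell M d 0 k) (.const 0)) (Expr.eval (setCell M d 0 k) (.const 0))) =
      powerState M d k f 0 := by
    rw [powerState, pow_zero, mul_one]; rfl
  have w := Run.write (setCell M d 0 k) 5 (.const 0) (.const 0)
  rw [s0] at w
  refine ⟨_, ?_, Run.seq (Run.write M d (.const 0) (.const k)) (Run.seq w hr)⟩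
  have e4 : (n + 1) * (c * b) ≤ (b + 1) * (c * b) := Nat.mul_le_mul_right _ (by omega)
  have e5 : c * b * (b + 1) = (b + 1) * (c * b) := mul_comm _ _
  simp only [Polynomial.eval_add, Polynomial.eval_mul, Polynomial.eval_C, Polynomial.eval_X,
    Polynomial.eval_one, Expr.cost, Expr.eval, Nat.size_zero, e5]
  omega

/-- Store the modulus `2 ^ (50 * n ^ 2 + 1)` in bank `3`. -/
def modulusProg : Prog := .seq (powerLoop 4 1 (.const (2 ^ 50))) (powerLoop 3 2 (cell 4))

/-- The memory in which the certification program starts. -/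
noncomputable def initialMemory (n : ℕ) (H : Hypergraph3 n) (t r : ℕ) : Memory :=
  powerState (powerState (inputMemory n H t r) 4 1 (2 ^ 50) n) 3 2 (2 ^ (50 * n)) n

lemma inputMemory_lt (n : ℕ) (H : Hypergraph3 n) (t r : ℕ) {a : ℕ} (ha : a ≠ 0) (i : ℕ) :
    inputMemory n H t r a i < 2 := by
  unfold inputMemory
  split
  · exact absurd rfl ha
  · exact absurd rfl ha
  · exact absurd rfl ha
  · split_ifs <;> norm_num
  · norm_num

lemma inputMemory_bounded (n : ℕ) (H : Hypergraph3 n) (t r : ℕ) :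
    Bounded (inputMemory n H t r) (n + t.size + r.size + 1) := by
  intro a i
  have h2 : 2 ≤ 2 ^ (n + t.size + r.size + 1) := by
    rw [pow_succ]; have := Nat.one_le_two_pow (n := n + t.size + r.size); omega
  rcases eq_or_ne a 0 with rfl | ha
  · match i with
    | 0 => exact (Nat.lt_two_pow_self (n := n)).trans_le (Nat.pow_le_pow_right two_pos (by omega))
    | 1 => exact (Nat.lt_size_self t).trans_le (Nat.pow_le_pow_right two_pos (by omega))
    | 2 => exact (Nat.lt_size_self r).trans_le (Nat.pow_le_pow_right two_pos (by omega))
    | i + 3 => exact lt_of_lt_of_le (by simp [inputMemory]) h2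
  · exact (inputMemory_lt n H t r ha i).trans_le h2

lemma initialMemory_of_notMem (n : ℕ) (H : Hypergraph3 n) (t r : ℕ) {a : ℕ} (ha : a ∉ [3, 4, 5]) :
    initialMemory n H t r a = inputMemory n H t r a := by
  simp only [List.mem_cons, List.not_mem_nil, or_false, not_or] at ha
  rw [initialMemory, powerState, setCell_of_ne ha.2.2, setCell_of_ne ha.1, powerState,
    setCell_of_ne ha.2.2, setCell_of_ne ha.2.1]

lemma initialMemory_reduced (n : ℕ) (H : Hypergraph3 n) (t r : ℕ) :
    Reduced (initialMemory n H t r) n (2 ^ (50 * n ^ 2 + 1)) := by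
  have hn : n < 2 ^ (50 * n ^ 2 + 1) :=
    Nat.lt_two_pow_self.trans_le (Nat.pow_le_pow_right two_pos (by nlinarith))
  have h4 : 1 * (2 ^ 50) ^ n < 2 ^ (50 * n ^ 2 + 1) := by
    rw [one_mul, ← pow_mul]
    exact Nat.pow_lt_pow_right (by norm_num) (by have := Nat.le_self_pow two_ne_zero n; omega)
  refine ⟨?_, ?_, hn, fun a h0 h3 i => ?_⟩
  · rw [initialMemory_of_notMem n H t r (by decide)]; rfl
  -- The second loop yields `2 * (2 ^ (50n)) ^ n`.
  · rw [initialMemory, powerState, setCell_of_ne (by decide), setCell_same, if_pos rfl, ← pow_mul,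
      ← pow_succ']
    ring_nf
  · rw [initialMemory, powerState]
    -- The summand `1` in the exponent makes the modulus at least `2` even for `n = 0`, so it
    -- exceeds the entries of the adjacency tensor.
    have h1 : ∀ i, inputMemory n H t r a i < 2 ^ (50 * n ^ 2 + 1) := fun i =>
      (inputMemory_lt n H t r h0 i).trans_le (Nat.le_self_pow (by omega) 2)
    rcases eq_or_ne a 5 with rfl | h5
    · rw [setCell_same]
      split_ifs
      · exact hn
      · rw [setCell_of_ne h3, powerState, setCell_same]
        split_ifs
        rw [setCell_of_ne (by decide)]
        exact h1 i
    · rw [setCell_of_ne h5, setCell_of_ne h3, powerState, setCell_of_ne h5]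
      rcases eq_or_ne a 4 with rfl | h4'
      · rw [setCell_same]
        split_ifs
        · exact h4
        · exact h1 i
      · rw [setCell_of_ne h4']; exact h1 i

/-- A structured program that starts in the memory `initialMemory` runs in polynomial time on
machines. -/
theorem isPolyTime_of_code {p : Code} (hd : p.Disciplined) (h0 : 0 ∉ p.banks) (h3 : 3 ∉ p.banks)
    {𝒜 : Certifier} (h𝒜 : ∀ (n : ℕ) (H : Hypergraph3 n) (t r : ℕ),
      p.exec (initialMemory n H t r) 2 0 = 𝒜 n H t r) : 𝒜.IsPolyTime := by
  obtain ⟨Q₁, hQ₁⟩ := exists_run_powerLoop (d := 4) (by decide) (by decide) 1 (.const (2 ^ 50))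
  obtain ⟨Q₂, hQ₂⟩ := exists_run_powerLoop (d := 3) (by decide) (by decide) 2 (cell 4)
  obtain ⟨Q₃, hQ₃⟩ := Code.exists_run hd h0 h3
  refine ⟨.seq modulusProg p.compile, (Q₁ + Q₂ + Q₃).comp
    (Polynomial.C 50 * Polynomial.X ^ 2 + Polynomial.X + Polynomial.C 2), fun n H t r => ?_⟩
  set x := n + t.size + r.size with hx
  -- One bit bound for everything: it covers the inputs `n`, `t`, `r` as well as the modulus, and is
  -- polynomial in the input size.
  set b := 50 * x ^ 2 + x + 2 with hb
  have hnx : 50 * n ^ 2 + n ≤ 50 * x ^ 2 + x := by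
    have : n ≤ x := by omega
    gcongr
  have hnb : n ≤ b := by omega
  have hlt : ∀ y, y < b → 2 ^ y < 2 ^ b := fun y hy => Nat.pow_lt_pow_right (by norm_num) hy
  have hM : Bounded (inputMemory n H t r) b := fun a i =>
    (inputMemory_bounded n H t r a i).trans_le (Nat.pow_le_pow_right two_pos (by omega))
  obtain ⟨B₁, T₁, hT₁, r₁⟩ := hQ₁ (inputMemory n H t r) b (2 ^ 50) hM (by omega) hnb (by norm_num)
    (by
      rw [one_mul, ← pow_mul]
      refine hlt _ ?_
      have := Nat.le_self_pow two_ne_zero n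
      change 50 * n < b
      omega) (fun i => rfl)
  have e1 : inputMemory n H t r 0 0 = n := rfl
  rw [e1] at B₁ r₁
  set M₁ := powerState (inputMemory n H t r) 4 1 (2 ^ 50) n with hM₁
  have e2 : M₁ 0 0 = n := by
    rw [hM₁, powerState, setCell_of_ne (by decide), setCell_of_ne (by decide), e1]
  obtain ⟨B₂, T₂, hT₂, r₂⟩ := hQ₂ M₁ b (2 ^ (50 * n)) B₁ (by omega) (by rw [e2]; exact hnb)
    (by positivity)
    (by
      rw [e2, ← pow_mul, ← pow_succ']
      refine hlt _ ?_
      have : 50 * n * n = 50 * n ^ 2 := by ring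
      omega)
    (fun i => by
      rw [powerState, Expr.eval, setCell_of_ne (by decide), setCell_of_ne (by decide), hM₁,
        powerState, setCell_of_ne (by decide), Expr.eval, setCell_same, if_pos rfl, one_mul,
        ← pow_mul])
  rw [e2] at B₂ r₂
  have hred := initialMemory_reduced n H t r
  obtain ⟨-, T₃, hT₃, r₃⟩ := hQ₃ (initialMemory n H t r) b B₂ (by omega)
    (by rw [hred.size_eq]; exact hnb) (by rw [hred.modulus_eq]; positivity)
  refine ⟨_, _, Run.seq (Run.seq r₁ r₂) r₃, h𝒜 n H t r, ?_⟩
  simp only [Polynomial.eval_comp, Polynomial.eval_add, Polynomial.eval_mul, Polynomial.eval_C,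
    Polynomial.eval_X, Polynomial.eval_pow]
  rw [← hb]
  omega

end Modulus

/-! ### The two certifiers run in polynomial time -/

section PolynomialTime

open RAM Code

lemma certifyCode_disciplined (σ : Expr) {out : Code} (h : out.Disciplined) :
    (certifyCode σ out).Disciplined := by
  simp [certifyCode, countCode, positionCode, degreeCode, momentCode, windowCode, mulCode,
    fillSumCode, sumCode, powerCode, powerStep, frobeniusCode, flagCode, trivialCode, fillCode,
    Disciplined, banks, h]

lemma banks_certifyCode (σ : Expr) (out : Code) : (certifyCode σ out).banks =
    countCode.banks ++ ([21] ++ ([22] ++ ((positionCode 0).banks ++ ((positionCode 1).banks ++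
      ((positionCode 2).banks ++ (trivialCode.banks ++ out.banks)))))) := rfl

lemma notMem_banks_certifyCode (σ : Expr) {out : Code} {a : ℕ} (ha : a = 0 ∨ a = 3)
    (h : a ∉ out.banks) : a ∉ (certifyCode σ out).banks := by
  simp only [banks_certifyCode, List.mem_append, not_or, banks_positionCode, banks_momentCode, h]
  rcases ha with rfl | rfl <;> simp [countCode, trivialCode, banks]

/-- The expression for `windowLength n r`. -/
def windowLengthExpr : Expr :=
  .sub (cell 0) (.sub (cell 0) (.add (.div (.mul (.add (.read 0 (.const 2)) (.const 1))
    (.add (.read 0 (.const 2)) (.const 1))) (cell 0)) (.const 1)))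

lemma isPolyTime_windowCertifier_sparse :
    (windowCertifier windowLength fun n s => n * 2 ^ s).IsPolyTime := by
  refine isPolyTime_of_code (p := certifyCode windowLengthExpr sparseCode)
    (certifyCode_disciplined _ (by simp [sparseCode, Disciplined, banks]))
    (notMem_banks_certifyCode _ (by simp) (by simp [sparseCode, banks]))
    (notMem_banks_certifyCode _ (by simp) (by simp [sparseCode, banks])) fun n H t r => ?_
  have h0 := initialMemory_of_notMem n H t r (a := 0) (by decide)
  have h1 := initialMemory_of_notMem n H t r (a := 1) (by decide)
  have hs : windowLength n r ≤ n := min_le_left _ _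
  refine exec_certifyCode rfl (initialMemory_reduced n H t r) h0 h1 hs (fun _ => rfl)
    (fun M' hM' => ?_) fun M' hM' => exec_sparseCode hM' hs ?_
  · simp only [windowLengthExpr, Expr.eval, hM', h0, inputMemory, windowLength]
    rw [← sq]
    -- What remains is `n - (n - (y + 1)) = min n (y + 1)` for truncated subtraction.
    generalize (r + 1) ^ 2 / n = y
    omega
  · calc n * 2 ^ n ≤ 2 ^ n * 2 ^ n := Nat.mul_le_mul_right _ Nat.lt_two_pow_self.le
      _ = 2 ^ (n + n) := (pow_add _ _ _).symm
      _ < _ := Nat.pow_lt_pow_right (by norm_num) (by nlinarith)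

lemma isPolyTime_windowCertifier_dense :
    (windowCertifier (fun _ _ => 1) fun _ _ => 1).IsPolyTime := by
  refine isPolyTime_of_code (p := certifyCode (.sub (.const 1) (.sub (.const 1) (cell 0)))
      (assign 2 (.const 0) (.const 1)))
    (certifyCode_disciplined _ trivial)
    (notMem_banks_certifyCode _ (by simp) (by simp [banks]))
    (notMem_banks_certifyCode _ (by simp) (by simp [banks])) fun n H t r => ?_
  have h0 := initialMemory_of_notMem n H t r (a := 0) (by decide)
  have h1 := initialMemory_of_notMem n H t r (a := 1) (by decide)
  -- The program uses `min 1 n` instead of `1`, so that the window length never exceeds `n`; the two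
  -- agree for `n > 0`.
  refine exec_certifyCode (s := 1 - (1 - n)) rfl (initialMemory_reduced n H t r) h0 h1 (by omega)
    (fun hn => by omega) (fun M' hM' => ?_) fun M' hM' => ?_
  · simp only [Expr.eval, hM', h0, inputMemory]
  · rw [exec, Expr.eval, setCell_same, if_pos rfl, hM'.modulus_eq, Expr.eval]
    exact Nat.mod_eq_of_lt (Nat.one_lt_two_pow (by omega))

end PolynomialTime

end XORCert

theorem mainTheorem5 :
    ∃ η₀ : ℝ, 0 < η₀ ∧ ∃ C : ℝ, 0 < C ∧ ∀ δ : ℝ, 0 < δ → δ < 2 →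
      ∃ 𝒜 : Certifier, 𝒜.IsPolyTime ∧ 𝒜.IsSound ∧
        ∀ K : ℕ, ∀ᶠ n : ℕ in Filter.atTop, ∀ η : ℝ, 0 ≤ η → η ≤ η₀ →
          let Δ : ℝ := (n : ℝ) ^ δ
          let θ : ℝ := clusterScale n Δ η
          1 - 1 / (n : ℝ) ^ K ≤
            (randomHypergraph3 n (Δ * n)).real
              {H | (𝒜 n H ⌊η * (H.ncard : ℝ)⌋₊ ⌊θ * n / 2⌋₊ : ℝ) ≤
                Real.exp (C * (θ ^ 2 * Real.log (1 / θ)) * n)} := by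
  -- The value of `η₀` guarantees the tested condition `1000 * t ≤ m`; `5` is the constant of the
  -- sparse bound, and any positive constant would serve in the dense case.
  refine ⟨1 / 1000, by norm_num, 5, by norm_num, fun δ hδ hδ2 => ?_⟩
  rcases le_or_gt δ 1 with h | h
  · exact ⟨_, XORCert.isPolyTime_windowCertifier_sparse, XORCert.isSound_windowCertifier_sparse _,
      fun K => XORCert.eventually_sparse_bound hδ h K⟩
  · exact ⟨_, XORCert.isPolyTime_windowCertifier_dense, XORCert.isSound_windowCertifier_dense,
      fun K => XORCert.eventually_dense_bound h hδ2 K⟩
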